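/- A \emph{convex surface} in $\mathbb R^3$ is the boundary of a closed (not necessarily bounded) convex set $K\subset\mathbb R^3$ with nonempty interior; it is called smooth and \emph{strongly convex} if it is a $C^\infty$ surface and its principal curvatures with respect to the outer normal (signed so that those of the unit sphere are $+1$) are positive at every point. A \emph{minimizing geodesic} $\gamma\colon[a,b]\to\Sigma$, $a<b$, is a curve with constant positive speed in $\Sigma$ that is shortest among all continuous curves in $\Sigma$ with the same endpoints. The \emph{total curvature} $\Phi(\gamma)$ of a curve $\gamma$ is the supremum of the sums of exterior angles of polygonal lines inscribed in $\gamma$. \textbf{Proposition.} For every $\varepsilon>0$ there is $\delta>0$ such that the following holds. If $\gamma\colon[a,b]\to\Sigma$ is a minimizing geodesic on a smooth strongly convex surface $\Sigma$ in $\mathbb R^3$, then there are an interval $[a',b']\subset[a,b]$ with $a'<b'$ and a unit vector $u\in\mathbb R^3$ such that \[\Phi(\gamma|_{[a',b']})>\delta\cdot\Phi(\gamma),\] and, for every $t\in[a',b']$, the velocity $\dot\gamma(t)$ (one-sided at $a$ and $b$) exists, is nonzero, and satisfies \[\angle(\dot\gamma(t),u)<\varepsilon .\] Moreover, for $\varepsilon=\tfrac1{10}$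 one may take $\delta=\tfrac1{100^{100}}$. -/

import Mathlib

open Set
open scoped ContDiff ENNReal NNReal

/-- Euclidean 3-space. -/
abbrev E3 : Type := EuclideanSpace ℝ (Fin 3)

/-! ### Smooth strongly convex surfaces -/

/-- `f` is a smooth defining function of `K` on the open set `U`: it is smooth on `U`, its gradient
does not vanish there, and `K` coincides with `{f ≤ 0}` in `U`. Consequently the boundary of `K` in
`U` is the regular level set `{f = 0}`, and the gradient of `f` on it points out of `K`. -/
structure IsDefiningFunctionOn (K U : Set E3) (f : E3 → ℝ) : Prop where
  isOpen : IsOpen U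
  contDiffOn : ContDiffOn ℝ ∞ f U
  gradient_ne_zero : ∀ x ∈ U, gradient f x ≠ 0
  mem_iff : ∀ x ∈ U, (x ∈ K ↔ f x ≤ 0)

/-- The normalized gradient of `f`; for a defining function of `K` its restriction to the boundary
of `K` is the outer unit normal (the Gauss map). -/
noncomputable def unitNormal (f : E3 → ℝ) (x : E3) : E3 :=
  ‖gradient f x‖⁻¹ • gradient f x

/-- The boundary of `K` is a smooth surface. -/
def HasSmoothBoundary (K : Set E3) : Prop :=
  ∀ p ∈ frontier K, ∃ U : Set E3, ∃ f : E3 → ℝ, p ∈ U ∧ IsDefiningFunctionOn K U f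

/-- `κ` is a principal curvature of the boundary of `K` at `p`: an eigenvalue, on the tangent plane
at `p`, of the shape operator `v ↦ D_v ν`, where `ν` is the outer unit normal. With this sign
convention the unit sphere (the boundary of the unit ball) has principal curvatures `1`. -/
def IsPrincipalCurvature (K : Set E3) (p : E3) (κ : ℝ) : Prop :=
  ∃ U : Set E3, ∃ f : E3 → ℝ, p ∈ U ∧ IsDefiningFunctionOn K U f ∧
    ∃ v : E3, v ≠ 0 ∧ inner ℝ (unitNormal f p) v = 0 ∧ fderiv ℝ (unitNormal f) p v = κ • v

/-- `S` is a smooth strongly convex surface: the boundary of a closed convex set with nonempty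
interior which is smooth and has positive principal curvatures at every point. It need not be
compact. -/
def IsSmoothStronglyConvexSurface (S : Set E3) : Prop :=
  ∃ K : Set E3, IsClosed K ∧ Convex ℝ K ∧ (interior K).Nonempty ∧ S = frontier K ∧
    HasSmoothBoundary K ∧ ∀ p ∈ S, ∀ κ : ℝ, IsPrincipalCurvature K p κ → 0 < κ

/-! ### Minimizing geodesics -/

/-- `γ : [a, b] → S` is a (nonconstant) minimizing geodesic on `S`: it is parametrized with constant
positive speed (proportionally to arc length), and it is a shortest curve among all continuous
curves in `S` with the same endpoints. No differentiability of `γ` is assumed. -/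
structure IsMinimizingGeodesic (S : Set E3) (γ : ℝ → E3) (a b : ℝ) : Prop where
  lt : a < b
  continuousOn : ContinuousOn γ (Icc a b)
  mapsTo : MapsTo γ (Icc a b) S
  constantSpeed : ∃ c : ℝ≥0, 0 < c ∧ HasConstantSpeedOnWith γ (Icc a b) c
  minimizing : ∀ σ : ℝ → E3, ContinuousOn σ (Icc a b) → MapsTo σ (Icc a b) S →
    σ a = γ a → σ b = γ b → eVariationOn γ (Icc a b) ≤ eVariationOn σ (Icc a b)

/-! ### Total curvature -/

/-- `t 0 < t 1 < ⋯ < t (n + 1)` are parameters in `[a, b]` of the successive vertices of a polygonal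
line with nondegenerate edges inscribed in `γ`. It has `n` interior vertices. -/
structure IsInscribedPolygon (γ : ℝ → E3) (a b : ℝ) (n : ℕ) (t : ℕ → ℝ) : Prop where
  mem : ∀ i ≤ n + 1, t i ∈ Icc a b
  lt : ∀ i ≤ n, t i < t (i + 1)
  ne : ∀ i ≤ n, γ (t i) ≠ γ (t (i + 1))

/-- The sum of the exterior angles of the polygonal line with vertices
`γ (t 0), …, γ (t (n + 1))`. -/
noncomputable def sumExteriorAngles (γ : ℝ → E3) (n : ℕ) (t : ℕ → ℝ) : ℝ :=
  ∑ i ∈ Finset.range n,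
    InnerProductGeometry.angle (γ (t (i + 1)) - γ (t i)) (γ (t (i + 2)) - γ (t (i + 1)))

/-- The total curvature of `γ` restricted to `[a, b]`: the supremum of the sums of exterior angles
of the inscribed polygonal lines. -/
noncomputable def totalCurvature (γ : ℝ → E3) (a b : ℝ) : ℝ≥0∞ :=
  ⨆ (n : ℕ) (t : ℕ → ℝ) (_ : IsInscribedPolygon γ a b n t),
    ENNReal.ofReal (sumExteriorAngles γ n t)

/-! ### Arcs in almost constant direction -/

/-- Every minimizing geodesic on a smooth strongly convex surface has a subarc which carries more
than the fraction `δ` of the total curvature, and on which the velocity exists, is nonzero and makes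
an angle less than `ε` with a fixed unit vector. (The derivative is one-sided at `a` and `b`.) -/
def HasAlmostConstantArcs (ε δ : ℝ) : Prop :=
  ∀ (S : Set E3), IsSmoothStronglyConvexSurface S →
    ∀ (γ : ℝ → E3) (a b : ℝ), IsMinimizingGeodesic S γ a b →
      ∃ a' b' : ℝ, a ≤ a' ∧ a' < b' ∧ b' ≤ b ∧
        ENNReal.ofReal δ * totalCurvature γ a b < totalCurvature γ a' b' ∧
        ∃ u : E3, ‖u‖ = 1 ∧ ∀ t ∈ Icc a' b', ∃ v : E3,
          HasDerivWithinAt γ v (Icc a b) t ∧ v ≠ 0 ∧ InnerProductGeometry.angle v u < ε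

/-! ### Competitors outside of a convex body -/

/-! Let `K` be the body, `c` the speed and `g` the velocity of `γ`. Nearest-point retraction onto
`K` is nonexpansive, so an arc of `γ` is no longer than any path outside `interior K` with the same
ends (`IsMinimizingGeodesic.le_of_isJoinedBy`). All information about `γ` comes from such
competitors.

Regularity. Raising the midpoint of a chord above two supporting planes shows that arcs exceed their
chords only to third order. Hence `γ` is locally almost affine and `g` exists and is continuous.
First variation along tangent fields then gives the geodesic equation: the acceleration `A` is a
negative multiple of the outer normal, so it points into `K` and, by strong convexity, never
vanishes (`exists_acceleration`).

Reduction. The total curvature of an arc lies between `1 / c` and `4π / c` times the variation of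
`g` on it (`eVariationOn_velocity_le`, `totalCurvature_le`). It remains to find an arc of almost
constant direction carrying a definite part of this variation. One half of `[a, b]` carries at least
half of it; by reversal let it be the first half `[a, m]`.

Thin or fat. Put `κ = (ε / 40) ^ 2` and test at the dyadic scales `R = c (m - a) / 2 ^ j` whether
the part of `K` in the `R`-ball about `γ a` lies within `κ R` of a line through `γ a`.

If it does, then by convexity `K` is thin at all larger scales. A detour beside the body shows that
arcs from `γ a` are nearly as short as their chords, so beyond length `R` and up to `m` the velocity
is nearly parallel to the line (`exists_angle_lt_of_isThinAt`).

If it does not, `K` contains a fat triangle with vertex `γ a`. As `A` has nonnegative product with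
the vectors from `γ` to its vertices, the part of `A` in the plane of the triangle is at most a
constant times `-⟪γ - o, A⟫`, with `o` the centroid. Up to length `2R` the integral of this is
bounded by a multiple of `c`. Pigeonholing gives a subarc where the planar part of `g` is almost
constant; since `‖g‖ = c`, so is `g` (`exists_angle_lt_of_not_isThinAt`).

At the first fat scale the preceding scale is thin, and the two cases together cover `[a, m]`. If
every scale is thin, the uncovered initial arc can be made so short that its variation is
negligible. -/

/-- A closed convex set is a nonexpansive retract, and the points outside of its interior are
retracted to its boundary. -/
theorem exists_nonexpansive_retraction {K : Set E3} (hc : IsClosed K) (hK : Convex ℝ K)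
    (hne : K.Nonempty) :
    ∃ π : E3 → E3, (∀ x ∈ K, π x = x) ∧ (∀ x y, ‖π x - π y‖ ≤ ‖x - y‖) ∧
      ∀ x ∉ interior K, π x ∈ frontier K := by
  choose π hπ hmin using fun x => exists_norm_eq_iInf_of_complete_convex hne hc.isComplete hK x
  have hin : ∀ x, ∀ w ∈ K, inner ℝ (x - π x) (w - π x) ≤ 0 := fun x =>
    (norm_eq_iInf_iff_real_inner_le_zero hK (hπ x)).1 (hmin x)
  have hfix : ∀ x ∈ K, π x = x := fun x hx => by
    have h := hin x x hx
    rw [real_inner_self_eq_norm_sq] at h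
    have : ‖x - π x‖ = 0 := by nlinarith [norm_nonneg (x - π x)]
    exact (sub_eq_zero.1 (norm_eq_zero.1 this)).symm
  refine ⟨π, hfix, fun x y => ?_, fun x hx => ?_⟩
  · have h1 := hin x (π y) (hπ y)
    have h2 := hin y (π x) (hπ x)
    have h3 : ‖π x - π y‖ ^ 2 ≤ inner ℝ (x - y) (π x - π y) := by
      rw [← real_inner_self_eq_norm_sq]
      have e : inner ℝ (x - y) (π x - π y) - inner ℝ (π x - π y) (π x - π y) =
          - inner ℝ (x - π x) (π y - π x) - inner ℝ (y - π y) (π x - π y) := by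
        rw [← neg_sub (π x) (π y), inner_neg_right]
        simp only [inner_sub_left]
        ring
      linarith
    have h4 := real_inner_le_norm (x - y) (π x - π y)
    by_contra! hlt
    nlinarith [norm_nonneg (x - y), norm_nonneg (π x - π y)]
  · refine ⟨subset_closure (hπ x), fun hint => ?_⟩
    -- A small step from an interior point `π x` towards `x` would stay in `K`, against the
    -- variational inequality for the projection.
    have hxK : x ∉ K := fun hxK => hx (by rwa [hfix x hxK] at hint)
    have hne : x - π x ≠ 0 := fun h => hxK (by rw [sub_eq_zero.1 h]; exact hπ x)
    have hcont : Filter.Tendsto (fun s : ℝ => π x + s • (x - π x)) (nhdsWithin 0 (Ioi 0))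
        (nhds (π x)) := by
      have : Continuous fun s : ℝ => π x + s • (x - π x) := by fun_prop
      simpa using (this.tendsto 0).mono_left nhdsWithin_le_nhds
    have hev := hcont.eventually (mem_interior_iff_mem_nhds.1 hint)
    obtain ⟨s, hs, hs0⟩ := (hev.and self_mem_nhdsWithin).exists
    have h := hin x _ hs
    rw [add_sub_cancel_left, inner_smul_right, real_inner_self_eq_norm_sq] at h
    have : 0 < ‖x - π x‖ := norm_pos_iff.2 hne
    have hs0 : 0 < s := hs0
    nlinarith [mul_pos hs0 (pow_pos this 2)]

theorem eVariationOn_le_ofReal_of_norm_sub_le {σ : ℝ → E3} {Ψ : ℝ → ℝ} {s t : ℝ} (hst : s ≤ t)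
    (h : ∀ x ∈ Icc s t, ∀ y ∈ Icc s t, x ≤ y → ‖σ y - σ x‖ ≤ Ψ y - Ψ x) :
    eVariationOn σ (Icc s t) ≤ ENNReal.ofReal (Ψ t - Ψ s) := by
  have hmono : MonotoneOn Ψ (Icc s t) := fun x hx y hy hxy => by
    linarith [h x hx y hy hxy, norm_nonneg (σ y - σ x)]
  have hΨ := hmono.eVariationOn_eq (left_mem_Icc.2 hst) (right_mem_Icc.2 hst)
  rw [inter_self] at hΨ
  rw [← hΨ]
  refine iSup_mono fun p => Finset.sum_le_sum fun i _ => ?_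
  have h1 := h _ (p.2.2.2 i) _ (p.2.2.2 (i + 1)) (p.2.2.1 i.le_succ)
  rw [edist_dist, edist_dist]
  refine ENNReal.ofReal_le_ofReal ?_
  rw [dist_eq_norm, Real.dist_eq]
  exact h1.trans (le_abs_self _)

/-- The points `x` and `y` are joined in `C` by a path parametrized by `[s, t]` whose length is at
most `L`. -/
def IsJoinedBy (C : Set E3) (s t : ℝ) (x y : E3) (L : ℝ≥0∞) : Prop :=
  ∃ σ : ℝ → E3, ContinuousOn σ (Icc s t) ∧ MapsTo σ (Icc s t) C ∧ σ s = x ∧ σ t = y ∧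
    eVariationOn σ (Icc s t) ≤ L

theorem IsJoinedBy.trans {C : Set E3} {s m t : ℝ} {x y z : E3} {L M : ℝ≥0∞} (hsm : s ≤ m)
    (hmt : m ≤ t) (h₁ : IsJoinedBy C s m x y L) (h₂ : IsJoinedBy C m t y z M) :
    IsJoinedBy C s t x z (L + M) := by
  obtain ⟨σ, hσ, hσC, hσs, hσm, hσL⟩ := h₁
  obtain ⟨τ, hτ, hτC, hτm, hτt, hτL⟩ := h₂
  have e1 : EqOn (fun r => if r ≤ m then σ r else τ r) σ (Icc s m) := fun r hr => if_pos hr.2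
  have e2 : EqOn (fun r => if r ≤ m then σ r else τ r) τ (Icc m t) := fun r hr => by
    rcases hr.1.eq_or_lt with h | h
    · subst h; simp [hσm, hτm]
    · simp [not_le.2 h]
  refine ⟨fun r => if r ≤ m then σ r else τ r, ?_, ?_, ?_, ?_, ?_⟩
  · rw [← Icc_union_Icc_eq_Icc hsm hmt]
    exact (hσ.congr e1).union_of_isClosed (hτ.congr e2) isClosed_Icc isClosed_Icc
  · rw [← Icc_union_Icc_eq_Icc hsm hmt]
    exact (hσC.congr e1.symm).union (hτC.congr e2.symm)
  · exact (e1 (left_mem_Icc.2 hsm)).trans hσs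
  · exact (e2 (right_mem_Icc.2 hmt)).trans hτt
  · have := eVariationOn.Icc_add_Icc (fun r => if r ≤ m then σ r else τ r) (s := univ) hsm hmt
      (mem_univ _)
    simp only [univ_inter] at this
    rw [← this, eVariationOn.congr e1, eVariationOn.congr e2]
    exact add_le_add hσL hτL

theorem isJoinedBy_of_segment_subset {C : Set E3} {s t : ℝ} {x y : E3} (hst : s < t)
    (h : segment ℝ x y ⊆ C) : IsJoinedBy C s t x y (ENNReal.ofReal ‖y - x‖) := by
  have hts : 0 < t - s := sub_pos.2 hst
  refine ⟨fun r => AffineMap.lineMap x y ((r - s) / (t - s)), ?_, ?_, ?_, ?_, ?_⟩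
  · refine Continuous.continuousOn ?_
    simp only [AffineMap.lineMap_apply]
    fun_prop
  · intro r hr
    refine h ?_
    rw [segment_eq_image_lineMap]
    exact ⟨_, ⟨div_nonneg (sub_nonneg.2 hr.1) hts.le,
      (div_le_one hts).2 (by linarith [hr.2])⟩, rfl⟩
  · simp
  · simp [div_self hts.ne']
  · refine (eVariationOn_le_ofReal_of_norm_sub_le (Ψ := fun r => (r - s) / (t - s) * ‖y - x‖)
      hst.le ?_).trans ?_
    · intro a _ b _ hab
      simp only [AffineMap.lineMap_apply, vsub_eq_sub, vadd_eq_add, add_sub_add_right_eq_sub]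
      rw [← sub_smul, ← sub_mul, norm_smul, Real.norm_eq_abs, abs_of_nonneg]
      have := div_le_div_of_nonneg_right (sub_le_sub_right hab s) hts.le
      linarith
    · simp [div_self hts.ne']

section

variable {K : Set E3} {γ : ℝ → E3} {a b : ℝ} {c : ℝ≥0}

/-- An arc of a minimizing geodesic on the boundary of a convex body is not longer than any path
with the same endpoints outside of the interior of the body. -/
theorem IsMinimizingGeodesic.le_of_isJoinedBy (hcl : IsClosed K) (hK : Convex ℝ K)
    (hγ : IsMinimizingGeodesic (frontier K) γ a b) (hc : HasConstantSpeedOnWith γ (Icc a b) c)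
    {s t : ℝ} (hs : a ≤ s) (hst : s ≤ t) (ht : t ≤ b) {L : ℝ≥0∞}
    (h : IsJoinedBy (interior K)ᶜ s t (γ s) (γ t) L) : ENNReal.ofReal (c * (t - s)) ≤ L := by
  have hfr : frontier K ⊆ K := hcl.frontier_subset
  have hlen : ∀ x y, a ≤ x → x ≤ y → y ≤ b →
      eVariationOn γ (Icc x y) = ENNReal.ofReal (c * (y - x)) := fun x y hx hxy hy => by
    have := hc (x := x) ⟨hx, hxy.trans hy⟩ (y := y) ⟨hx.trans hxy, hy⟩
    rwa [inter_eq_right.2 (Icc_subset_Icc hx hy)] at this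
  have hself : ∀ x y, a ≤ x → x ≤ y → y ≤ b →
      IsJoinedBy (frontier K) x y (γ x) (γ y) (ENNReal.ofReal (c * (y - x))) :=
    fun x y hx hxy hy => ⟨γ, hγ.continuousOn.mono (Icc_subset_Icc hx hy),
      hγ.mapsTo.mono_left (Icc_subset_Icc hx hy), rfl, rfl, (hlen x y hx hxy hy).le⟩
  have hsab : s ∈ Icc a b := ⟨hs, hst.trans ht⟩
  have htab : t ∈ Icc a b := ⟨hs.trans hst, ht⟩
  obtain ⟨π, hfix, hlip, hπ⟩ := exists_nonexpansive_retraction hcl hK ⟨γ s, hfr (hγ.mapsTo hsab)⟩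
  have hL : LipschitzWith 1 π := LipschitzWith.of_dist_le_mul fun x y => by
    simpa [dist_eq_norm] using hlip x y
  obtain ⟨σ, hσ, hσC, hσs, hσt, hσL⟩ := h
  -- The retraction moves the competitor onto the surface without lengthening it. Spliced between
  -- the outer arcs of `γ`, it competes with the whole of `γ`, and the common outer lengths cancel.
  have hmid : IsJoinedBy (frontier K) s t (γ s) (γ t) L := by
    refine ⟨π ∘ σ, hL.continuous.comp_continuousOn hσ, fun r hr => hπ _ (hσC hr), ?_, ?_, ?_⟩
    · simp only [Function.comp, hσs]; exact hfix _ (hfr (hγ.mapsTo hsab))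
    · simp only [Function.comp, hσt]; exact hfix _ (hfr (hγ.mapsTo htab))
    · refine le_trans ?_ hσL
      have := (hL.lipschitzOnWith (s := univ)).comp_eVariationOn_le (g := σ) (s := Icc s t)
        (mapsTo_univ _ _)
      simpa using this
  obtain ⟨ρ, hρ, hρC, hρa, hρb, hρL⟩ := ((hself a s le_rfl hs hsab.2).trans hs hst hmid).trans
    (hs.trans hst) ht (hself t b htab.1 ht le_rfl)
  have hmin := (hγ.minimizing ρ hρ hρC hρa hρb).trans hρL
  rw [hlen a b le_rfl hγ.lt.le le_rfl] at hmin
  have hcn := c.2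
  have e : ENNReal.ofReal (c * (b - a)) = ENNReal.ofReal (c * (s - a)) +
      ENNReal.ofReal (c * (t - s)) + ENNReal.ofReal (c * (b - t)) := by
    rw [← ENNReal.ofReal_add, ← ENNReal.ofReal_add]
    · congr 1; ring
    all_goals positivity
  rw [e] at hmin
  exact (ENNReal.add_le_add_iff_left ENNReal.ofReal_ne_top).1
    ((ENNReal.add_le_add_iff_right ENNReal.ofReal_ne_top).1 hmin)

theorem HasConstantSpeedOnWith.norm_sub_le (hc : HasConstantSpeedOnWith γ (Icc a b) c)
    {s t : ℝ} (hs : a ≤ s) (hst : s ≤ t) (ht : t ≤ b) : ‖γ t - γ s‖ ≤ c * (t - s) := by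
  have h := hc (x := s) ⟨hs, hst.trans ht⟩ (y := t) ⟨hs.trans hst, ht⟩
  rw [inter_eq_right.2 (Icc_subset_Icc hs ht)] at h
  have h2 := eVariationOn.edist_le γ (right_mem_Icc.2 hst) (left_mem_Icc.2 hst)
  rw [h, edist_dist, dist_eq_norm] at h2
  exact (ENNReal.ofReal_le_ofReal_iff (mul_nonneg c.2 (sub_nonneg.2 hst))).1 h2

/-- A point on the outer side of a supporting plane is not in the interior. -/
theorem notMem_interior_of_forall_inner_le {p ν x : E3} (hν : ν ≠ 0)
    (h : ∀ y ∈ K, inner ℝ (y - p) ν ≤ 0) (hx : 0 ≤ inner ℝ (x - p) ν) : x ∉ interior K := by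
  intro hint
  have hcont : Filter.Tendsto (fun s : ℝ => x + s • ν) (nhdsWithin 0 (Ioi 0)) (nhds x) := by
    have : Continuous fun s : ℝ => x + s • ν := by fun_prop
    simpa using (this.tendsto 0).mono_left nhdsWithin_le_nhds
  obtain ⟨s, hs, hs0⟩ := ((hcont.eventually (mem_interior_iff_mem_nhds.1 hint)).and
    self_mem_nhdsWithin).exists
  have h1 := h _ hs
  rw [add_sub_right_comm, inner_add_left, inner_smul_left, real_inner_self_eq_norm_sq] at h1
  have hs0 : 0 < s := hs0
  have := mul_pos hs0 (pow_pos (norm_pos_iff.2 hν) 2)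
  simp at h1
  linarith

theorem segment_subset_interior_compl {p ν x y : E3} (hν : ν ≠ 0)
    (h : ∀ z ∈ K, inner ℝ (z - p) ν ≤ 0) (hx : 0 ≤ inner ℝ (x - p) ν)
    (hy : 0 ≤ inner ℝ (y - p) ν) : segment ℝ x y ⊆ (interior K)ᶜ := by
  rintro z ⟨u, v, hu, hv, huv, rfl⟩
  refine notMem_interior_of_forall_inner_le hν h ?_
  have e : u • x + v • y - p = u • (x - p) + v • (y - p) := by
    rw [smul_sub, smul_sub, sub_add_sub_comm, ← add_smul, huv, one_smul]
  rw [e, inner_add_left, inner_smul_left, inner_smul_left]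
  exact add_nonneg (mul_nonneg hu hx) (mul_nonneg hv hy)

end

/-! ### Local geometry of a smooth convex surface -/

namespace IsDefiningFunctionOn

variable {K U : Set E3} {f : E3 → ℝ} {p : E3}

theorem contDiffAt (h : IsDefiningFunctionOn K U f) (hp : p ∈ U) : ContDiffAt ℝ ∞ f p :=
  h.contDiffOn.contDiffAt (h.isOpen.mem_nhds hp)

theorem hasFDerivAt (h : IsDefiningFunctionOn K U f) (hp : p ∈ U) :
    HasFDerivAt f (innerSL ℝ (gradient f p)) p := by
  have h1 := ((h.contDiffAt hp).differentiableAt (by simp)).hasGradientAt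
  exact h1.hasFDerivAt

theorem contDiffAt_gradient (h : IsDefiningFunctionOn K U f) (hp : p ∈ U) :
    ContDiffAt ℝ 2 (gradient f) p := by
  have h1 : ContDiffAt ℝ 2 (fderiv ℝ f) p :=
    (h.contDiffAt hp).fderiv_right (m := 2) (by norm_cast)
  exact ((InnerProductSpace.toDual ℝ E3).symm.toContinuousLinearEquiv.contDiff.contDiffAt).comp p h1

theorem mem_interior (h : IsDefiningFunctionOn K U f) (hp : p ∈ U) (hfp : f p < 0) :
    p ∈ interior K := by
  rw [mem_interior_iff_mem_nhds]
  filter_upwards [h.isOpen.mem_nhds hp,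
    (h.contDiffAt hp).continuousAt.eventually_lt_const hfp] with x hx hfx
  exact (h.mem_iff x hx).2 hfx.le

theorem eq_zero (h : IsDefiningFunctionOn K U f) (hK : IsClosed K) (hp : p ∈ U)
    (hpK : p ∈ frontier K) : f p = 0 :=
  le_antisymm ((h.mem_iff p hp).1 (hK.frontier_subset hpK))
    (not_lt.1 fun hlt => hpK.2 (h.mem_interior hp hlt))

theorem inner_gradient_nonpos (h : IsDefiningFunctionOn K U f) (hcl : IsClosed K)
    (hK : Convex ℝ K) (hp : p ∈ U) (hpK : p ∈ frontier K) {x : E3} (hx : x ∈ K) :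
    inner ℝ (x - p) (gradient f p) ≤ 0 := by
  have h0 := h.eq_zero hcl hp hpK
  have hline : HasDerivAt (fun s : ℝ => p + s • (x - p)) (x - p) 0 := by
    simpa using ((hasDerivAt_id (0 : ℝ)).smul_const (x - p)).const_add p
  have hd : HasDerivAt (fun s : ℝ => f (p + s • (x - p))) (inner ℝ (gradient f p) (x - p)) 0 := by
    have hfp : HasFDerivAt f (innerSL ℝ (gradient f p)) (p + (0 : ℝ) • (x - p)) := by
      simpa using h.hasFDerivAt hp
    exact hfp.comp_hasDerivAt (0 : ℝ) hline
  rw [real_inner_comm]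
  have hlim := hasDerivWithinAt_iff_tendsto_slope.1 (hd.hasDerivWithinAt (s := Ioi 0))
  have hcont : Filter.Tendsto (fun s : ℝ => p + s • (x - p)) (nhdsWithin 0 (Ioi 0)) (nhds p) := by
    have := hline.continuousAt.tendsto.mono_left (nhdsWithin_le_nhds (s := Ioi 0))
    simpa using this
  rw [sdiff_singleton_eq_self (by simp)] at hlim
  refine le_of_tendsto hlim ?_
  filter_upwards [hcont.eventually (h.isOpen.mem_nhds hp), self_mem_nhdsWithin,
    mem_nhdsWithin_of_mem_nhds (Iio_mem_nhds one_pos)] with s hsU hs0 hs1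
  have hs0 : 0 < s := hs0
  have hs1 : s < 1 := hs1
  have hmem : p + s • (x - p) ∈ K :=
    hK.add_smul_sub_mem (hcl.frontier_subset hpK) hx ⟨hs0.le, hs1.le⟩
  have hle := (h.mem_iff _ hsU).1 hmem
  rw [slope_def_field]
  simp only [zero_smul, add_zero, sub_zero, h0]
  exact div_nonpos_of_nonpos_of_nonneg hle hs0.le

theorem norm_gradient_pos (h : IsDefiningFunctionOn K U f) (hp : p ∈ U) : 0 < ‖gradient f p‖ :=
  norm_pos_iff.2 (h.gradient_ne_zero p hp)

theorem norm_unitNormal (h : IsDefiningFunctionOn K U f) (hp : p ∈ U) : ‖unitNormal f p‖ = 1 := by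
  rw [unitNormal, norm_smul, norm_inv, norm_norm, inv_mul_cancel₀ (h.norm_gradient_pos hp).ne']

theorem inner_unitNormal_nonpos (h : IsDefiningFunctionOn K U f) (hcl : IsClosed K)
    (hK : Convex ℝ K) (hp : p ∈ U) (hpK : p ∈ frontier K) {x : E3} (hx : x ∈ K) :
    inner ℝ (x - p) (unitNormal f p) ≤ 0 := by
  rw [unitNormal, inner_smul_right]
  exact mul_nonpos_of_nonneg_of_nonpos (by positivity)
    (h.inner_gradient_nonpos hcl hK hp hpK hx)

theorem contDiffAt_unitNormal (h : IsDefiningFunctionOn K U f) (hp : p ∈ U) :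
    ContDiffAt ℝ 2 (unitNormal f) p := by
  have h1 := h.contDiffAt_gradient hp
  exact ((h1.norm ℝ (h.gradient_ne_zero p hp)).inv (h.norm_gradient_pos hp).ne').smul h1

/-- Chords of the surface are almost tangent to it. -/
theorem exists_abs_inner_unitNormal_le (h : IsDefiningFunctionOn K U f) (hcl : IsClosed K)
    (hp : p ∈ U) : ∃ C : ℝ, 0 ≤ C ∧ ∀ᶠ q in nhds (p, p),
      q.1 ∈ frontier K → q.2 ∈ frontier K →
        |inner ℝ (q.2 - q.1) (unitNormal f q.1)| ≤ C * ‖q.2 - q.1‖ ^ 2 := by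
  obtain ⟨L, s, hs, hL⟩ :=
    ((h.contDiffAt_gradient hp).of_le (by norm_num : (1 : ℕ∞ω) ≤ 2)).exists_lipschitzOnWith
  have hg := (h.contDiffAt_gradient hp).continuousAt.norm.eventually_const_lt
    (half_lt_self (h.norm_gradient_pos hp))
  obtain ⟨r, hr, hball⟩ := Metric.mem_nhds_iff.1
    (Filter.inter_mem (Filter.inter_mem hs (h.isOpen.mem_nhds hp)) hg)
  refine ⟨L / (‖gradient f p‖ / 2), by positivity, ?_⟩
  have hprod : Metric.ball p r ×ˢ Metric.ball p r ∈ nhds (p, p) :=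
    prod_mem_nhds (Metric.ball_mem_nhds p hr) (Metric.ball_mem_nhds p hr)
  filter_upwards [hprod] with ⟨x, y⟩ ⟨hx, hy⟩ hxK hyK
  have hx' := hball hx
  -- First-order Taylor estimate from a Lipschitz gradient; on chords of the surface both values of
  -- `f` vanish.
  have key : ‖f y - f x - innerSL ℝ (gradient f x) (y - x)‖ ≤ (L * ‖y - x‖) * ‖y - x‖ := by
    refine Convex.norm_image_sub_le_of_norm_hasFDerivWithin_le'
      (f' := fun z => innerSL ℝ (gradient f z)) (s := segment ℝ x y)
      (fun z hz => ?_) (fun z hz => ?_) (convex_segment x y) (left_mem_segment ℝ x y)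
      (right_mem_segment ℝ x y)
    · have hz' := hball ((convex_ball p r).segment_subset hx hy hz)
      exact (h.hasFDerivAt hz'.1.2).hasFDerivWithinAt
    · have hz' := hball ((convex_ball p r).segment_subset hx hy hz)
      rw [← map_sub, innerSL_apply_norm]
      refine (hL.norm_sub_le hz'.1.1 hx'.1.1).trans ?_
      gcongr
      have := dist_add_dist_of_mem_segment hz
      rw [← dist_eq_norm, ← dist_eq_norm, dist_comm y x, dist_comm z x]
      linarith [dist_nonneg (x := z) (y := y)]
  rw [h.eq_zero hcl hx'.1.2 hxK, h.eq_zero hcl (hball hy).1.2 hyK] at key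
  simp only [sub_zero, zero_sub, norm_neg, innerSL_apply_apply, Real.norm_eq_abs] at key
  have hgx : ‖gradient f p‖ / 2 < ‖gradient f x‖ := hx'.2
  have hgp := h.norm_gradient_pos hp
  rw [unitNormal, inner_smul_right, abs_mul, abs_of_nonneg (by positivity), real_inner_comm]
  calc ‖gradient f x‖⁻¹ * |inner ℝ (gradient f x) (y - x)|
      ≤ (‖gradient f p‖ / 2)⁻¹ * ((L * ‖y - x‖) * ‖y - x‖) := by gcongr
    _ = L / (‖gradient f p‖ / 2) * ‖y - x‖ ^ 2 := by ring

end IsDefiningFunctionOn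

/-! ### Second fundamental form and normal curvatures -/

namespace IsDefiningFunctionOn

variable {K U : Set E3} {f : E3 → ℝ} {p : E3}

theorem hasFDerivAt_gradient (h : IsDefiningFunctionOn K U f) (hp : p ∈ U) :
    HasFDerivAt (gradient f) (fderiv ℝ (gradient f) p) p :=
  ((h.contDiffAt_gradient hp).differentiableAt (by simp)).hasFDerivAt

theorem inner_fderiv_gradient_comm (h : IsDefiningFunctionOn K U f) (hp : p ∈ U) (v w : E3) :
    inner ℝ (fderiv ℝ (gradient f) p v) w = inner ℝ (fderiv ℝ (gradient f) p w) v := by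
  have h1 : ContDiffAt ℝ 2 f p := (h.contDiffAt hp).of_le (by norm_cast)
  have hsymm := h1.isSymmSndFDerivAt (by simp)
  have h2 : DifferentiableAt ℝ (fderiv ℝ f) p :=
    (h1.fderiv_right (m := 1) (by norm_num)).differentiableAt (by simp)
  have h3 : ∀ v w : E3, inner ℝ (fderiv ℝ (gradient f) p v) w = fderiv ℝ (fderiv ℝ f) p v w := by
    intro v w
    have e : (fun x => inner ℝ (gradient f x) w) = fun x => fderiv ℝ f x w :=
      funext fun x => inner_gradient_left
    have h4 := (h.hasFDerivAt_gradient hp).inner ℝ (hasFDerivAt_const w p)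
    rw [e] at h4
    have h5 := h4.unique (h2.hasFDerivAt.clm_apply (hasFDerivAt_const w p))
    simpa [fderivInnerCLM_apply] using congrArg (fun L : E3 →L[ℝ] ℝ => L v) h5
  rw [h3, h3, hsymm.eq]

/-- The second fundamental form of a convex surface is nonnegative. -/
theorem inner_fderiv_gradient_nonneg (h : IsDefiningFunctionOn K U f) (hcl : IsClosed K)
    (hK : Convex ℝ K) (hp : p ∈ U) (hpK : p ∈ frontier K) {v : E3}
    (hv : inner ℝ (gradient f p) v = 0) : 0 ≤ inner ℝ (fderiv ℝ (gradient f) p v) v := by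
  -- Otherwise `f` would become negative along the tangent line in the direction `v`, giving an
  -- interior point of `K` on the supporting plane at `p`.
  by_contra! hneg
  have hline : ∀ s : ℝ, HasDerivAt (fun s : ℝ => p + s • v) v s := fun s => by
    simpa using ((hasDerivAt_id s).smul_const v).const_add p
  have hU : ∀ᶠ s : ℝ in nhds 0, p + s • v ∈ U := by
    have := (hline 0).continuousAt.tendsto
    simp only [zero_smul, add_zero] at this
    exact this.eventually (h.isOpen.mem_nhds hp)
  have hd : ∀ s : ℝ, p + s • v ∈ U →
      HasDerivAt (fun s : ℝ => f (p + s • v)) (inner ℝ (gradient f (p + s • v)) v) s :=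
    fun s hs => HasFDerivAt.comp_hasDerivAt (f := fun s : ℝ => p + s • v) s (h.hasFDerivAt hs)
      (hline s)
  have hd2 : HasDerivAt (fun s : ℝ => inner ℝ (gradient f (p + s • v)) v)
      (inner ℝ (fderiv ℝ (gradient f) p v) v) 0 := by
    have h1 : HasFDerivAt (gradient f) (fderiv ℝ (gradient f) p) (p + (0 : ℝ) • v) := by
      simpa using h.hasFDerivAt_gradient hp
    have h2 := h1.comp_hasDerivAt (0 : ℝ) (hline 0)
    simpa using h2.inner ℝ (hasDerivAt_const (0 : ℝ) v)
  have hlim := hasDerivWithinAt_iff_tendsto_slope.1 (hd2.hasDerivWithinAt (s := Ioi 0))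
  rw [sdiff_singleton_eq_self (by simp)] at hlim
  have hev := (hlim.eventually_lt_const hneg).and (hU.filter_mono nhdsWithin_le_nhds)
  obtain ⟨r, hr, hsub⟩ := mem_nhdsGT_iff_exists_Ioo_subset.1 hev
  have hr : 0 < r := hr
  have hUat : ∀ s, 0 ≤ s → s ≤ r / 2 → p + s • v ∈ U := by
    intro s hs hsr
    rcases hs.eq_or_lt with rfl | hs
    · simpa using hp
    · exact (hsub ⟨hs, by linarith⟩).2
  obtain ⟨ξ, hξ, hslope⟩ := exists_hasDerivAt_eq_slope (fun s : ℝ => f (p + s • v))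
    (fun s => inner ℝ (gradient f (p + s • v)) v) (half_pos hr)
    (fun s hs => (hd s (hUat s hs.1 hs.2)).continuousAt.continuousWithinAt)
    (fun s hs => hd s (hUat s hs.1.le hs.2.le))
  have hξneg : inner ℝ (gradient f (p + ξ • v)) v < 0 := by
    have h1 := (hsub ⟨hξ.1, by linarith [hξ.2]⟩).1
    simp only [slope_def_field, zero_smul, add_zero, sub_zero, hv] at h1
    by_contra! h2
    linarith [div_nonneg h2 hξ.1.le]
  rw [hslope] at hξneg
  simp only [zero_smul, add_zero, sub_zero, h.eq_zero hcl hp hpK] at hξneg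
  have hlt : f (p + (r / 2) • v) < 0 := by
    by_contra! h2
    linarith [div_nonneg h2 (half_pos hr).le]
  refine notMem_interior_of_forall_inner_le (h.gradient_ne_zero p hp)
    (fun y hy => h.inner_gradient_nonpos hcl hK hp hpK hy) ?_
    (h.mem_interior (hUat _ (half_pos hr).le le_rfl) hlt)
  rw [add_sub_cancel_left, inner_smul_left, real_inner_comm, hv]
  simp

theorem hasFDerivAt_unitNormal (h : IsDefiningFunctionOn K U f) (hp : p ∈ U) :
    HasFDerivAt (unitNormal f) (fderiv ℝ (unitNormal f) p) p :=
  ((h.contDiffAt_unitNormal hp).differentiableAt (by simp)).hasFDerivAt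

theorem inner_unitNormal_fderiv (h : IsDefiningFunctionOn K U f) (hp : p ∈ U) (v : E3) :
    inner ℝ (unitNormal f p) (fderiv ℝ (unitNormal f) p v) = 0 := by
  have h1 := (h.hasFDerivAt_unitNormal hp).inner ℝ (h.hasFDerivAt_unitNormal hp)
  have h2 : (fun x => inner ℝ (unitNormal f x) (unitNormal f x)) =ᶠ[nhds p] fun _ => (1 : ℝ) := by
    filter_upwards [h.isOpen.mem_nhds hp] with x hx
    rw [real_inner_self_eq_norm_sq, h.norm_unitNormal hx, one_pow]
  have h3 := (h1.congr_of_eventuallyEq h2.symm).unique (hasFDerivAt_const (1 : ℝ) p)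
  have h4 := congrArg (fun L : E3 →L[ℝ] ℝ => L v) h3
  simp only [ContinuousLinearMap.comp_apply, ContinuousLinearMap.prod_apply,
    fderivInnerCLM_apply, zero_apply] at h4
  rw [real_inner_comm (unitNormal f p) (fderiv ℝ (unitNormal f) p v)] at h4
  linarith

/-- Differentiating the normalizing factor only contributes a multiple of the gradient, which is
orthogonal to `w`. -/
theorem inner_fderiv_unitNormal (h : IsDefiningFunctionOn K U f) (hp : p ∈ U) {v w : E3}
    (hw : inner ℝ (gradient f p) w = 0) :
    inner ℝ (fderiv ℝ (unitNormal f) p v) w =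
      ‖gradient f p‖⁻¹ * inner ℝ (fderiv ℝ (gradient f) p v) w := by
  have hn : DifferentiableAt ℝ (fun x => ‖gradient f x‖⁻¹) p :=
    (((h.contDiffAt_gradient hp).norm ℝ (h.gradient_ne_zero p hp)).inv
      (h.norm_gradient_pos hp).ne').differentiableAt (by simp)
  have h1 : HasFDerivAt (unitNormal f) _ p := hn.hasFDerivAt.smul (h.hasFDerivAt_gradient hp)
  rw [h1.fderiv]
  simp [inner_add_left, inner_smul_left, hw]

/-- If the principal curvatures are positive, then so are all normal curvatures. -/
theorem inner_fderiv_unitNormal_pos (h : IsDefiningFunctionOn K U f) (hcl : IsClosed K)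
    (hK : Convex ℝ K) (hp : p ∈ U) (hpK : p ∈ frontier K)
    (hκ : ∀ κ, IsPrincipalCurvature K p κ → 0 < κ) {v : E3} (hv0 : v ≠ 0)
    (hv : inner ℝ (unitNormal f p) v = 0) :
    0 < inner ℝ (fderiv ℝ (unitNormal f) p v) v := by
  have hN := h.norm_gradient_pos hp
  have htan : ∀ w, inner ℝ (unitNormal f p) w = 0 → inner ℝ (gradient f p) w = 0 := by
    intro w hw
    rw [unitNormal, inner_smul_left] at hw
    exact (mul_eq_zero.1 hw).resolve_left (by simpa using h.gradient_ne_zero p hp)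
  set B := fderiv ℝ (gradient f) p with hB
  rw [h.inner_fderiv_unitNormal hp (htan v hv)]
  have hnn := h.inner_fderiv_gradient_nonneg hcl hK hp hpK (htan v hv)
  refine mul_pos (inv_pos.2 hN) (hnn.lt_of_ne fun hzero => ?_)
  -- An isotropic vector of a semidefinite form is in its kernel: the form at `w + s • v` is affine
  -- in `s` and bounded below, so its slope is zero.
  have horth : ∀ w, inner ℝ (unitNormal f p) w = 0 → inner ℝ (B v) w = 0 := by
    intro w hw
    have hq : ∀ s : ℝ, 0 ≤ inner ℝ (B w) w + 2 * s * inner ℝ (B v) w := by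
      intro s
      have := h.inner_fderiv_gradient_nonneg hcl hK hp hpK (v := w + s • v) (by
        rw [inner_add_right, inner_smul_right, htan w hw, htan v hv]; simp)
      rw [map_add, map_smul] at this
      simp only [inner_add_left, inner_add_right, inner_smul_left, inner_smul_right,
        ← hB, conj_trivial] at this
      have hc : inner ℝ (B w) v = inner ℝ (B v) w := h.inner_fderiv_gradient_comm hp w v
      have hz : inner ℝ (B v) v = 0 := hzero.symm
      rw [hc, hz] at this
      linarith
    by_contra hne
    have h1 := hq (-(inner ℝ (B w) w + 1) / (2 * inner ℝ (B v) w))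
    have h2 : 2 * (-(inner ℝ (B w) w + 1) / (2 * inner ℝ (B v) w)) * inner ℝ (B v) w =
        -(inner ℝ (B w) w + 1) := by field_simp
    linarith
  -- The vector `d` is itself tangent, so testing against it gives `d = 0`. Then `0` would be a
  -- principal curvature.
  set d := fderiv ℝ (unitNormal f) p v with hd
  have hdν : inner ℝ (unitNormal f p) d = 0 := h.inner_unitNormal_fderiv hp v
  have hd0 : d = 0 := by
    have h1 := h.inner_fderiv_unitNormal hp (v := v) (htan d hdν)
    rw [horth d hdν, mul_zero] at h1
    exact inner_self_eq_zero.1 h1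
  exact lt_irrefl _ (hκ 0 ⟨U, f, hp, h, v, hv0, hv, by rw [← hd, hd0, zero_smul]⟩)

end IsDefiningFunctionOn

/-! ### Curves whose arcs are close to their chords -/

section

variable {F : ℝ → E3} {p q C : ℝ}

/-- On every subinterval of `[p, q]`, the curve `F` is close, to second order, to the affine
interpolation between the endpoints. -/
def IsAlmostAffineOn (F : ℝ → E3) (p q C : ℝ) : Prop :=
  ∀ s x t : ℝ, p ≤ s → s ≤ x → x ≤ t → t ≤ q →
    ‖(t - s) • F x - (t - x) • F s - (x - s) • F t‖ ≤ C * (t - s) ^ 3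

/-- If `t - s` is at most twice `x - s`, one division gives `2 * C * (t - s)`. In general `t - s` is
halved until this applies, and the geometric series doubles the constant. -/
theorem IsAlmostAffineOn.norm_slope_sub_slope_left_le (h : IsAlmostAffineOn F p q C) (hC : 0 ≤ C)
    {s x t : ℝ} (hs : p ≤ s) (hsx : s < x) (hxt : x ≤ t) (ht : t ≤ q) :
    ‖slope F s x - slope F s t‖ ≤ 4 * C * (t - s) := by
  have key : ∀ n : ℕ, ∀ t : ℝ, x ≤ t → t ≤ q → t - s ≤ 2 ^ n * (x - s) →
      ‖slope F s x - slope F s t‖ ≤ 4 * C * (t - s) := by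
    have hstep : ∀ x t : ℝ, s < x → x ≤ t → t ≤ q → t - s ≤ 2 * (x - s) →
        ‖slope F s x - slope F s t‖ ≤ 2 * C * (t - s) := by
      intro x t hsx hxt ht hle
      have hx0 : 0 < x - s := sub_pos.2 hsx
      have ht0 : 0 < t - s := by linarith
      have e : slope F s x - slope F s t = ((x - s) * (t - s))⁻¹ •
          ((t - s) • F x - (t - x) • F s - (x - s) • F t) := by
        simp only [slope_def_module]
        rw [show t - x = (t - s) - (x - s) by ring]
        match_scalars <;> field_simp
        ring
      rw [e, norm_smul, norm_inv, Real.norm_eq_abs, abs_of_pos (by positivity),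
        inv_mul_le_iff₀ (by positivity)]
      refine (h s x t hs hsx.le hxt ht).trans ?_
      have : C * (t - s) ^ 2 * (t - s) ≤ C * (t - s) ^ 2 * (2 * (x - s)) := by gcongr
      nlinarith
    intro n
    induction n with
    | zero =>
      intro t hxt ht hle
      have : t = x := by linarith
      subst this
      rw [sub_self, norm_zero]
      have := sub_nonneg.2 hsx.le
      positivity
    | succ n ih =>
      intro t hxt ht hle
      by_cases hcase : t - s ≤ 2 * (x - s)
      · refine (hstep x t hsx hxt ht hcase).trans ?_
        have := sub_nonneg.2 (hsx.le.trans hxt)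
        nlinarith [mul_nonneg hC this]
      · have h1 := ih ((s + t) / 2) (by linarith) (by linarith)
          (by rw [pow_succ] at hle; linarith)
        have h2 := hstep ((s + t) / 2) t (by linarith) (by linarith) ht (by linarith)
        have h3 := norm_sub_le_norm_sub_add_norm_sub (slope F s x) (slope F s ((s + t) / 2))
          (slope F s t)
        linarith
  obtain ⟨n, hn⟩ := pow_unbounded_of_one_lt ((t - s) / (x - s)) one_lt_two
  exact key n t hxt ht ((div_lt_iff₀ (sub_pos.2 hsx)).1 hn).le

theorem IsAlmostAffineOn.comp_neg (h : IsAlmostAffineOn F p q C) :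
    IsAlmostAffineOn (fun t => F (-t)) (-q) (-p) C := by
  intro s x t hs hsx hxt ht
  have := h (-t) (-x) (-s) (by linarith) (by linarith) (by linarith) (by linarith)
  rw [show -s - -t = t - s by ring, show -s - -x = x - s by ring,
    show -x - -t = t - x by ring, sub_right_comm] at this
  exact this

/-- The endpoints are moved one at a time, the second by the mirrored curve. -/
theorem IsAlmostAffineOn.norm_slope_sub_slope_le (h : IsAlmostAffineOn F p q C) (hC : 0 ≤ C)
    {s x y t : ℝ} (hs : p ≤ s) (hsx : s ≤ x) (hxy : x < y) (hyt : y ≤ t) (ht : t ≤ q) :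
    ‖slope F x y - slope F s t‖ ≤ 8 * C * (t - s) := by
  have h1 := h.norm_slope_sub_slope_left_le hC (hs.trans hsx) hxy hyt ht
  have h2 := h.comp_neg.norm_slope_sub_slope_left_le (s := -t) (x := -x) (t := -s) hC
    (by linarith) (by linarith) (by linarith) (by linarith)
  have e : ∀ u v : ℝ, slope (fun t => F (-t)) (-u) (-v) = - slope F u v := fun u v => by
    simp only [slope_def_module, neg_neg]
    rw [show -v - -u = -(v - u) by ring, inv_neg, neg_smul]
  rw [e, e, slope_comm F t x, slope_comm F t s, ← neg_sub', norm_neg] at h2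
  have h3 := norm_sub_le_norm_sub_add_norm_sub (slope F x y) (slope F x t) (slope F s t)
  have h4 : 4 * C * (t - x) ≤ 4 * C * (t - s) := by gcongr
  linarith

/-- Slopes over intervals shrinking to `r` are Cauchy. Two intervals around `r` are compared through
their hull, no longer than both together; this turns `8` into `16`. -/
theorem IsAlmostAffineOn.exists_slope_limit (h : IsAlmostAffineOn F p q C) (hC : 0 ≤ C)
    (hpq : p < q) {r : ℝ} (hr : r ∈ Icc p q) :
    ∃ g : E3, ∀ s t : ℝ, p ≤ s → s ≤ r → r ≤ t → t ≤ q → s < t →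
      ‖slope F s t - g‖ ≤ 16 * C * (t - s) := by
  set l : ℕ → ℝ := fun n => r - (r - p) * (1 / 2) ^ n with hl
  set u : ℕ → ℝ := fun n => r + (q - r) * (1 / 2) ^ n with hu
  have hpow : ∀ n : ℕ, (0 : ℝ) < (1 / 2) ^ n := fun n => by positivity
  have hpow1 : ∀ n : ℕ, ((1 : ℝ) / 2) ^ n ≤ 1 := fun n => pow_le_one₀ (by norm_num) (by norm_num)
  have hrp := sub_nonneg.2 hr.1
  have hqr := sub_nonneg.2 hr.2
  have hlp : ∀ n, p ≤ l n := fun n => by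
    have := mul_le_mul_of_nonneg_left (hpow1 n) hrp
    simp only [hl]; linarith
  have huq : ∀ n, u n ≤ q := fun n => by
    have := mul_le_mul_of_nonneg_left (hpow1 n) hqr
    simp only [hu]; linarith
  have hlr : ∀ n, l n ≤ r := fun n => by
    have := mul_nonneg hrp (hpow n).le
    simp only [hl]; linarith
  have hur : ∀ n, r ≤ u n := fun n => by
    have := mul_nonneg hqr (hpow n).le
    simp only [hu]; linarith
  have hlen : ∀ n, u n - l n = (q - p) * (1 / 2) ^ n := fun n => by simp only [hl, hu]; ring
  have hlu : ∀ n, l n < u n := fun n => by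
    have := mul_pos (sub_pos.2 hpq) (hpow n)
    linarith [hlen n]
  have hanti : ∀ m n, m ≤ n → ((1 : ℝ) / 2) ^ n ≤ (1 / 2) ^ m := fun m n hmn =>
    pow_le_pow_of_le_one (by norm_num) (by norm_num) hmn
  have hlim : Filter.Tendsto (fun n => u n - l n) Filter.atTop (nhds 0) := by
    simp only [hlen]
    simpa using (tendsto_pow_atTop_nhds_zero_of_lt_one (r := (1 / 2 : ℝ)) (by norm_num)
      (by norm_num)).const_mul (q - p)
  have hcau : CauchySeq fun n => slope F (l n) (u n) := by
    refine cauchySeq_of_le_tendsto_0' (fun n => 8 * C * (u n - l n)) (fun m n hmn => ?_) ?_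
    · rw [dist_comm, dist_eq_norm]
      refine h.norm_slope_sub_slope_le hC (hlp m) ?_ (hlu n) ?_ (huq m)
      · have := mul_le_mul_of_nonneg_left (hanti m n hmn) hrp
        simp only [hl]; linarith
      · have := mul_le_mul_of_nonneg_left (hanti m n hmn) hqr
        simp only [hu]; linarith
    · simpa using hlim.const_mul (8 * C)
  obtain ⟨g, hg⟩ := cauchySeq_tendsto_of_complete hcau
  refine ⟨g, fun s t hs hsr hrt ht hst => ?_⟩
  have hL : Filter.Tendsto (fun n => ‖slope F s t - slope F (l n) (u n)‖) Filter.atTop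
      (nhds ‖slope F s t - g‖) := (hg.const_sub _).norm
  have hR : Filter.Tendsto (fun n => 16 * C * ((t - s) + (u n - l n))) Filter.atTop
      (nhds (16 * C * (t - s))) := by
    simpa using (hlim.const_add (t - s)).const_mul (16 * C)
  refine le_of_tendsto_of_tendsto' hL hR fun n => ?_
  have h1 := h.norm_slope_sub_slope_le hC (s := min s (l n)) (x := s) (y := t) (t := max t (u n))
    (le_min hs (hlp n)) (min_le_left _ _) hst (le_max_left _ _) (max_le ht (huq n))
  have h2 := h.norm_slope_sub_slope_le hC (s := min s (l n)) (x := l n) (y := u n)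
    (t := max t (u n)) (le_min hs (hlp n)) (min_le_right _ _) (hlu n) (le_max_right _ _)
    (max_le ht (huq n))
  rw [norm_sub_rev] at h2
  have h3 := norm_sub_le_norm_sub_add_norm_sub (slope F s t) (slope F (min s (l n)) (max t (u n)))
    (slope F (l n) (u n))
  have h4 : max t (u n) - min s (l n) ≤ (t - s) + (u n - l n) := by
    have := hlr n
    have := hur n
    rcases max_cases t (u n) with ⟨e, -⟩ | ⟨e, -⟩ <;> rcases min_cases s (l n) with ⟨e', -⟩ | ⟨e', -⟩
      <;> rw [e, e'] <;> linarith
  have h5 : 16 * C * (max t (u n) - min s (l n)) ≤ 16 * C * ((t - s) + (u n - l n)) := by gcongr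
  linarith

/-- The limit slopes are the derivative, and they are Lipschitz because the limits at two points are
both close to the slope between these points. -/
theorem IsAlmostAffineOn.exists_hasDerivWithinAt (h : IsAlmostAffineOn F p q C) (hC : 0 ≤ C)
    (hpq : p < q) : ∃ g : ℝ → E3, ContinuousOn g (Icc p q) ∧
      ∀ r ∈ Icc p q, HasDerivWithinAt F (g r) (Icc p q) r := by
  have hex : ∀ r : ℝ, ∃ g : E3, r ∈ Icc p q → ∀ s t : ℝ, p ≤ s → s ≤ r → r ≤ t → t ≤ q → s < t →
      ‖slope F s t - g‖ ≤ 16 * C * (t - s) := fun r => by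
    by_cases hr : r ∈ Icc p q
    · obtain ⟨g, hg⟩ := h.exists_slope_limit hC hpq hr
      exact ⟨g, fun _ => hg⟩
    · exact ⟨0, fun h => absurd h hr⟩
  choose g hg using hex
  have hslope : ∀ r ∈ Icc p q, ∀ y ∈ Icc p q, y ≠ r → ‖slope F r y - g r‖ ≤ 16 * C * |y - r| := by
    intro r hr y hy hne
    rcases hne.lt_or_gt with hlt | hlt
    · rw [slope_comm, abs_sub_comm, abs_of_pos (sub_pos.2 hlt)]
      exact hg r hr y r hy.1 hlt.le le_rfl hr.2 hlt
    · rw [abs_of_pos (sub_pos.2 hlt)]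
      exact hg r hr r y hr.1 le_rfl hlt.le hy.2 hlt
  refine ⟨g, ?_, fun r hr => ?_⟩
  · have hlip : LipschitzOnWith (Real.toNNReal (32 * C)) g (Icc p q) := by
      refine LipschitzOnWith.of_dist_le_mul fun x hx y hy => ?_
      rw [Real.coe_toNNReal _ (by positivity), dist_eq_norm, Real.dist_eq]
      by_cases hxy : x = y
      · simp [hxy]
      · have h1 := hslope x hx y hy (Ne.symm hxy)
        have h2 := hslope y hy x hx hxy
        rw [slope_comm] at h2
        rw [norm_sub_rev, abs_sub_comm] at h1
        have h3 := norm_sub_le_norm_sub_add_norm_sub (g x) (slope F x y) (g y)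
        linarith
    exact hlip.continuousOn
  · rw [hasDerivWithinAt_iff_tendsto_slope, tendsto_iff_norm_sub_tendsto_zero]
    have hlim : Filter.Tendsto (fun y : ℝ => 16 * C * |y - r|) (nhdsWithin r (Icc p q \ {r}))
        (nhds 0) := by
      have : Continuous fun y : ℝ => 16 * C * |y - r| := by fun_prop
      simpa using (this.tendsto r).mono_left nhdsWithin_le_nhds
    refine squeeze_zero' (Filter.Eventually.of_forall fun _ => norm_nonneg _) ?_ hlim
    filter_upwards [self_mem_nhdsWithin] with y hy
    exact hslope r hr y hy.1 hy.2

end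

/-! ### Differentiability of minimizing geodesics -/

theorem continuousOn_derivWithin_of_local {F : ℝ → E3} {a b : ℝ} (hab : a < b)
    (h : ∀ t₀ ∈ Icc a b, ∃ p q : ℝ, t₀ ∈ Icc p q ∧ Icc p q ∈ nhdsWithin t₀ (Icc a b) ∧
      ∃ g : ℝ → E3, ContinuousOn g (Icc p q) ∧
        ∀ t ∈ Icc p q, HasDerivWithinAt F (g t) (Icc p q) t) :
    ContinuousOn (derivWithin F (Icc a b)) (Icc a b) ∧
      ∀ t ∈ Icc a b, HasDerivWithinAt F (derivWithin F (Icc a b) t) (Icc a b) t := by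
  have hlocal : ∀ t₀ ∈ Icc a b,
      HasDerivWithinAt F (derivWithin F (Icc a b) t₀) (Icc a b) t₀ ∧
        ContinuousWithinAt (derivWithin F (Icc a b)) (Icc a b) t₀ := by
    intro t₀ ht₀
    obtain ⟨p, q, htpq, hnhds, g, hg, hder⟩ := h t₀ ht₀
    obtain ⟨O, hO, htO, hOsub⟩ := mem_nhdsWithin.1 hnhds
    have hder' : ∀ t ∈ O ∩ Icc a b, HasDerivWithinAt F (g t) (Icc a b) t := fun t ht =>
      (hder t (hOsub ht)).mono_of_mem_nhdsWithin
        (mem_nhdsWithin.2 ⟨O, hO, ht.1, hOsub⟩)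
    have hunique : ∀ t ∈ O ∩ Icc a b, derivWithin F (Icc a b) t = g t := fun t ht =>
      (hder' t ht).derivWithin (uniqueDiffOn_Icc hab t ht.2)
    refine ⟨by rw [hunique t₀ ⟨htO, ht₀⟩]; exact hder' t₀ ⟨htO, ht₀⟩, ?_⟩
    have hgc : ContinuousWithinAt g (Icc a b) t₀ :=
      (hg t₀ htpq).mono_of_mem_nhdsWithin hnhds
    refine hgc.congr_of_eventuallyEq ?_ (hunique t₀ ⟨htO, ht₀⟩)
    filter_upwards [mem_nhdsWithin_of_mem_nhds (hO.mem_nhds htO), self_mem_nhdsWithin] with t h1 h2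
    exact hunique t ⟨h1, h2⟩
  exact ⟨fun t ht => (hlocal t ht).2, fun t ht => (hlocal t ht).1⟩

/-- The curve `γ` is a minimizing geodesic with speed `c` on the smooth strongly convex boundary of
the convex body `K`. -/
structure IsGeodesicOnBody (K : Set E3) (γ : ℝ → E3) (a b : ℝ) (c : ℝ≥0) : Prop where
  isClosed : IsClosed K
  convex : Convex ℝ K
  smooth : HasSmoothBoundary K
  curvature_pos : ∀ p ∈ frontier K, ∀ κ : ℝ, IsPrincipalCurvature K p κ → 0 < κ
  geodesic : IsMinimizingGeodesic (frontier K) γ a b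
  speed_pos : 0 < c
  speed : HasConstantSpeedOnWith γ (Icc a b) c

namespace IsGeodesicOnBody

variable {K : Set E3} {γ : ℝ → E3} {a b : ℝ} {c : ℝ≥0}

theorem exists_supporting_normal (h : IsGeodesicOnBody K γ a b c) {t : ℝ} (ht : t ∈ Icc a b) :
    ∃ ν : E3, ‖ν‖ = 1 ∧ ∀ x ∈ K, inner ℝ (x - γ t) ν ≤ 0 := by
  obtain ⟨U, f, hU, hf⟩ := h.smooth _ (h.geodesic.mapsTo ht)
  exact ⟨unitNormal f (γ t), hf.norm_unitNormal hU, fun x hx =>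
    hf.inner_unitNormal_nonpos h.isClosed h.convex hU (h.geodesic.mapsTo ht) hx⟩

/-- The length of a path in two segments outside of the body bounds the length of the geodesic. -/
theorem length_le_add (h : IsGeodesicOnBody K γ a b c) {s t : ℝ} (hs : a ≤ s) (hst : s < t)
    (ht : t ≤ b) {z : E3} (h₁ : segment ℝ (γ s) z ⊆ (interior K)ᶜ)
    (h₂ : segment ℝ z (γ t) ⊆ (interior K)ᶜ) : c * (t - s) ≤ ‖z - γ s‖ + ‖γ t - z‖ := by
  have h3 := (isJoinedBy_of_segment_subset (s := s) (t := (s + t) / 2) (by linarith) h₁).trans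
    (by linarith) (by linarith)
    (isJoinedBy_of_segment_subset (s := (s + t) / 2) (t := t) (by linarith) h₂)
  have h4 := h.geodesic.le_of_isJoinedBy h.isClosed h.convex h.speed hs hst.le ht h3
  rw [← ENNReal.ofReal_add (norm_nonneg _) (norm_nonneg _)] at h4
  exact (ENNReal.ofReal_le_ofReal_iff (by positivity)).1 h4

/-- A geodesic arc between two points with close normals is almost as short as its chord. -/
theorem sq_length_le (h : IsGeodesicOnBody K γ a b c) {s t C : ℝ} (hs : a ≤ s) (hst : s < t)
    (ht : t ≤ b) (hC : 0 ≤ C) {ν μ : E3} (hν : ‖ν‖ = 1) (hμ : ‖μ‖ = 1)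
    (hνK : ∀ x ∈ K, inner ℝ (x - γ s) ν ≤ 0) (hμK : ∀ x ∈ K, inner ℝ (x - γ t) μ ≤ 0)
    (hνC : |inner ℝ (γ t - γ s) ν| ≤ C * ‖γ t - γ s‖ ^ 2)
    (hμC : |inner ℝ (γ s - γ t) μ| ≤ C * ‖γ t - γ s‖ ^ 2) (hνμ : 1 / 2 ≤ inner ℝ ν μ) :
    (c * (t - s)) ^ 2 ≤ ‖γ t - γ s‖ ^ 2 + 24 * C ^ 2 * ‖γ t - γ s‖ ^ 4 := by
  set d := ‖γ t - γ s‖ with hd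
  -- The chord leaves either tangent plane by at most `C * d ^ 2`. Since `inner ℝ ν μ ≥ 1 / 2`, this
  -- height lifts the midpoint above both planes, so both segments through `z` avoid the interior.
  set lam := 2 * C * d ^ 2 with hlam
  have hlam0 : 0 ≤ lam := by positivity
  set z := (2⁻¹ : ℝ) • (γ s + γ t) + lam • ν with hz
  have e1 : z - γ s = (2⁻¹ : ℝ) • (γ t - γ s) + lam • ν := by rw [hz]; module
  have e2 : z - γ t = (2⁻¹ : ℝ) • (γ s - γ t) + lam • ν := by rw [hz]; module
  have hνν : inner ℝ ν ν = (1 : ℝ) := by rw [real_inner_self_eq_norm_sq, hν, one_pow]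
  have hν0 : ν ≠ 0 := norm_pos_iff.1 (by rw [hν]; exact one_pos)
  have hμ0 : μ ≠ 0 := norm_pos_iff.1 (by rw [hμ]; exact one_pos)
  have hkey := h.length_le_add hs hst ht (z := z)
    (segment_subset_interior_compl hν0 hνK (by simp) (by
      rw [e1, inner_add_left, inner_smul_left, inner_smul_left, hνν]
      simp only [conj_trivial]
      have := neg_le_of_abs_le hνC
      have : 0 ≤ C * d ^ 2 := by positivity
      nlinarith))
    (segment_subset_interior_compl hμ0 hμK (by
      rw [e2, inner_add_left, inner_smul_left, inner_smul_left]
      simp only [conj_trivial]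
      have := neg_le_of_abs_le hμC
      have : 0 ≤ C * d ^ 2 := by positivity
      nlinarith [mul_le_mul_of_nonneg_left hνμ hlam0]) (by simp))
  have hA : ‖z - γ s‖ ^ 2 ≤ d ^ 2 / 4 + 6 * C ^ 2 * d ^ 4 := by
    rw [e1, norm_add_sq_real, norm_smul, norm_smul, hν, inner_smul_left, inner_smul_right, ← hd]
    have : inner ℝ (γ t - γ s) ν ≤ C * d ^ 2 := le_of_abs_le hνC
    have := mul_le_mul_of_nonneg_left this hlam0
    simp only [conj_trivial, Real.norm_eq_abs, mul_one, sq_abs, mul_pow]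
    have e3 : lam * (C * d ^ 2) = 2 * C ^ 2 * d ^ 4 := by rw [hlam]; ring
    have e4 : lam ^ 2 = 4 * C ^ 2 * d ^ 4 := by rw [hlam]; ring
    linarith
  have hB : ‖γ t - z‖ ^ 2 ≤ d ^ 2 / 4 + 6 * C ^ 2 * d ^ 4 := by
    rw [norm_sub_rev, e2, norm_add_sq_real, norm_smul, norm_smul, hν, inner_smul_left,
      inner_smul_right, norm_sub_rev (γ s), ← hd, ← neg_sub (γ t) (γ s), inner_neg_left]
    have := neg_le_of_abs_le hνC
    have := mul_le_mul_of_nonneg_left this hlam0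
    simp only [conj_trivial, Real.norm_eq_abs, mul_one, sq_abs, mul_pow]
    have e3 : lam * (C * d ^ 2) = 2 * C ^ 2 * d ^ 4 := by rw [hlam]; ring
    have e4 : lam ^ 2 = 4 * C ^ 2 * d ^ 4 := by rw [hlam]; ring
    linarith
  have hst' := sub_pos.2 hst
  have h0 : 0 ≤ c * (t - s) := by positivity
  calc (c * (t - s)) ^ 2 ≤ (‖z - γ s‖ + ‖γ t - z‖) ^ 2 := by gcongr
    _ ≤ 2 * ‖z - γ s‖ ^ 2 + 2 * ‖γ t - z‖ ^ 2 := by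
        nlinarith [sq_nonneg (‖z - γ s‖ - ‖γ t - z‖)]
    _ ≤ d ^ 2 + 24 * C ^ 2 * d ^ 4 := by linarith

/-- Around each of its points, the geodesic runs in the domain of a defining function of the body,
and its arcs are close to their chords. -/
theorem exists_local_chart (h : IsGeodesicOnBody K γ a b c) {t₀ : ℝ} (ht₀ : t₀ ∈ Icc a b) :
    ∃ (U : Set E3) (f : E3 → ℝ) (p q C : ℝ), IsDefiningFunctionOn K U f ∧ p < q ∧
      t₀ ∈ Icc p q ∧ Icc p q ⊆ Icc a b ∧ Icc p q ∈ nhdsWithin t₀ (Icc a b) ∧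
      MapsTo γ (Icc p q) U ∧ 0 ≤ C ∧ IsAlmostAffineOn γ p q C := by
  obtain ⟨U, f, hU, hf⟩ := h.smooth _ (h.geodesic.mapsTo ht₀)
  obtain ⟨C, hC, hev⟩ := hf.exists_abs_inner_unitNormal_le h.isClosed hU
  have hnormal : ∀ᶠ x : E3 × E3 in nhds (γ t₀, γ t₀),
      1 / 2 < inner ℝ (unitNormal f x.1) (unitNormal f x.2) := by
    have h1 := (hf.contDiffAt_unitNormal hU).continuousAt
    have h2 : ContinuousAt (fun x : E3 × E3 => inner ℝ (unitNormal f x.1) (unitNormal f x.2))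
        (γ t₀, γ t₀) :=
      (ContinuousAt.comp (x := (γ t₀, γ t₀)) h1 continuousAt_fst).inner
        (ContinuousAt.comp (x := (γ t₀, γ t₀)) h1 continuousAt_snd)
    refine h2.eventually_const_lt ?_
    simp only [real_inner_self_eq_norm_sq, hf.norm_unitNormal hU]
    norm_num
  have hUev : ∀ᶠ x : E3 × E3 in nhds (γ t₀, γ t₀), x.1 ∈ U :=
    continuousAt_fst.eventually (hf.isOpen.mem_nhds hU)
  have hall := hev.and (hnormal.and hUev)
  rw [nhds_prod_eq] at hall
  obtain ⟨V, hV, hVall⟩ := Filter.eventually_prod_self_iff'.1 hall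
  have hVt := (h.geodesic.continuousOn t₀ ht₀) hV
  obtain ⟨r, hr, hball⟩ := Metric.mem_nhdsWithin_iff.1 hVt
  have hsub : Icc (max a (t₀ - r / 2)) (min b (t₀ + r / 2)) ⊆ Icc a b :=
    Icc_subset_Icc (le_max_left _ _) (min_le_left _ _)
  have hγV : ∀ t ∈ Icc (max a (t₀ - r / 2)) (min b (t₀ + r / 2)), γ t ∈ V := fun t ht => by
    refine hball ⟨?_, hsub ht⟩
    have h1 := (le_max_right a (t₀ - r / 2)).trans ht.1
    have h2 := ht.2.trans (min_le_right b (t₀ + r / 2))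
    rw [Metric.mem_ball, Real.dist_eq, abs_lt]
    constructor <;> linarith
  refine ⟨U, f, max a (t₀ - r / 2), min b (t₀ + r / 2), 5 * C * c ^ 2, hf, ?_,
    ⟨max_le ht₀.1 (by linarith), le_min ht₀.2 (by linarith)⟩, hsub, ?_, fun t ht => ?_,
    by positivity, ?_⟩
  · have := h.geodesic.lt
    exact max_lt (lt_min this (by linarith [ht₀.1])) (lt_min (by linarith [ht₀.2]) (by linarith))
  · rw [← Icc_inter_Icc]
    exact Filter.inter_mem self_mem_nhdsWithin
      (mem_nhdsWithin_of_mem_nhds (Icc_mem_nhds (by linarith) (by linarith)))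
  · exact (hVall _ (hγV t ht) _ (hγV t ht)).2.2
  intro s x t hs hsx hxt ht
  rcases (hsx.trans hxt).eq_or_lt with heq | hst
  · have h1 : x = s := by linarith
    subst h1 heq
    simp
  have hs' := hsub ⟨hs, (hst.le.trans ht)⟩
  have ht' := hsub ⟨hs.trans hst.le, ht⟩
  have hsV := hγV s ⟨hs, hst.le.trans ht⟩
  have htV := hγV t ⟨hs.trans hst.le, ht⟩
  have hsK := h.geodesic.mapsTo hs'
  have htK := h.geodesic.mapsTo ht'
  obtain ⟨hst1, hst2, hsU⟩ := hVall _ hsV _ htV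
  obtain ⟨hts1, -, htU⟩ := hVall _ htV _ hsV
  have hL := h.sq_length_le hs'.1 hst ht'.2 hC (hf.norm_unitNormal hsU) (hf.norm_unitNormal htU)
    (fun x hx => hf.inner_unitNormal_nonpos h.isClosed h.convex hsU hsK hx)
    (fun x hx => hf.inner_unitNormal_nonpos h.isClosed h.convex htU htK hx)
    (hst1 hsK htK) (by have := hts1 htK hsK; rwa [norm_sub_rev (γ s)] at this) hst2.le
  have hd := h.speed.norm_sub_le hs'.1 hst.le ht'.2
  have hu := h.speed.norm_sub_le hs'.1 hsx (hxt.trans ht'.2)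
  have hw := h.speed.norm_sub_le (hs'.1.trans hsx) hxt ht'.2
  have e : (t - s) • γ x - (t - x) • γ s - (x - s) • γ t =
      (t - x) • (γ x - γ s) - (x - s) • (γ t - γ x) := by module
  have e2 : γ t - γ s = (γ x - γ s) + (γ t - γ x) := by abel
  set d := ‖γ t - γ s‖
  set u := γ x - γ s
  set w := γ t - γ x
  have hα : 0 ≤ t - x := sub_nonneg.2 hxt
  have hβ : 0 ≤ x - s := sub_nonneg.2 hsx
  have hT : t - s = (t - x) + (x - s) := by ring
  have hd2 : d ^ 2 = ‖u‖ ^ 2 + 2 * inner ℝ u w + ‖w‖ ^ 2 := by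
    rw [← norm_add_sq_real, ← e2]
  set α := t - x
  set β := x - s
  set T := t - s
  have hT0 : 0 < T := sub_pos.2 hst
  have hu2 : ‖u‖ ^ 2 ≤ (c * β) ^ 2 := by gcongr
  have hw2 : ‖w‖ ^ 2 ≤ (c * α) ^ 2 := by gcongr
  have hd4 : d ^ 4 ≤ (c * T) ^ 4 := by gcongr
  have hαT : α ≤ T := by linarith
  have hβT : β ≤ T := by linarith
  rw [e]
  refine abs_le_of_sq_le_sq' ?_ (by positivity) |>.2
  rw [norm_sub_sq_real, norm_smul, norm_smul, inner_smul_left, inner_smul_right]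
  simp only [Real.norm_eq_abs, mul_pow, sq_abs, conj_trivial]
  -- Stewart's identity: the two sides are bounded above by arc length, the chord `d` below by `hL`,
  -- and the leading terms cancel.
  calc α ^ 2 * ‖u‖ ^ 2 - 2 * (α * (β * inner ℝ u w)) + β ^ 2 * ‖w‖ ^ 2
      = α * T * ‖u‖ ^ 2 + β * T * ‖w‖ ^ 2 - α * β * d ^ 2 := by rw [hd2, hT]; ring
    _ ≤ α * T * (c * β) ^ 2 + β * T * (c * α) ^ 2 - α * β * d ^ 2 := by gcongr
    _ = α * β * ((c * T) ^ 2 - d ^ 2) := by rw [hT]; ring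
    _ ≤ α * β * (24 * C ^ 2 * (c * T) ^ 4) := by
        gcongr
        have : 24 * C ^ 2 * d ^ 4 ≤ 24 * C ^ 2 * (c * T) ^ 4 := by gcongr
        linarith
    _ ≤ T * T * (25 * C ^ 2 * (c * T) ^ 4) := by gcongr; norm_num
    _ = 5 ^ 2 * C ^ 2 * (c ^ 2) ^ 2 * (T ^ 3) ^ 2 := by ring

theorem continuousOn_velocity (h : IsGeodesicOnBody K γ a b c) :
    ContinuousOn (derivWithin γ (Icc a b)) (Icc a b) ∧
      ∀ t ∈ Icc a b, HasDerivWithinAt γ (derivWithin γ (Icc a b) t) (Icc a b) t := by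
  refine continuousOn_derivWithin_of_local h.geodesic.lt fun t₀ ht₀ => ?_
  obtain ⟨U, f, p, q, C, -, hpq, htpq, -, hnhds, -, hC, haff⟩ := h.exists_local_chart ht₀
  exact ⟨p, q, htpq, hnhds, haff.exists_hasDerivWithinAt hC hpq⟩

end IsGeodesicOnBody

/-! ### The geodesic equation -/

theorem norm_image_sub_le_of_norm_deriv_le {F F' : ℝ → E3} {B B' : ℝ → ℝ} {p q : ℝ}
    (hF : ∀ t ∈ Icc p q, HasDerivWithinAt F (F' t) (Icc p q) t)
    (hB : ∀ t ∈ Icc p q, HasDerivWithinAt B (B' t) (Icc p q) t)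
    (hle : ∀ t ∈ Icc p q, ‖F' t‖ ≤ B' t) :
    ∀ x ∈ Icc p q, ∀ y ∈ Icc p q, x ≤ y → ‖F y - F x‖ ≤ B y - B x := by
  intro x hx y hy hxy
  have hsub : Icc x y ⊆ Icc p q := Icc_subset_Icc hx.1 hy.2
  have hmem : ∀ t ∈ Ico x y, Icc p q ∈ nhdsWithin t (Ici t) := fun t ht =>
    Icc_mem_nhdsGE_of_mem ⟨hx.1.trans ht.1, ht.2.trans_le hy.2⟩
  refine image_norm_le_of_norm_deriv_right_le_deriv_boundary' (f := fun t => F t - F x)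
    (f' := F') (B := fun t => B t - B x) (B' := B') (a := x) (b := y) ?_ ?_ (by simp) ?_ ?_ ?_
    (right_mem_Icc.2 hxy)
  · exact fun t ht => ((hF t (hsub ht)).continuousWithinAt.mono hsub).sub_const _
  · exact fun t ht => ((hF t (hsub (Ico_subset_Icc_self ht))).mono_of_mem_nhdsWithin
      (hmem t ht)).sub_const _
  · exact fun t ht => ((hB t (hsub ht)).continuousWithinAt.mono hsub).sub_const _
  · exact fun t ht => ((hB t (hsub (Ico_subset_Icc_self ht))).mono_of_mem_nhdsWithin
      (hmem t ht)).sub_const _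
  · exact fun t ht => hle t (hsub (Ico_subset_Icc_self ht))

namespace IsGeodesicOnBody

variable {K : Set E3} {γ : ℝ → E3} {a b : ℝ} {c : ℝ≥0}

theorem length_le_of_curve (h : IsGeodesicOnBody K γ a b c) {p q : ℝ} (hp : a ≤ p) (hpq : p ≤ q)
    (hq : q ≤ b) {σ : ℝ → E3} {Ψ : ℝ → ℝ} (hσ : ContinuousOn σ (Icc p q))
    (hσK : MapsTo σ (Icc p q) (interior K)ᶜ) (hσp : σ p = γ p) (hσq : σ q = γ q)
    (hΨ : ∀ x ∈ Icc p q, ∀ y ∈ Icc p q, x ≤ y → ‖σ y - σ x‖ ≤ Ψ y - Ψ x) :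
    c * (q - p) ≤ Ψ q - Ψ p := by
  have h1 := h.geodesic.le_of_isJoinedBy h.isClosed h.convex h.speed hp hpq hq
    ⟨σ, hσ, hσK, hσp, hσq, eVariationOn_le_ofReal_of_norm_sub_le hpq hΨ⟩
  exact (ENNReal.ofReal_le_ofReal_iff
    ((norm_nonneg _).trans (hΨ p (left_mem_Icc.2 hpq) q (right_mem_Icc.2 hpq) hpq))).1 h1

theorem norm_velocity (h : IsGeodesicOnBody K γ a b c) {t : ℝ} (ht : t ∈ Icc a b) :
    ‖derivWithin γ (Icc a b) t‖ = c := by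
  have hab := h.geodesic.lt
  obtain ⟨hcont, hder⟩ := h.continuousOn_velocity
  set g := derivWithin γ (Icc a b)
  refine le_antisymm ?_ (not_lt.1 fun hlt => ?_)
  · have : (nhdsWithin t (Icc a b \ {t})).NeBot :=
      accPt_principal_iff_nhdsWithin.1 (uniqueDiffWithinAt_iff_accPt.1 (uniqueDiffOn_Icc hab t ht))
    refine le_of_tendsto (hasDerivWithinAt_iff_tendsto_slope.1 (hder t ht)).norm ?_
    filter_upwards [self_mem_nhdsWithin] with x hx
    have hle : ∀ x y : ℝ, a ≤ x → x < y → y ≤ b → ‖slope γ x y‖ ≤ c := fun x y hx hxy hy => by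
      have hpos := sub_pos.2 hxy
      rw [slope_def_module, norm_smul, norm_inv, Real.norm_of_nonneg hpos.le,
        inv_mul_le_iff₀ hpos, mul_comm]
      exact h.speed.norm_sub_le hx hxy.le hy
    rcases lt_or_gt_of_ne hx.2 with hlt | hlt
    · rw [slope_comm]
      exact hle x t hx.1.1 hlt ht.2
    · exact hle t x ht.1 hlt hx.1.2
  -- If the derivative were shorter than `c`, it would be bounded by some `e < c` nearby, and the
  -- arc there would have length below `c * (q - p)`.
  · obtain ⟨e, he1, he2⟩ := exists_between hlt
    have hev := (hcont t ht).norm.eventually_lt_const he1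
    obtain ⟨r, hr, hball⟩ := Metric.mem_nhdsWithin_iff.1 hev
    have hsub : Icc (max a (t - r / 2)) (min b (t + r / 2)) ⊆ Icc a b :=
      Icc_subset_Icc (le_max_left _ _) (min_le_left _ _)
    have hpq : max a (t - r / 2) < min b (t + r / 2) :=
      max_lt (lt_min hab (by linarith [ht.1])) (lt_min (by linarith [ht.2]) (by linarith))
    set p := max a (t - r / 2)
    set q := min b (t + r / 2)
    have hbound : ∀ s ∈ Icc p q, ‖g s‖ ≤ e := fun s hs => by
      refine (hball ⟨?_, hsub hs⟩ : ‖g s‖ < e).le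
      have h1 := (le_max_right a (t - r / 2)).trans hs.1
      have h2 := hs.2.trans (min_le_right b (t + r / 2))
      rw [Metric.mem_ball, Real.dist_eq, abs_lt]
      constructor <;> linarith
    have h2 := h.length_le_of_curve (p := p) (q := q) (hsub (left_mem_Icc.2 hpq.le)).1 hpq.le
      (hsub (right_mem_Icc.2 hpq.le)).2 (Ψ := fun s => e * s)
      (h.geodesic.continuousOn.mono hsub)
      (fun s hs => (h.geodesic.mapsTo (hsub hs)).2) rfl rfl
      (norm_image_sub_le_of_norm_deriv_le (F' := g) (B' := fun _ => e)
        (fun s hs => (hder s (hsub hs)).mono hsub)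
        (fun s _ => by simpa using ((hasDerivAt_id s).const_mul e).hasDerivWithinAt) hbound)
    have h3 := mul_lt_mul_of_pos_right he2 (sub_pos.2 hpq)
    linarith

/-- The first variation of length vanishes for tangent fields. -/
theorem first_variation_eq_zero (h : IsGeodesicOnBody K γ a b c) {p q : ℝ}
    (hpq : p < q) (hsub : Icc p q ⊆ Icc a b) {g ν η η' : ℝ → E3} {Q : ℝ → ℝ}
    (hγ : ∀ t ∈ Icc p q, HasDerivWithinAt γ (g t) (Icc p q) t)
    (hgc : ∀ t ∈ Icc p q, ‖g t‖ ≤ c)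
    (hν1 : ∀ t ∈ Icc p q, ‖ν t‖ = 1) (hνK : ∀ t ∈ Icc p q, ∀ x ∈ K, inner ℝ (x - γ t) (ν t) ≤ 0)
    (hη : ∀ t ∈ Icc p q, HasDerivWithinAt η (η' t) (Icc p q) t) (hη' : ContinuousOn η' (Icc p q))
    (hην : ∀ t ∈ Icc p q, inner ℝ (η t) (ν t) = 0) (hηp : η p = 0) (hηq : η q = 0)
    (hQ : ∀ t ∈ Icc p q, HasDerivWithinAt Q (inner ℝ (g t) (η' t)) (Icc p q) t) :
    Q q = Q p := by
  have hc : (0 : ℝ) < c := h.speed_pos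
  have hpos : 0 < q - p := sub_pos.2 hpq
  obtain ⟨D, hD0, hD⟩ : ∃ D, 0 < D ∧ ∀ t ∈ Icc p q, ‖η' t‖ ^ 2 ≤ D := by
    obtain ⟨D, hD⟩ := isCompact_Icc.exists_bound_of_continuousOn hη'
    exact ⟨D ^ 2 + 1, by positivity, fun t ht =>
      (pow_le_pow_left₀ (norm_nonneg _) (hD t ht) 2).trans (by linarith)⟩
  -- As `η` is tangent, `γ + s • η` lies in supporting planes of `K` and is an admissible
  -- competitor. Its speed is estimated by `2 * c * r ≤ r ^ 2 + c ^ 2`, which avoids expanding a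
  -- square root.
  have hvar : ∀ s : ℝ, 0 ≤ s / c * (Q q - Q p) + s ^ 2 * D / (2 * c) * (q - p) := by
    intro s
    have h1 := h.length_le_of_curve (p := p) (q := q) (hsub (left_mem_Icc.2 hpq.le)).1 hpq.le
      (hsub (right_mem_Icc.2 hpq.le)).2 (σ := fun t => γ t + s • η t)
      (Ψ := fun t => c * t + s / c * Q t + s ^ 2 * D / (2 * c) * t)
      (fun t ht => ((hγ t ht).continuousWithinAt).add ((hη t ht).continuousWithinAt.const_smul s))
      ?_ (by simp [hηp]) (by simp [hηq])
      (norm_image_sub_le_of_norm_deriv_le (F' := fun t => g t + s • η' t)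
        (B' := fun t => c * 1 + s / c * inner ℝ (g t) (η' t) + s ^ 2 * D / (2 * c) * 1)
        (fun t ht => (hγ t ht).add ((hη t ht).const_smul s))
        (fun t ht => (((hasDerivAt_id t).const_mul (c : ℝ)).hasDerivWithinAt.add
          ((hQ t ht).const_mul _)).add ((hasDerivAt_id t).const_mul _).hasDerivWithinAt) ?_)
    · linarith
    · intro t ht
      refine notMem_interior_of_forall_inner_le (norm_pos_iff.1 (by rw [hν1 t ht]; exact one_pos))
        (hνK t ht) ?_
      rw [add_sub_cancel_left, inner_smul_left, hην t ht, mul_zero]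
    · intro t ht
      have h2 : ‖g t + s • η' t‖ ^ 2 ≤ c ^ 2 + 2 * s * inner ℝ (g t) (η' t) + s ^ 2 * D := by
        rw [norm_add_sq_real, norm_smul, mul_pow, inner_smul_right, Real.norm_eq_abs, sq_abs]
        have h4 : ‖g t‖ ^ 2 ≤ c ^ 2 := pow_le_pow_left₀ (norm_nonneg _) (hgc t ht) 2
        have h5 := mul_le_mul_of_nonneg_left (hD t ht) (sq_nonneg s)
        linarith
      have h6 : 2 * c * ‖g t + s • η' t‖ ≤
          2 * c ^ 2 + 2 * s * inner ℝ (g t) (η' t) + s ^ 2 * D := by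
        linarith [sq_nonneg (‖g t + s • η' t‖ - c), sub_sq ‖g t + s • η' t‖ (c : ℝ)]
      have e : c * 1 + s / c * inner ℝ (g t) (η' t) + s ^ 2 * D / (2 * c) * 1 =
          (2 * c ^ 2 + 2 * s * inner ℝ (g t) (η' t) + s ^ 2 * D) / (2 * c) := by
        field_simp
      rw [e, le_div_iff₀ (by positivity)]
      linarith
  -- The minimizer in `s` of the quadratic bound.
  have h1 := hvar (-(Q q - Q p) / (D * (q - p)))
  have e : -(Q q - Q p) / (D * (q - p)) / c * (Q q - Q p) +
      (-(Q q - Q p) / (D * (q - p))) ^ 2 * D / (2 * c) * (q - p) =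
      -((Q q - Q p) ^ 2 / (2 * c * D * (q - p))) := by
    field_simp
    ring
  rw [e] at h1
  by_contra hne
  have : 0 < (Q q - Q p) ^ 2 := by
    have := sub_ne_zero.2 hne
    positivity
  have : 0 < (Q q - Q p) ^ 2 / (2 * c * D * (q - p)) := by positivity
  linarith

/-- The geodesic equation: the acceleration is normal to the surface. -/
theorem hasDerivWithinAt_velocity_of_normal (h : IsGeodesicOnBody K γ a b c) {p q : ℝ}
    (hpq : p < q) (hsub : Icc p q ⊆ Icc a b) {g ν μ : ℝ → E3}
    (hg : ContinuousOn g (Icc p q)) (hγ : ∀ t ∈ Icc p q, HasDerivWithinAt γ (g t) (Icc p q) t)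
    (hgc : ∀ t ∈ Icc p q, ‖g t‖ ≤ c)
    (hμ : ContinuousOn μ (Icc p q)) (hν : ∀ t ∈ Icc p q, HasDerivWithinAt ν (μ t) (Icc p q) t)
    (hν1 : ∀ t ∈ Icc p q, ‖ν t‖ = 1) (hνK : ∀ t ∈ Icc p q, ∀ x ∈ K, inner ℝ (x - γ t) (ν t) ≤ 0)
    (hgν : ∀ t ∈ Icc p q, inner ℝ (g t) (ν t) = 0) :
    ∀ t ∈ Icc p q, HasDerivWithinAt g (-(inner ℝ (g t) (μ t)) • ν t) (Icc p q) t := by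
  have hνc : ContinuousOn ν (Icc p q) := fun t ht => (hν t ht).continuousWithinAt
  have hpos : 0 < q - p := sub_pos.2 hpq
  -- A du Bois-Reymond argument, since `g` is only known to be continuous: with `B` a primitive of
  -- the normal term, `G = g + B` is shown to be constant. Extending `κ` and `g` continuously to the
  -- line gives primitives differentiable everywhere.
  obtain ⟨κ, hκ, hκe⟩ : ∃ κ : ℝ → E3, Continuous κ ∧
      ∀ t ∈ Icc p q, κ t = inner ℝ (g t) (μ t) • ν t := by
    have h1 : ContinuousOn (fun t => inner ℝ (g t) (μ t)) (Icc p q) := hg.inner hμ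
    have h2 : ContinuousOn (fun t => inner ℝ (g t) (μ t) • ν t) (Icc p q) := h1.smul hνc
    exact ⟨_, h2.domRestrict.Icc_extend', fun t ht => IccExtend_of_mem hpq.le _ ht⟩
  obtain ⟨g', hgE, hge⟩ : ∃ g' : ℝ → E3, Continuous g' ∧ ∀ t ∈ Icc p q, g' t = g t :=
    ⟨_, hg.domRestrict.Icc_extend', fun t ht => IccExtend_of_mem hpq.le _ ht⟩
  have hprim : ∀ φ : ℝ → E3, Continuous φ → ∀ t, HasDerivAt (fun t => ∫ s in p..t, φ s) (φ t) t :=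
    fun φ hφ t => intervalIntegral.integral_hasDerivAt_right (hφ.intervalIntegrable _ _)
      hφ.stronglyMeasurable.stronglyMeasurableAtFilter hφ.continuousAt
  obtain ⟨B, hBd⟩ : ∃ B : ℝ → E3, ∀ t, HasDerivAt B (κ t) t := ⟨_, hprim κ hκ⟩
  have hBc : Continuous B := continuous_iff_continuousAt.2 fun t => (hBd t).continuousAt
  obtain ⟨G, hGe⟩ : ∃ G : ℝ → E3, ∀ t, G t = g' t + B t := ⟨_, fun _ => rfl⟩
  have hGc : Continuous G := by
    rw [funext hGe]
    exact hgE.add hBc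
  obtain ⟨m, X, hXd, hXp, hXq⟩ : ∃ (m : E3) (X : ℝ → E3), (∀ t, HasDerivAt X (G t - m) t) ∧
      X p = 0 ∧ X q = 0 := by
    refine ⟨(q - p)⁻¹ • ∫ s in p..q, G s, _, hprim _ (hGc.sub continuous_const),
      intervalIntegral.integral_same, ?_⟩
    rw [intervalIntegral.integral_sub (hGc.intervalIntegrable _ _)
      (continuous_const.intervalIntegrable _ _), intervalIntegral.integral_const,
      smul_inv_smul₀ hpos.ne', sub_self]
  have hGm : Continuous fun s => G s - m := hGc.sub continuous_const
  have hXc : Continuous X := continuous_iff_continuousAt.2 fun t => (hXd t).continuousAt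
  obtain ⟨J, hJd⟩ : ∃ J : ℝ → ℝ, ∀ t, HasDerivAt J (‖G t - m‖ ^ 2) t := by
    have hGm2 : Continuous fun s => ‖G s - m‖ ^ 2 := hGm.norm.pow 2
    exact ⟨fun t => ∫ s in p..t, ‖G s - m‖ ^ 2, fun t =>
      intervalIntegral.integral_hasDerivAt_right (hGm2.intervalIntegrable _ _)
        hGm2.stronglyMeasurable.stronglyMeasurableAtFilter hGm2.continuousAt⟩
  have hXν : ContinuousOn (fun t => inner ℝ (X t) (ν t)) (Icc p q) := hXc.continuousOn.inner hνc
  have hXμ : ContinuousOn (fun t => inner ℝ (X t) (μ t)) (Icc p q) := hXc.continuousOn.inner hμ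
  have hGν : ContinuousOn (fun t => inner ℝ (G t - m) (ν t)) (Icc p q) :=
    hGm.continuousOn.inner hνc
  -- The field is the tangential part of `X`, a primitive of `G - m`; `m` is the mean of `G`, so `X`
  -- vanishes at both ends. Then `⟪g, η'⟫` is `‖G - m‖ ^ 2` plus the derivative of `⟪m, X⟫ - ⟪X,
  -- B⟫`, whose boundary terms are zero. Thus the integral of `‖G - m‖ ^ 2` is zero.
  have hJ := h.first_variation_eq_zero hpq hsub (η := fun t => X t - inner ℝ (X t) (ν t) • ν t)
    (η' := fun t => (G t - m) - (inner ℝ (X t) (ν t) • μ t +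
      (inner ℝ (X t) (μ t) + inner ℝ (G t - m) (ν t)) • ν t))
    (Q := fun t => J t + inner ℝ m (X t) - inner ℝ (X t) (B t)) hγ hgc hν1 hνK
    (fun t ht => (hXd t).hasDerivWithinAt.sub
      (((hXd t).hasDerivWithinAt.inner ℝ (hν t ht)).smul (hν t ht)))
    (hGm.continuousOn.sub ((hXν.smul hμ).add ((hXμ.add hGν).smul hνc)))
    (fun t ht => by
      rw [inner_sub_left, inner_smul_left, real_inner_self_eq_norm_sq, hν1 t ht]
      simp)
    (by simp [hXp]) (by simp [hXq]) (fun t ht => by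
      have h1 := (((hJd t).add ((hasDerivAt_const t m).inner ℝ (hXd t))).sub
        ((hXd t).inner ℝ (hBd t))).hasDerivWithinAt (s := Icc p q)
      refine h1.congr_deriv ?_
      have e1 : ‖G t - m‖ ^ 2 = inner ℝ (g t) (G t - m) + inner ℝ (B t) (G t - m) -
          inner ℝ m (G t - m) := by
        rw [← inner_add_left, ← inner_sub_left, ← hge t ht, ← hGe t, real_inner_self_eq_norm_sq]
      rw [e1, hκe t ht, real_inner_comm (B t)]
      simp only [inner_sub_right (g t), inner_add_right (g t), inner_smul_right, hgν t ht,
        inner_zero_left]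
      ring)
  simp only [hXp, hXq, inner_zero_left, inner_zero_right, add_zero, sub_zero] at hJ
  have hJmono : Monotone J := by
    refine monotone_of_deriv_nonneg (fun t => (hJd t).differentiableAt) fun t => ?_
    rw [(hJd t).deriv]
    positivity
  have hGeq : ∀ t ∈ Icc p q, G t = m := by
    intro t ht
    have hJ0 : ∀ s ∈ Icc p q, J s = J p := fun s hs =>
      le_antisymm ((hJmono hs.2).trans hJ.le) (hJmono hs.1)
    have h1 := ((hasDerivWithinAt_const t (Icc p q) (J p)).congr hJ0 (hJ0 t ht))
    have h2 := (uniqueDiffOn_Icc hpq t ht).eq_deriv _ ((hJd t).hasDerivWithinAt) h1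
    exact sub_eq_zero.1 (norm_eq_zero.1 (pow_eq_zero_iff two_ne_zero |>.1 h2))
  intro t ht
  have e : ∀ s ∈ Icc p q, g s = m - B s := fun s hs => by
    rw [← hGeq s hs, hGe, hge s hs, add_sub_cancel_right]
  have h1 := ((hBd t).hasDerivWithinAt (s := Icc p q)).const_sub m
  rw [hκe t ht, ← neg_smul] at h1
  exact h1.congr e (e t ht)

end IsGeodesicOnBody

/-! ### Acceleration of a minimizing geodesic -/

namespace IsGeodesicOnBody

variable {K : Set E3} {γ : ℝ → E3} {a b : ℝ} {c : ℝ≥0}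

/-- A minimizing geodesic is twice continuously differentiable, and its acceleration does not
vanish and points into the body. -/
theorem exists_acceleration (h : IsGeodesicOnBody K γ a b c) :
    ∃ g A : ℝ → E3, (∀ t ∈ Icc a b, HasDerivWithinAt γ (g t) (Icc a b) t) ∧
      (∀ t ∈ Icc a b, ‖g t‖ = c) ∧ (∀ t ∈ Icc a b, HasDerivWithinAt g (A t) (Icc a b) t) ∧
      ContinuousOn A (Icc a b) ∧ (∀ t ∈ Icc a b, ∀ x ∈ K, 0 ≤ inner ℝ (x - γ t) (A t)) ∧
      ∀ t ∈ Icc a b, A t ≠ 0 := by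
  obtain ⟨hgc, hγ⟩ := h.continuousOn_velocity
  have hnorm : ∀ t ∈ Icc a b, ‖derivWithin γ (Icc a b) t‖ = c := fun t ht => h.norm_velocity ht
  generalize derivWithin γ (Icc a b) = g at hgc hγ hnorm
  have hlocal : ∀ t₀ ∈ Icc a b, ∃ (U : Set E3) (f : E3 → ℝ) (p q : ℝ), p < q ∧
      IsDefiningFunctionOn K U f ∧ t₀ ∈ Icc p q ∧ Icc p q ∈ nhdsWithin t₀ (Icc a b) ∧
      Icc p q ⊆ Icc a b ∧ MapsTo γ (Icc p q) U ∧
      (∀ t ∈ Icc p q, inner ℝ (g t) (unitNormal f (γ t)) = 0) ∧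
      ContinuousOn (fun t => -inner ℝ (g t) (fderiv ℝ (unitNormal f) (γ t) (g t)) •
        unitNormal f (γ t)) (Icc p q) ∧
      ∀ t ∈ Icc p q, HasDerivWithinAt g (-inner ℝ (g t) (fderiv ℝ (unitNormal f) (γ t) (g t)) •
        unitNormal f (γ t)) (Icc p q) t := by
    intro t₀ ht₀
    obtain ⟨U, f, p, q, C, hf, hpq, htpq, hsub, hnhds, hU, -⟩ := h.exists_local_chart ht₀
    have hγ' : ∀ t ∈ Icc p q, HasDerivWithinAt γ (g t) (Icc p q) t := fun t ht =>
      (hγ t (hsub ht)).mono hsub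
    have hγc : ContinuousOn γ (Icc p q) := h.geodesic.continuousOn.mono hsub
    have hgc' : ContinuousOn g (Icc p q) := hgc.mono hsub
    have hK : ∀ t ∈ Icc p q, γ t ∈ frontier K := fun t ht => h.geodesic.mapsTo (hsub ht)
    have hνd : ∀ t ∈ Icc p q, HasDerivWithinAt (fun t => unitNormal f (γ t))
        (fderiv ℝ (unitNormal f) (γ t) (g t)) (Icc p q) t := fun t ht =>
      (hf.hasFDerivAt_unitNormal (hU ht)).comp_hasDerivWithinAt t (hγ' t ht)
    have hνc : ContinuousOn (fun t => unitNormal f (γ t)) (Icc p q) := fun t ht =>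
      (hνd t ht).continuousWithinAt
    have hμc : ContinuousOn (fun t => fderiv ℝ (unitNormal f) (γ t) (g t)) (Icc p q) := by
      have h1 : ContinuousOn (fun t => fderiv ℝ (unitNormal f) (γ t)) (Icc p q) := fun t ht => by
        have h2 : ContinuousAt (fderiv ℝ (unitNormal f)) (γ t) :=
          ((hf.contDiffAt_unitNormal (hU ht)).fderiv_right (m := 1) (by norm_num)).continuousAt
        exact ContinuousAt.comp_continuousWithinAt h2 (hγc t ht)
      exact h1.clm_apply hgc'
    have hgν : ∀ t ∈ Icc p q, inner ℝ (g t) (unitNormal f (γ t)) = 0 := by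
      intro t ht
      have h1 : HasDerivWithinAt (fun t => f (γ t)) (inner ℝ (gradient f (γ t)) (g t))
          (Icc p q) t := (hf.hasFDerivAt (hU ht)).comp_hasDerivWithinAt t (hγ' t ht)
      have h0 : ∀ s ∈ Icc p q, f (γ s) = 0 := fun s hs => hf.eq_zero h.isClosed (hU hs) (hK s hs)
      have h2 := (hasDerivWithinAt_const t (Icc p q) (0 : ℝ)).congr h0 (h0 t ht)
      rw [unitNormal, inner_smul_right, real_inner_comm,
        (uniqueDiffOn_Icc hpq t ht).eq_deriv _ h1 h2, mul_zero]
    refine ⟨U, f, p, q, hpq, hf, htpq, hnhds, hsub, hU, hgν, ?_, ?_⟩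
    · have h1 : ContinuousOn (fun t => inner ℝ (g t) (fderiv ℝ (unitNormal f) (γ t) (g t)))
          (Icc p q) := hgc'.inner hμc
      exact h1.neg.smul hνc
    · exact h.hasDerivWithinAt_velocity_of_normal hpq hsub hgc' hγ'
        (fun t ht => (hnorm t (hsub ht)).le) hμc hνd (fun t ht => hf.norm_unitNormal (hU ht))
        (fun t ht x hx => hf.inner_unitNormal_nonpos h.isClosed h.convex (hU ht) (hK t ht) hx) hgν
  obtain ⟨hAc, hA⟩ := continuousOn_derivWithin_of_local h.geodesic.lt fun t₀ ht₀ => by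
    obtain ⟨U, f, p, q, -, -, h1, h2, -, -, -, h3, h4⟩ := hlocal t₀ ht₀
    exact ⟨p, q, h1, h2, _, h3, h4⟩
  have hformula : ∀ t ∈ Icc a b, ∃ (k : ℝ) (ν : E3), 0 < k ∧ ‖ν‖ = 1 ∧
      (∀ x ∈ K, inner ℝ (x - γ t) ν ≤ 0) ∧ derivWithin g (Icc a b) t = -k • ν := by
    intro t ht
    obtain ⟨U, f, p, q, hpq, hf, htpq, hnhds, hsub, hU, hgν, -, hd⟩ := hlocal t ht
    have hK := h.geodesic.mapsTo ht
    have hg0 : g t ≠ 0 := norm_pos_iff.1 (by rw [hnorm t ht]; exact h.speed_pos)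
    refine ⟨_, _, ?_, hf.norm_unitNormal (hU htpq), fun x hx =>
      hf.inner_unitNormal_nonpos h.isClosed h.convex (hU htpq) hK hx,
      ((hd t htpq).mono_of_mem_nhdsWithin hnhds).derivWithin (uniqueDiffOn_Icc h.geodesic.lt t ht)⟩
    rw [real_inner_comm]
    exact hf.inner_fderiv_unitNormal_pos h.isClosed h.convex (hU htpq) hK
      (h.curvature_pos _ hK) hg0 (by rw [real_inner_comm]; exact hgν t htpq)
  refine ⟨g, derivWithin g (Icc a b), hγ, hnorm, hA, hAc, fun t ht x hx => ?_, fun t ht => ?_⟩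
  · obtain ⟨k, ν, hk, -, hν, e⟩ := hformula t ht
    rw [e, inner_smul_right]
    exact mul_nonneg_of_nonpos_of_nonpos (neg_nonpos.2 hk.le) (hν x hx)
  · obtain ⟨k, ν, hk, hν, -, e⟩ := hformula t ht
    rw [e, smul_ne_zero_iff]
    exact ⟨neg_ne_zero.2 hk.ne', norm_pos_iff.1 (by rw [hν]; exact one_pos)⟩

end IsGeodesicOnBody

/-! ### Total curvature and the variation of the velocity -/

/-- For an angle `θ` up to `π / 2`, `‖x - y‖` is at least the height `‖y‖ sin θ`, and Jordan's
inequality applies. For an obtuse angle, `‖x - y‖ ≥ ‖y‖`. -/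
theorem angle_le_pi_mul_norm_sub_div (x : E3) {y : E3} (hy : y ≠ 0) :
    InnerProductGeometry.angle x y ≤ Real.pi * ‖x - y‖ / ‖y‖ := by
  have hy0 := norm_pos_iff.2 hy
  set θ := InnerProductGeometry.angle x y with hθ
  have hcos : Real.cos θ * (‖x‖ * ‖y‖) = inner ℝ x y :=
    InnerProductGeometry.cos_angle_mul_norm_mul_norm x y
  have hθ0 : 0 ≤ θ := InnerProductGeometry.angle_nonneg x y
  have hsq : ‖x - y‖ ^ 2 = (‖x‖ - ‖y‖ * Real.cos θ) ^ 2 + (‖y‖ * Real.sin θ) ^ 2 := by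
    rw [norm_sub_sq_real, ← hcos]
    linear_combination ‖y‖ ^ 2 * (-Real.sin_sq_add_cos_sq θ)
  rw [le_div_iff₀ hy0]
  rcases le_or_gt θ (Real.pi / 2) with hle | hlt
  · have h1 : ‖y‖ * Real.sin θ ≤ ‖x - y‖ :=
      abs_le_of_sq_le_sq' (by rw [hsq]; nlinarith [sq_nonneg (‖x‖ - ‖y‖ * Real.cos θ)])
        (norm_nonneg _) |>.2
    have h2 := Real.mul_le_sin hθ0 hle
    have h3 : θ ≤ Real.pi / 2 * Real.sin θ := by
      calc θ = Real.pi / 2 * (2 / Real.pi * θ) := by field_simp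
        _ ≤ Real.pi / 2 * Real.sin θ := by gcongr
    have h4 := Real.sin_nonneg_of_nonneg_of_le_pi hθ0 (InnerProductGeometry.angle_le_pi x y)
    calc θ * ‖y‖ ≤ Real.pi / 2 * Real.sin θ * ‖y‖ := by gcongr
      _ = Real.pi / 2 * (‖y‖ * Real.sin θ) := by ring
      _ ≤ Real.pi / 2 * ‖x - y‖ := by gcongr
      _ ≤ Real.pi * ‖x - y‖ := by
        gcongr
        linarith [Real.pi_pos]
  · have h1 : inner ℝ x y ≤ 0 := by
      rw [← hcos]
      exact mul_nonpos_of_nonpos_of_nonneg (Real.cos_nonpos_of_pi_div_two_le_of_le hlt.le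
        (by linarith [InnerProductGeometry.angle_le_pi x y, Real.pi_pos])) (by positivity)
    have h2 : ‖y‖ ≤ ‖x - y‖ :=
      abs_le_of_sq_le_sq' (by rw [norm_sub_sq_real]; nlinarith [sq_nonneg ‖x‖])
        (norm_nonneg _) |>.2
    have := InnerProductGeometry.angle_le_pi x y
    gcongr

theorem norm_sub_le_mul_angle {x y : E3} {r : ℝ} (hx : ‖x‖ = r) (hy : ‖y‖ = r) :
    ‖x - y‖ ≤ r * InnerProductGeometry.angle x y := by
  have hr : 0 ≤ r := hx ▸ norm_nonneg x
  have hcos := InnerProductGeometry.cos_angle_mul_norm_mul_norm x y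
  have h0 := InnerProductGeometry.angle_nonneg x y
  set θ := InnerProductGeometry.angle x y
  refine abs_le_of_sq_le_sq' ?_ (by positivity) |>.2
  rw [norm_sub_sq_real, ← hcos, hx, hy]
  have h1 := Real.one_sub_sq_div_two_le_cos (x := θ)
  have h2 := mul_le_mul_of_nonneg_left h1 (mul_nonneg hr hr)
  linarith

/-- A chord is a mean of velocities on its arc, hence makes an angle at most `π / c` times the
increment of `w` with each of them. Exterior angles are split at the velocity at the vertex, so each
edge is counted at most twice. -/
theorem totalCurvature_le {γ g : ℝ → E3} {w : ℝ → ℝ} {a b c : ℝ} (hc : 0 < c)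
    (hγ : ∀ t ∈ Icc a b, HasDerivWithinAt γ (g t) (Icc a b) t) (hg : ∀ t ∈ Icc a b, ‖g t‖ = c)
    (hw : ∀ s ∈ Icc a b, ∀ t ∈ Icc a b, s ≤ t → ‖g t - g s‖ ≤ w t - w s) :
    totalCurvature γ a b ≤ ENNReal.ofReal (4 * Real.pi * (w b - w a) / c) := by
  have hchord : ∀ s ∈ Icc a b, ∀ t ∈ Icc a b, s < t → ∀ r ∈ Icc s t,
      InnerProductGeometry.angle (γ t - γ s) (g r) ≤ Real.pi * (w t - w s) / c := by
    intro s hs t ht hst r hr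
    have hsub : Icc s t ⊆ Icc a b := Icc_subset_Icc hs.1 ht.2
    have hpos := sub_pos.2 hst
    have hgr := hg r (hsub hr)
    have h1 := (convex_Icc s t).norm_image_sub_le_of_norm_hasDerivWithin_le
      (f := fun x => γ x - x • g r) (f' := fun x => g x - (1 : ℝ) • g r) (C := w t - w s)
      (fun x hx => ((hγ x (hsub hx)).mono hsub).sub
        ((hasDerivWithinAt_id x _).smul_const (g r))) (fun x hx => ?_)
      (left_mem_Icc.2 hst.le) (right_mem_Icc.2 hst.le)
    · have e : γ t - t • g r - (γ s - s • g r) = (γ t - γ s) - (t - s) • g r := by module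
      rw [e, Real.norm_of_nonneg hpos.le] at h1
      rw [← InnerProductGeometry.angle_smul_right_of_pos _ _ hpos]
      have hne : (t - s) • g r ≠ 0 :=
        smul_ne_zero hpos.ne' (norm_pos_iff.1 (by rw [hgr]; exact hc))
      refine (angle_le_pi_mul_norm_sub_div _ hne).trans ?_
      rw [norm_smul, hgr, Real.norm_of_nonneg hpos.le, div_le_div_iff₀ (by positivity) hc]
      calc Real.pi * ‖γ t - γ s - (t - s) • g r‖ * c
          ≤ Real.pi * ((w t - w s) * (t - s)) * c := by gcongr
        _ = Real.pi * (w t - w s) * ((t - s) * c) := by ring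
    · rw [one_smul]
      have hmono : ∀ x ∈ Icc a b, ∀ y ∈ Icc a b, x ≤ y → w x ≤ w y := fun x hx y hy hxy =>
        sub_nonneg.1 ((norm_nonneg _).trans (hw x hx y hy hxy))
      have h1 := hmono s hs x (hsub hx) hx.1
      have h2 := hmono x (hsub hx) t ht hx.2
      have h3 := hmono s hs r (hsub hr) hr.1
      have h4 := hmono r (hsub hr) t ht hr.2
      rcases le_total r x with h | h
      · linarith [hw r (hsub hr) x (hsub hx) h]
      · rw [norm_sub_rev]
        linarith [hw x (hsub hx) r (hsub hr) h]
  refine iSup_le fun n => iSup_le fun t => iSup_le fun ht => ENNReal.ofReal_le_ofReal ?_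
  have hstep : ∀ i ∈ Finset.range n,
      InnerProductGeometry.angle (γ (t (i + 1)) - γ (t i)) (γ (t (i + 2)) - γ (t (i + 1))) ≤
        Real.pi / c * ((w (t (i + 1)) - w (t i)) + (w (t (i + 1 + 1)) - w (t (i + 1)))) := by
    intro i hi
    have hi := Finset.mem_range.1 hi
    have h0 := ht.mem i (by omega)
    have h1 := ht.mem (i + 1) (by omega)
    have h2 := ht.mem (i + 2) (by omega)
    have h01 := ht.lt i (by omega)
    have h12 := ht.lt (i + 1) (by omega)
    have ha := hchord _ h0 _ h1 h01 _ (right_mem_Icc.2 h01.le)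
    have hb := hchord _ h1 _ h2 h12 _ (left_mem_Icc.2 h12.le)
    rw [InnerProductGeometry.angle_comm] at hb
    refine (InnerProductGeometry.angle_le_angle_add_angle _ (g (t (i + 1))) _).trans
      ((add_le_add ha hb).trans_eq ?_)
    ring
  refine (Finset.sum_le_sum hstep).trans ?_
  rw [← Finset.mul_sum, Finset.sum_add_distrib, Finset.sum_range_sub (fun i => w (t i)),
    Finset.sum_range_sub (fun i => w (t (i + 1)))]
  have hmono : ∀ x ∈ Icc a b, w a ≤ w x ∧ w x ≤ w b := fun x hx => by
    have hab := hx.1.trans hx.2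
    exact ⟨sub_nonneg.1 ((norm_nonneg _).trans (hw a (left_mem_Icc.2 hab) x hx hx.1)),
      sub_nonneg.1 ((norm_nonneg _).trans (hw x hx b (right_mem_Icc.2 hab) hx.2))⟩
  have h1 := hmono _ (ht.mem n (by omega))
  have h2 := hmono _ (ht.mem 0 (by omega))
  have h3 := hmono _ (ht.mem (n + 1) le_rfl)
  have h4 := hmono _ (ht.mem (0 + 1) (by omega))
  calc Real.pi / c * ((w (t n) - w (t 0)) + (w (t (n + 1)) - w (t (0 + 1))))
      ≤ Real.pi / c * (2 * (w b - w a)) := by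
        gcongr
        linarith
    _ ≤ 4 * Real.pi * (w b - w a) / c := by
        have : 0 ≤ Real.pi / c * (w b - w a) :=
          mul_nonneg (by positivity) (by linarith)
        calc Real.pi / c * (2 * (w b - w a)) ≤ 4 * (Real.pi / c * (w b - w a)) := by linarith
          _ = 4 * Real.pi * (w b - w a) / c := by ring

/-! ### Total curvature from below by the variation of the velocity -/

theorem sum_range_two_mul (f : ℕ → ℝ) (n : ℕ) :
    ∑ i ∈ Finset.range (2 * n), f i = ∑ i ∈ Finset.range n, (f (2 * i) + f (2 * i + 1)) := by
  induction n with
  | zero => simp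
  | succ n ih =>
    rw [Finset.sum_range_succ, ← ih, show 2 * (n + 1) = 2 * n + 1 + 1 by ring,
      Finset.sum_range_succ, Finset.sum_range_succ, add_assoc]

/-- The short chords are alternate edges of one inscribed polygon. By the triangle inequality for
angles, the turn between consecutive ones is at most the two exterior angles at the ends of the edge
joining them. -/
theorem sum_angle_chords_le_totalCurvature {γ : ℝ → E3} {x y h : ℝ}
    (hinj : InjOn γ (Icc x y)) {n : ℕ} {u : ℕ → ℝ} (hu : ∀ i ≤ n, u i ∈ Ico x y) (hh : 0 < h)
    (hhy : ∀ i ≤ n, u i + h ≤ y) (hhu : ∀ i < n, u i + h < u (i + 1)) :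
    ENNReal.ofReal (∑ i ∈ Finset.range n, InnerProductGeometry.angle (γ (u i + h) - γ (u i))
      (γ (u (i + 1) + h) - γ (u (i + 1)))) ≤ totalCurvature γ x y := by
  set t : ℕ → ℝ := fun k => u (k / 2) + if k % 2 = 1 then h else 0 with ht
  have he : ∀ j, t (2 * j) = u j := fun j => by
    simp [ht]
  have ho : ∀ j, t (2 * j + 1) = u j + h := fun j => by
    simp only [ht]
    rw [show (2 * j + 1) / 2 = j by omega, if_pos (by omega)]
  have hpar : ∀ k : ℕ, ∃ j, k = 2 * j ∨ k = 2 * j + 1 := fun k => ⟨k / 2, by omega⟩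
  have hmem : ∀ i ≤ 2 * n + 1, t i ∈ Icc x y := by
    intro i hi
    obtain ⟨j, rfl | rfl⟩ := hpar i
    · rw [he]; exact Ico_subset_Icc_self (hu j (by omega))
    · rw [ho]; exact ⟨by linarith [(hu j (by omega)).1], hhy j (by omega)⟩
  have hlt : ∀ i ≤ 2 * n, t i < t (i + 1) := by
    intro i hi
    obtain ⟨j, rfl | rfl⟩ := hpar i
    · rw [he, ho]; linarith
    · rw [ho, show 2 * j + 1 + 1 = 2 * (j + 1) by ring, he]; exact hhu j (by omega)
  have hpoly : IsInscribedPolygon γ x y (2 * n) t :=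
    ⟨hmem, hlt, fun i hi heq => (hlt i hi).ne (hinj (hmem i (by omega)) (hmem (i + 1) (by omega))
      heq)⟩
  refine le_trans (ENNReal.ofReal_le_ofReal ?_)
    (le_iSup_of_le (2 * n) (le_iSup_of_le t (le_iSup_of_le hpoly le_rfl)))
  rw [sumExteriorAngles, sum_range_two_mul]
  refine Finset.sum_le_sum fun i _ => ?_
  rw [show 2 * i + 1 + 2 = 2 * (i + 1) + 1 by ring, show 2 * i + 1 + 1 = 2 * (i + 1) by ring,
    he, he, ho, ho]
  exact InnerProductGeometry.angle_le_angle_add_angle _ _ _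

theorem tendsto_inv_smul_sub {γ : ℝ → E3} {v : E3} {x y s : ℝ} (hs : s ∈ Ico x y)
    (h : HasDerivWithinAt γ v (Icc x y) s) :
    Filter.Tendsto (fun h : ℝ => h⁻¹ • (γ (s + h) - γ s)) (nhdsWithin 0 (Ioi 0)) (nhds v) := by
  have h1 := h.mono_of_mem_nhdsWithin (Icc_mem_nhdsGE_of_mem hs)
  have h2 := hasDerivWithinAt_iff_tendsto_slope.1 (h1.mono Ioi_subset_Ici_self)
  rw [sdiff_singleton_eq_self (by simp)] at h2
  have h3 : Filter.Tendsto (fun h : ℝ => s + h) (nhdsWithin 0 (Ioi 0))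
      (nhdsWithin s (Ioi s)) := by
    refine tendsto_nhdsWithin_iff.2 ⟨?_, ?_⟩
    · have : Continuous fun h : ℝ => s + h := by fun_prop
      simpa using (this.tendsto 0).mono_left (nhdsWithin_le_nhds (s := Ioi 0))
    · filter_upwards [self_mem_nhdsWithin] with h hh
      have hh : 0 < h := hh
      exact lt_add_of_pos_right _ hh
  refine (h2.comp h3).congr fun h => ?_
  simp [slope_def_module]

theorem tendsto_angle {l : Filter ℝ} {f k : ℝ → E3} {x y : E3} (hf : Filter.Tendsto f l (nhds x))
    (hk : Filter.Tendsto k l (nhds y)) (hx : x ≠ 0) (hy : y ≠ 0) :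
    Filter.Tendsto (fun h => InnerProductGeometry.angle (f h) (k h)) l
      (nhds (InnerProductGeometry.angle x y)) := by
  have h1 : Filter.Tendsto (fun h => inner ℝ (f h) (k h)) l (nhds (inner ℝ x y)) := hf.inner hk
  have h2 : Filter.Tendsto (fun h => ‖f h‖ * ‖k h‖) l (nhds (‖x‖ * ‖y‖)) := hf.norm.mul hk.norm
  have h3 := h1.div h2 (mul_ne_zero (norm_ne_zero_iff.2 hx) (norm_ne_zero_iff.2 hy))
  exact (Real.continuous_arccos.tendsto _).comp h3

/-- For a fixed partition, velocities are limits of short chords `γ (u i + h) - γ (u i)`; on a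
sphere of radius `c` a chord is at most `c` times the angle. -/
theorem eVariationOn_velocity_le {γ g : ℝ → E3} {x y c : ℝ} (hc : 0 < c) (hxy : x < y)
    (hinj : InjOn γ (Icc x y)) (hγ : ∀ t ∈ Icc x y, HasDerivWithinAt γ (g t) (Icc x y) t)
    (hg : ∀ t ∈ Icc x y, ‖g t‖ = c) (hgc : ContinuousOn g (Icc x y)) :
    eVariationOn g (Icc x y) ≤ ENNReal.ofReal c * totalCurvature γ x y := by
  have hcy : ContinuousWithinAt g (Iic y) y :=
    (hgc y (right_mem_Icc.2 hxy.le)).mono_of_mem_nhdsWithin (Icc_mem_nhdsLE hxy)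
  -- Continuity allows the right endpoint to be dropped, leaving room for the forward chord at the
  -- last partition point.
  rw [← eVariationOn.eVariationOn_Ico_eq_Icc_of_continuousWithinAt hcy,
    eVariationOn.eVariationOn_eq_strictMonoOn]
  refine iSup_le ?_
  rintro ⟨n, u, hu, hmem⟩
  simp only
  have hmem' : ∀ i ≤ n, u i ∈ Ico x y := fun i hi => hmem i hi
  have hlt : ∀ i < n, u i < u (i + 1) := fun i hi => hu (by simp; omega) (by simp; omega) (by omega)
  have hev : ∀ᶠ h in nhdsWithin (0 : ℝ) (Ioi 0), ENNReal.ofReal (c *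
      ∑ i ∈ Finset.range n, InnerProductGeometry.angle (h⁻¹ • (γ (u i + h) - γ (u i)))
        (h⁻¹ • (γ (u (i + 1) + h) - γ (u (i + 1))))) ≤
      ENNReal.ofReal c * totalCurvature γ x y := by
    have h1 : ∀ᶠ h in nhdsWithin (0 : ℝ) (Ioi 0), ∀ i ∈ Finset.range (n + 1), u i + h ≤ y := by
      rw [Filter.eventually_all_finset]
      intro i hi
      have := (hmem' i (by simp at hi; omega)).2
      filter_upwards [mem_nhdsWithin_of_mem_nhds (Iio_mem_nhds (sub_pos.2 this))] with h hh
      have hh : h < y - u i := hh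
      linarith
    have h2 : ∀ᶠ h in nhdsWithin (0 : ℝ) (Ioi 0), ∀ i ∈ Finset.range n, u i + h < u (i + 1) := by
      rw [Filter.eventually_all_finset]
      intro i hi
      have := hlt i (Finset.mem_range.1 hi)
      filter_upwards [mem_nhdsWithin_of_mem_nhds (Iio_mem_nhds (sub_pos.2 this))] with h hh
      have hh : h < u (i + 1) - u i := hh
      linarith
    filter_upwards [h1, h2, self_mem_nhdsWithin] with h h1 h2 h0
    have h0 : 0 < h := h0
    rw [ENNReal.ofReal_mul hc.le]
    gcongr
    simp only [InnerProductGeometry.angle_smul_smul (inv_ne_zero h0.ne')]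
    exact sum_angle_chords_le_totalCurvature hinj hmem' h0
      (fun i hi => h1 i (by simp; omega)) (fun i hi => h2 i (by simpa using hi))
  have hlim : Filter.Tendsto (fun h : ℝ => ENNReal.ofReal (c *
      ∑ i ∈ Finset.range n, InnerProductGeometry.angle (h⁻¹ • (γ (u i + h) - γ (u i)))
        (h⁻¹ • (γ (u (i + 1) + h) - γ (u (i + 1)))))) (nhdsWithin 0 (Ioi 0))
      (nhds (ENNReal.ofReal (c * ∑ i ∈ Finset.range n,
        InnerProductGeometry.angle (g (u i)) (g (u (i + 1)))))) := by
    have hslope : ∀ i ≤ n, Filter.Tendsto (fun h : ℝ => h⁻¹ • (γ (u i + h) - γ (u i)))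
        (nhdsWithin 0 (Ioi 0)) (nhds (g (u i))) := fun i hi =>
      tendsto_inv_smul_sub (hmem' i hi) (hγ (u i) (Ico_subset_Icc_self (hmem' i hi)))
    refine ENNReal.tendsto_ofReal (Filter.Tendsto.const_mul c (tendsto_finsetSum _ fun i hi => ?_))
    have hi := Finset.mem_range.1 hi
    have hne : ∀ i ≤ n, g (u i) ≠ 0 := fun i hi => norm_pos_iff.1 (by
      rw [hg _ (Ico_subset_Icc_self (hmem' i hi))]; exact hc)
    exact tendsto_angle (hslope i (by omega)) (hslope (i + 1) (by omega)) (hne i (by omega))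
      (hne (i + 1) (by omega))
  refine le_trans ?_ (le_of_tendsto hlim hev)
  rw [Finset.mul_sum, ENNReal.ofReal_sum_of_nonneg fun i _ =>
    mul_nonneg hc.le (InnerProductGeometry.angle_nonneg _ _)]
  refine Finset.sum_le_sum fun i hi => ?_
  have hi := Finset.mem_range.1 hi
  rw [edist_comm, edist_dist, dist_eq_norm]
  exact ENNReal.ofReal_le_ofReal (norm_sub_le_mul_angle
    (hg _ (Ico_subset_Icc_self (hmem' i (by omega))))
    (hg _ (Ico_subset_Icc_self (hmem' (i + 1) (by omega)))))

/-! ### Arcs whose acceleration points into a convex body -/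

theorem sub_le_of_hasDerivWithinAt_nonneg {B B' : ℝ → ℝ} {p q : ℝ}
    (hB : ∀ t ∈ Icc p q, HasDerivWithinAt B (B' t) (Icc p q) t) (h0 : ∀ t ∈ Icc p q, 0 ≤ B' t) :
    MonotoneOn B (Icc p q) := fun x hx y hy hxy => by
  have := norm_image_sub_le_of_norm_deriv_le (F := fun _ => 0) (F' := fun _ => 0)
    (fun t _ => hasDerivWithinAt_const t _ _) hB (fun t ht => by simpa using h0 t ht) x hx y hy hxy
  simpa using this

/-- In three-space there is a unit vector orthogonal to two given ones. -/
theorem exists_unit_orthogonal (u v : E3) :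
    ∃ w : E3, ‖w‖ = 1 ∧ inner ℝ w u = 0 ∧ inner ℝ w v = 0 := by
  have hlt : Module.finrank ℝ (Submodule.span ℝ {u, v}) < 3 := by
    have h1 := finrank_span_finset_le_card (R := ℝ) ({u, v} : Finset E3)
    have h2 : ({u, v} : Finset E3).card ≤ 2 := Finset.card_le_two
    rw [Finset.coe_pair] at h1
    change Module.finrank ℝ (Submodule.span ℝ {u, v}) ≤ _ at h1
    omega
  have h3 := (Submodule.span ℝ {u, v}).finrank_add_finrank_orthogonal
  rw [finrank_euclideanSpace_fin] at h3
  have hpos : 0 < Module.finrank ℝ (Submodule.span ℝ {u, v})ᗮ := by omega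
  obtain ⟨w, hw⟩ := Module.finrank_pos_iff_exists_ne_zero.1 hpos
  have hw0 : (w : E3) ≠ 0 := by simpa using hw
  have horth : ∀ x ∈ ({u, v} : Set E3), inner ℝ (w : E3) x = 0 := fun x hx => by
    rw [real_inner_comm]
    exact (Submodule.mem_orthogonal _ _).1 w.2 x (Submodule.subset_span hx)
  refine ⟨‖(w : E3)‖⁻¹ • (w : E3), by
    rw [norm_smul, norm_inv, norm_norm, inv_mul_cancel₀ (norm_ne_zero_iff.2 hw0)], ?_, ?_⟩ <;>
  rw [inner_smul_left, horth _ (by simp), mul_zero]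

theorem exists_eq_sum_inner_smul {e₁ e₂ : E3} (h₁ : ‖e₁‖ = 1) (h₂ : ‖e₂‖ = 1)
    (h₁₂ : inner ℝ e₁ e₂ = 0) : ∃ n : E3, ‖n‖ = 1 ∧
      ∀ v : E3, v - inner ℝ v n • n = inner ℝ v e₁ • e₁ + inner ℝ v e₂ • e₂ := by
  obtain ⟨n, hn, hn1, hn2⟩ := exists_unit_orthogonal e₁ e₂
  have hon : Orthonormal ℝ ![n, e₁, e₂] := by
    refine ⟨fun i => ?_, fun i j hij => ?_⟩
    · fin_cases i <;> simp [hn, h₁, h₂]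
    · fin_cases i <;> fin_cases j <;>
        simp_all [real_inner_comm]
  have hspan : ⊤ ≤ Submodule.span ℝ (range ![n, e₁, e₂]) := by
    refine (hon.linearIndependent.span_eq_top_of_card_eq_finrank' ?_).ge
    simp
  refine ⟨n, hn, fun v => ?_⟩
  have h := (OrthonormalBasis.mk hon hspan).sum_repr' v
  simp only [OrthonormalBasis.coe_mk, Fin.sum_univ_three] at h
  simp only [Matrix.cons_val_zero, Matrix.cons_val_one, Matrix.cons_val] at h
  rw [real_inner_comm n, real_inner_comm e₁, real_inner_comm e₂, sub_eq_iff_eq_add']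
  rw [← add_assoc]
  exact h.symm

theorem norm_sub_inner_smul_sq {u : E3} (hu : ‖u‖ = 1) (v : E3) :
    ‖v - inner ℝ v u • u‖ ^ 2 = ‖v‖ ^ 2 - inner ℝ v u ^ 2 := by
  rw [norm_sub_sq_real, inner_smul_right, norm_smul, hu, mul_one, Real.norm_eq_abs, sq_abs]
  ring

theorem norm_sub_inner_smul_le {u : E3} (hu : ‖u‖ = 1) (v : E3) :
    ‖v - inner ℝ v u • u‖ ≤ ‖v‖ :=
  abs_le_of_sq_le_sq' (by rw [norm_sub_inner_smul_sq hu]; linarith [sq_nonneg (inner ℝ v u)])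
    (norm_nonneg _) |>.2

/-! ### Short arcs and thin bodies -/

/-- A curve of speed `c` with velocity `g` and acceleration `A` that runs in the convex body `K`,
accelerates towards it, and is not longer than paths outside of it. -/
structure IsShortArc (K : Set E3) (γ g A : ℝ → E3) (a b c : ℝ) : Prop where
  convex : Convex ℝ K
  lt : a < b
  speed_pos : 0 < c
  mem : ∀ t ∈ Icc a b, γ t ∈ K
  velocity : ∀ t ∈ Icc a b, HasDerivWithinAt γ (g t) (Icc a b) t
  norm_velocity : ∀ t ∈ Icc a b, ‖g t‖ = c
  acceleration : ∀ t ∈ Icc a b, HasDerivWithinAt g (A t) (Icc a b) t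
  inner_nonneg : ∀ t ∈ Icc a b, ∀ x ∈ K, 0 ≤ inner ℝ (x - γ t) (A t)
  normal : ∀ t ∈ Icc a b, ∃ ν : E3, ν ≠ 0 ∧ ∀ x ∈ K, inner ℝ (x - γ t) ν ≤ 0
  short : ∀ s ∈ Icc a b, ∀ t ∈ Icc a b, s < t → ∀ z z' : E3,
    segment ℝ (γ s) z ⊆ (interior K)ᶜ → segment ℝ z z' ⊆ (interior K)ᶜ →
    segment ℝ z' (γ t) ⊆ (interior K)ᶜ → c * (t - s) ≤ ‖z - γ s‖ + ‖z' - z‖ + ‖γ t - z'‖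

/-- The part of `K` at distance at most `R` from `p` is within distance `κ R` of the line through
`p` in the direction `u`. -/
def IsThinAt (K : Set E3) (p u : E3) (κ R : ℝ) : Prop :=
  ∀ x ∈ K, ‖x - p‖ ≤ R → ‖(x - p) - inner ℝ (x - p) u • u‖ ≤ κ * R

/-- A distant point is contracted towards `p` to distance `R`; it stays in `K` by convexity, and its
distance to the line scales. -/
theorem IsThinAt.norm_le {K : Set E3} {p u : E3} {κ R : ℝ} (h : IsThinAt K p u κ R)
    (hK : Convex ℝ K) (hp : p ∈ K) (hR : 0 < R) {x : E3} (hx : x ∈ K) {L : ℝ}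
    (hRL : R ≤ L) (hxL : ‖x - p‖ ≤ L) (hκ : 0 ≤ κ) :
    ‖(x - p) - inner ℝ (x - p) u • u‖ ≤ κ * L := by
  rcases le_or_gt ‖x - p‖ R with hle | hlt
  · exact (h x hx hle).trans (by gcongr)
  · have hpos : 0 < ‖x - p‖ := hR.trans hlt
    have hs : 0 < R / ‖x - p‖ := by positivity
    have h1 := h (p + (R / ‖x - p‖) • (x - p))
      (hK.add_smul_sub_mem hp hx ⟨hs.le, (div_le_one hpos).2 hlt.le⟩) (by
        rw [add_sub_cancel_left, norm_smul, Real.norm_of_nonneg hs.le, div_mul_cancel₀ _ hpos.ne'])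
    rw [add_sub_cancel_left, inner_smul_left, conj_trivial, mul_smul, ← smul_sub, norm_smul,
      Real.norm_of_nonneg hs.le, div_mul_eq_mul_div, div_le_iff₀ hpos] at h1
    have h2 : ‖(x - p) - inner ℝ (x - p) u • u‖ ≤ κ * ‖x - p‖ := by
      refine le_of_mul_le_mul_left ?_ hR
      linarith
    exact h2.trans (by gcongr)

namespace IsShortArc

variable {K : Set E3} {γ g A : ℝ → E3} {a b c : ℝ}

theorem norm_sub_le (h : IsShortArc K γ g A a b c) {s t : ℝ} (hs : a ≤ s) (hst : s ≤ t)
    (ht : t ≤ b) : ‖γ t - γ s‖ ≤ c * (t - s) := by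
  have h1 := norm_image_sub_le_of_norm_deriv_le h.velocity (B := fun t => c * t) (B' := fun _ => c)
    (fun t _ => by simpa using ((hasDerivAt_id t).const_mul c).hasDerivWithinAt)
    (fun t ht => (h.norm_velocity t ht).le) s ⟨hs, hst.trans ht⟩ t ⟨hs.trans hst, ht⟩ hst
  linarith

theorem continuousOn_velocity (h : IsShortArc K γ g A a b c) : ContinuousOn g (Icc a b) :=
  fun t ht => (h.acceleration t ht).continuousWithinAt

/-- A short arc starting at the tip of a thin body is almost as short as its chord. -/
theorem length_le_of_isThinAt (h : IsShortArc K γ g A a b c) {u : E3} {κ R : ℝ}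
    (hκ : 0 < κ) (hκ1 : κ ≤ 1 / 100) (hR : 0 < R) (hthin : IsThinAt K (γ a) u κ R)
    {t : ℝ} (ht : t ∈ Icc a b) (hRt : R ≤ c * (t - a)) :
    c * (t - a) ≤ ‖γ t - γ a‖ + 6 * κ * (c * (t - a)) := by
  have haI := left_mem_Icc.2 h.lt.le
  have hc := h.speed_pos
  have hat : a < t := by
    by_contra! hle
    nlinarith [mul_nonneg hc.le (sub_nonneg.2 hle)]
  obtain ⟨ν, hν0, hν⟩ := h.normal a haI
  obtain ⟨μ, hμ0, hμ⟩ := h.normal t ht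
  -- Two orthogonality conditions leave a line of directions in three-space, and the sign remains
  -- free to handle `μ`.
  obtain ⟨w, hw1, hwu, hwν, hwμ⟩ : ∃ w : E3, ‖w‖ = 1 ∧ inner ℝ u w = 0 ∧ 0 ≤ inner ℝ w ν ∧
      0 ≤ inner ℝ w μ := by
    obtain ⟨w, hw1, hwu, hwν⟩ := exists_unit_orthogonal u ν
    rw [real_inner_comm] at hwu
    rcases le_total 0 (inner ℝ w μ) with h0 | h0
    · exact ⟨w, hw1, hwu, hwν.ge, h0⟩
    · exact ⟨-w, by rw [norm_neg, hw1], by rw [inner_neg_right, hwu, neg_zero],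
        by rw [inner_neg_left, hwν, neg_zero], by rw [inner_neg_left]; linarith⟩
  set L := c * (t - a) with hL
  have hL0 : 0 < L := hR.trans_le hRt
  have hchord : ‖γ t - γ a‖ ≤ L := h.norm_sub_le le_rfl hat.le ht.2
  have hinner : ∀ x ∈ K, ∀ M, L ≤ M → ‖x - γ a‖ ≤ M → |inner ℝ (x - γ a) w| ≤ κ * M := by
    intro x hx M hLM hxM
    have h1 := hthin.norm_le h.convex (h.mem a haI) hR hx (hRt.trans hLM) hxM hκ.le
    have h2 := abs_real_inner_le_norm (x - γ a - inner ℝ (x - γ a) u • u) w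
    rw [inner_sub_left, inner_smul_left, hwu, mul_zero, sub_zero, hw1, mul_one] at h2
    exact h2.trans h1
  have hx := hinner (γ t) (h.mem t ht) L le_rfl hchord
  have hh : 0 < 3 * κ * L := by positivity
  -- The chord is shifted sideways by `3 * κ * L` along `w`. The connecting segments are outside by
  -- the supporting planes. The shifted chord is outside by thinness, as its `w`-coordinate is at
  -- least `2 * κ * L`, while for points of `K` in range it is at most `κ * (1 + 3 * κ) * L`.
  have hkey := h.short a haI t ht hat (γ a + (3 * κ * L) • w) (γ t + (3 * κ * L) • w)
    (segment_subset_interior_compl hν0 hν (by simp) (by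
      rw [add_sub_cancel_left, inner_smul_left]
      exact mul_nonneg hh.le hwν)) ?_
    (segment_subset_interior_compl hμ0 hμ (by
      rw [add_sub_cancel_left, inner_smul_left]
      exact mul_nonneg hh.le hwμ) (by simp))
  · rw [add_sub_cancel_left, add_sub_add_right_eq_sub, sub_add_cancel_left, norm_neg, norm_smul,
      hw1, Real.norm_of_nonneg hh.le] at hkey
    linarith
  · rintro z ⟨α, β, hα, hβ, hαβ, rfl⟩ hz
    have e : α • (γ a + (3 * κ * L) • w) + β • (γ t + (3 * κ * L) • w) - γ a =
        β • (γ t - γ a) + (3 * κ * L) • w := by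
      rw [← eq_sub_iff_add_eq] at hαβ
      rw [hαβ]
      module
    have hβ1 : β ≤ 1 := by linarith
    have hnorm : ‖β • (γ t - γ a) + (3 * κ * L) • w‖ ≤ L + 3 * κ * L := by
      refine (norm_add_le _ _).trans ?_
      rw [norm_smul, norm_smul, hw1, Real.norm_of_nonneg hβ, Real.norm_of_nonneg hh.le, mul_one]
      have : β * ‖γ t - γ a‖ ≤ 1 * L := by gcongr
      linarith
    have h1 := hinner _ (interior_subset hz) (L + 3 * κ * L) (by linarith) (by rw [e]; exact hnorm)
    rw [e, inner_add_left, inner_smul_left, inner_smul_left, real_inner_self_eq_norm_sq, hw1] at h1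
    have h2 := le_of_abs_le h1
    have h3 := neg_le_of_abs_le hx
    have h4 : -(κ * L) ≤ β * inner ℝ (γ t - γ a) w := by
      have := mul_le_mul_of_nonneg_left h3 hβ
      have h5 : β * (κ * L) ≤ 1 * (κ * L) := by gcongr
      linarith
    simp only [conj_trivial] at h2
    have h6 : κ * (κ * L) ≤ 1 / 100 * (κ * L) := by gcongr
    have h7 : 0 < κ * L := by positivity
    linarith

/-- The distance to the starting point is bounded by the first order expansion. -/
theorem sq_norm_sub_le (h : IsShortArc K γ g A a b c) {s t : ℝ} (hs : a ≤ s) (hst : s ≤ t)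
    (ht : t ≤ b) : ‖γ t - γ a‖ ^ 2 ≤ ‖γ s - γ a‖ ^ 2 +
      2 * inner ℝ (γ s - γ a) (g s) * (t - s) + c ^ 2 * (t - s) ^ 2 := by
  have haI := left_mem_Icc.2 h.lt.le
  have hsub : Icc s t ⊆ Icc a b := Icc_subset_Icc hs ht
  have hγ : ∀ x ∈ Icc s t, HasDerivWithinAt γ (g x) (Icc s t) x := fun x hx =>
    (h.velocity x (hsub hx)).mono hsub
  have hg : ∀ x ∈ Icc s t, HasDerivWithinAt g (A x) (Icc s t) x := fun x hx =>
    (h.acceleration x (hsub hx)).mono hsub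
  have hsI := left_mem_Icc.2 hst
  have htI := right_mem_Icc.2 hst
  have hself : ∀ x ∈ Icc s t, inner ℝ (g x) (g x) = c ^ 2 := fun x hx => by
    rw [real_inner_self_eq_norm_sq, h.norm_velocity x (hsub hx)]
  -- The derivative of `⟪γ - γ a, g⟫` is `c ^ 2 + ⟪γ - γ a, A⟫`, and the last term is nonpositive
  -- because `A` points towards `γ a ∈ K`. A second integration gives the claim.
  have h1 : MonotoneOn (fun x => c ^ 2 * x - inner ℝ (γ x - γ a) (g x)) (Icc s t) := by
    refine sub_le_of_hasDerivWithinAt_nonneg (B' := fun x => c ^ 2 * 1 -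
      (inner ℝ (γ x - γ a) (A x) + inner ℝ (g x) (g x))) (fun x hx =>
      ((hasDerivAt_id x).const_mul (c ^ 2)).hasDerivWithinAt.sub
        (((hγ x hx).sub_const (γ a)).inner ℝ (hg x hx))) fun x hx => ?_
    have h2 := h.inner_nonneg x (hsub hx) (γ a) (h.mem a haI)
    rw [← neg_sub, inner_neg_left] at h2
    rw [hself x hx]
    linarith
  have h3 : MonotoneOn (fun x => 2 * inner ℝ (γ s - γ a) (g s) * x + c ^ 2 * (x - s) ^ 2 -
      ‖γ x - γ a‖ ^ 2) (Icc s t) := by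
    refine sub_le_of_hasDerivWithinAt_nonneg (B' := fun x => 2 * inner ℝ (γ s - γ a) (g s) * 1 +
      c ^ 2 * (((2 : ℕ) : ℝ) * (x - s) ^ (2 - 1) * 1) - 2 * inner ℝ (γ x - γ a) (g x))
      (fun x hx => ((((hasDerivAt_id x).const_mul _).hasDerivWithinAt).add
        (((((hasDerivAt_id x).sub_const s).pow 2).const_mul _).hasDerivWithinAt)).sub
        ((hγ x hx).sub_const (γ a)).norm_sq) fun x hx => ?_
    have h2 := h1 hsI hx hx.1
    simp only at h2
    norm_num
    linarith
  have h4 := h3 hsI htI hst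
  simp only at h4
  linarith

/-- With `T = t - a`, the chord to parameter `t + T` is almost `2 * c * T` long. The expansion at
`t` then forces `⟪γ t - γ a, T • g t⟫` to be almost `(c * T) ^ 2`, so `T • g t` is close to the
chord `γ t - γ a`, which is almost parallel to `u`. -/
theorem norm_velocity_sub_le_of_isThinAt (h : IsShortArc K γ g A a b c) {u : E3} {k R : ℝ}
    (hu : ‖u‖ = 1) (hk : 0 < k) (hk1 : k ≤ 1 / 10) (hR : 0 < R)
    (hthin : IsThinAt K (γ a) u (k ^ 2) R) {t : ℝ} (hat : a ≤ t) (htb : 2 * (t - a) ≤ b - a)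
    (hRt : R ≤ c * (t - a)) : ‖g t - inner ℝ (g t) u • u‖ ≤ 8 * k * c := by
  have haI := left_mem_Icc.2 h.lt.le
  have hc := h.speed_pos
  have htI : t ∈ Icc a b := ⟨hat, by linarith⟩
  have hk2 : k ^ 2 ≤ 1 / 100 := by nlinarith
  have hT : 0 < t - a := by
    by_contra! hle
    nlinarith [mul_nonneg hc.le (neg_nonneg.2 hle)]
  have hlen := h.length_le_of_isThinAt (by positivity) hk2 hR hthin
    (t := t + (t - a)) ⟨by linarith, by linarith⟩ (by nlinarith)
  have hsq := h.sq_norm_sub_le hat (t := t + (t - a)) (by linarith) (by linarith)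
  have hchord := h.norm_sub_le le_rfl hat htI.2
  have hperp := hthin.norm_le h.convex (h.mem a haI) hR (h.mem t htI) hRt hchord (by positivity)
  set T := t - a with hTdef
  rw [show t + T - a = 2 * T by rw [hTdef]; ring] at hlen
  rw [add_sub_cancel_left] at hsq
  set y := γ t - γ a
  set D := inner ℝ y (g t) with hD
  have h1 : (2 * (c * T) * (1 - 6 * k ^ 2)) ^ 2 ≤ ‖γ (t + T) - γ a‖ ^ 2 := by
    refine pow_le_pow_left₀ (mul_nonneg (by positivity) (by linarith)) ?_ 2
    linarith
  have hy2 : ‖y‖ ^ 2 ≤ (c * T) ^ 2 := pow_le_pow_left₀ (norm_nonneg _) hchord 2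
  have hDlow : (1 - 24 * k ^ 2) * (c * T) ^ 2 ≤ T * D := by
    have h2 : 4 * (1 - 12 * k ^ 2) * (c * T) ^ 2 ≤ (2 * (c * T) * (1 - 6 * k ^ 2)) ^ 2 := by
      nlinarith [sq_nonneg (c * T * (6 * k ^ 2))]
    nlinarith
  have hdiff : ‖T • g t - y‖ ≤ 7 * k * (c * T) := by
    refine abs_le_of_sq_le_sq' ?_ (by positivity) |>.2
    rw [norm_sub_sq_real, norm_smul, h.norm_velocity t htI, Real.norm_of_nonneg hT.le,
      inner_smul_left, real_inner_comm, ← hD]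
    simp only [conj_trivial]
    nlinarith [sq_nonneg (k * (c * T))]
  have h3 := norm_sub_inner_smul_le hu (T • g t - y)
  have e : T • (g t - inner ℝ (g t) u • u) = ((T • g t - y) - inner ℝ (T • g t - y) u • u) +
      (y - inner ℝ y u • u) := by
    rw [inner_sub_left, inner_smul_left]
    simp only [conj_trivial]
    module
  have h4 : T * ‖g t - inner ℝ (g t) u • u‖ ≤ T * (8 * k * c) := by
    calc T * ‖g t - inner ℝ (g t) u • u‖ = ‖T • (g t - inner ℝ (g t) u • u)‖ := by
          rw [norm_smul, Real.norm_of_nonneg hT.le]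
      _ ≤ 7 * k * (c * T) + k ^ 2 * (c * T) := by
          rw [e]
          exact (norm_add_le _ _).trans (add_le_add (h3.trans hdiff) hperp)
      _ ≤ T * (8 * k * c) := by
          have : k * (k * (c * T)) ≤ 1 * (k * (c * T)) := by gcongr; linarith
          nlinarith
  exact le_of_mul_le_mul_left h4 hT

/-- Along a thin body the direction of a short arc is almost constant. -/
theorem exists_angle_lt_of_isThinAt (h : IsShortArc K γ g A a b c) {u : E3} {ε R : ℝ}
    (hu : ‖u‖ = 1) (hε : 0 < ε) (hε1 : ε ≤ 1) (hR : 0 < R)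
    (hthin : IsThinAt K (γ a) u ((ε / 40) ^ 2) R) {s m : ℝ} (has : a ≤ s) (hsm : s ≤ m)
    (hm : 2 * (m - a) ≤ b - a) (hRs : R ≤ c * (s - a)) :
    ∃ v : E3, ‖v‖ = 1 ∧ ∀ t ∈ Icc s m, InnerProductGeometry.angle (g t) v < ε := by
  have hc := h.speed_pos
  have hsub : Icc s m ⊆ Icc a b := Icc_subset_Icc has (by linarith [h.lt])
  have hperp : ∀ t ∈ Icc s m, c ^ 2 - inner ℝ (g t) u ^ 2 ≤ (8 * (ε / 40) * c) ^ 2 := by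
    intro t ht
    have h1 := h.norm_velocity_sub_le_of_isThinAt hu (k := ε / 40) (by positivity) (by linarith)
      hR hthin (has.trans ht.1) (by linarith [ht.2]) (hRs.trans (by gcongr; exact ht.1))
    rw [← h.norm_velocity t (hsub ht), ← norm_sub_inner_smul_sq hu]
    rw [h.norm_velocity t (hsub ht)]
    exact pow_le_pow_left₀ (norm_nonneg _) h1 2
  have hcont : ContinuousOn (fun t => inner ℝ (g t) u) (Icc s m) :=
    (h.continuousOn_velocity.mono hsub).inner continuousOn_const
  have hne : ∀ t ∈ Icc s m, inner ℝ (g t) u ≠ 0 := fun t ht h0 => by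
    have h1 := hperp t ht
    rw [h0] at h1
    have h2 : ε ^ 2 * c ^ 2 ≤ 1 * c ^ 2 := by
      gcongr
      nlinarith
    have h3 : 0 < c ^ 2 := by positivity
    nlinarith
  have hfin : ∀ v : E3, ‖v‖ = 1 → (∀ t ∈ Icc s m, inner ℝ (g t) v ^ 2 = inner ℝ (g t) u ^ 2) →
      (∀ t ∈ Icc s m, 0 < inner ℝ (g t) v) →
      ∀ t ∈ Icc s m, InnerProductGeometry.angle (g t) v < ε := by
    intro v hv hvu hpos t ht
    have hgt := h.norm_velocity t (hsub ht)
    rw [← InnerProductGeometry.angle_smul_right_of_pos _ _ hc]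
    have hcv : ‖c • v‖ = c := by rw [norm_smul, hv, Real.norm_of_nonneg hc.le, mul_one]
    -- The square is `2c (c - ⟪g, v⟫) ≤ 2 (c ^ 2 - ⟪g, v⟫ ^ 2)`, at most `128 (ε / 40) ^ 2 c ^ 2`,
    -- and `128 ≤ 12 ^ 2`. The factor `40` is such that `12π / 40 < 1`.
    have h1 : ‖g t - c • v‖ ≤ 12 * (ε / 40) * c := by
      refine abs_le_of_sq_le_sq' ?_ (by positivity) |>.2
      rw [norm_sub_sq_real, hcv, hgt, inner_smul_right]
      have h2 := hperp t ht
      rw [← hvu t ht] at h2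
      have h3 : inner ℝ (g t) v ≤ c := by
        have := real_inner_le_norm (g t) v
        rwa [hgt, hv, mul_one] at this
      have h4 := mul_nonneg (hpos t ht).le (sub_nonneg.2 h3)
      nlinarith [sq_nonneg (ε * c)]
    refine (angle_le_pi_mul_norm_sub_div _ (norm_pos_iff.1 (by rw [hcv]; exact hc))).trans_lt ?_
    rw [hcv, div_lt_iff₀ hc]
    have hπ := Real.pi_lt_d2
    calc Real.pi * ‖g t - c • v‖ ≤ Real.pi * (12 * (ε / 40) * c) := by gcongr
      _ ≤ 3.15 * (12 * (ε / 40) * c) := by gcongr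
      _ < ε * c := by nlinarith [mul_pos hε hc]
  have hsI := left_mem_Icc.2 hsm
  -- The component along `u` never vanishes, so it keeps its sign, which selects `u` or `-u` for the
  -- whole arc.
  rcases lt_or_gt_of_ne (hne s hsI) with hlt | hgt
  · refine ⟨-u, by rw [norm_neg, hu], hfin (-u) (by rw [norm_neg, hu])
      (fun t _ => by rw [inner_neg_right, neg_sq]) fun t ht => ?_⟩
    rw [inner_neg_right, neg_pos]
    by_contra! hle
    obtain ⟨x, hx, hx0⟩ := isPreconnected_Icc.intermediate_value hsI ht hcont ⟨hlt.le, hle⟩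
    exact hne x hx hx0
  · refine ⟨u, hu, hfin u hu (fun t _ => rfl) fun t ht => ?_⟩
    by_contra! hle
    obtain ⟨x, hx, hx0⟩ := isPreconnected_Icc.intermediate_value ht hsI hcont ⟨hle, hgt.le⟩
    exact hne x hx hx0

end IsShortArc

/-! ### Arcs near the tip of a fat body -/

/-- Pigeonhole: pieces on which `M` rises by `η` are split off by the intermediate value theorem,
and some piece carries its share of the increment of `v`. -/
theorem exists_subinterval_of_continuousOn {M v : ℝ → ℝ} {η t : ℝ} (hη : 0 ≤ η) (N : ℕ) :
    ∀ s ≤ t, ContinuousOn M (Icc s t) → M t - M s ≤ (N + 1 : ℕ) * η →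
      ∃ s' t', s ≤ s' ∧ s' ≤ t' ∧ t' ≤ t ∧ M t' - M s' ≤ η ∧
        v t - v s ≤ (N + 1 : ℕ) * (v t' - v s') := by
  induction N with
  | zero => exact fun s hst _ h => ⟨s, t, le_rfl, hst, le_rfl, by simpa using h, by simp⟩
  | succ N ih =>
    intro s hst hM h
    rcases le_or_gt (M t - M s) η with hle | hlt
    · rcases le_or_gt (v t - v s) ((N + 1 + 1 : ℕ) * (v t - v s)) with h0 | h0
      · exact ⟨s, t, le_rfl, hst, le_rfl, hle, h0⟩
      -- Here the increment of `v` is negative, and a degenerate interval does better.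
      · refine ⟨s, s, le_rfl, le_rfl, hst, by simpa using hη, ?_⟩
        push_cast at h0 ⊢
        have h1 : ((N : ℝ) + 1) * (v t - v s) < 0 := by linarith
        have h2 : v t - v s < 0 := by
          by_contra! h3
          exact h1.not_ge (by positivity)
        simpa using h2.le
    · obtain ⟨r, hr, hMr⟩ := intermediate_value_Icc hst hM
        (show M s + η ∈ Icc (M s) (M t) from ⟨by linarith, by linarith⟩)
      rcases le_or_gt (v t - v s) ((N + 1 + 1 : ℕ) * (v r - v s)) with h0 | h0
      · exact ⟨s, r, le_rfl, hr.1, hr.2, by linarith, h0⟩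
      · obtain ⟨s', t', hs', hst', ht', h1, h2⟩ := ih r hr.2 (hM.mono (Icc_subset_Icc_left hr.1)) (by
          push_cast at h ⊢
          linarith)
        refine ⟨s', t', hr.1.trans hs', hst', ht', h1, ?_⟩
        push_cast at h0 h2 ⊢
        have hN : (0 : ℝ) < N + 1 := by positivity
        refine le_of_mul_le_mul_left ?_ hN
        have h3 := mul_le_mul_of_nonneg_left h2 (show (0 : ℝ) ≤ N + 1 + 1 by positivity)
        linarith

theorem sub_sq_le_abs_sq_sub_sq {x y : ℝ} (h : 0 ≤ x * y) : (x - y) ^ 2 ≤ |x ^ 2 - y ^ 2| := by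
  have h1 : |x - y| ≤ |x + y| := sq_le_sq.1 (by linarith)
  calc (x - y) ^ 2 = |x - y| * |x - y| := by rw [abs_mul_abs_self, sq]
    _ ≤ |x - y| * |x + y| := by gcongr
    _ = |x ^ 2 - y ^ 2| := by rw [← abs_mul]; ring_nf

theorem norm_sub_sq_eq_add {n : E3} (hn : ‖n‖ = 1) (x y : E3) :
    ‖x - y‖ ^ 2 = ‖(x - inner ℝ x n • n) - (y - inner ℝ y n • n)‖ ^ 2 +
      (inner ℝ x n - inner ℝ y n) ^ 2 := by
  have h := norm_sub_inner_smul_sq hn (x - y)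
  rw [show (x - y) - inner ℝ (x - y) n • n = (x - inner ℝ x n • n) - (y - inner ℝ y n • n) by
    rw [inner_sub_left]; module, inner_sub_left] at h
  linarith

theorem abs_inner_sq_sub_le {n x y : E3} {c d : ℝ} (hn : ‖n‖ = 1) (hx : ‖x‖ = c) (hy : ‖y‖ = c)
    (h : ‖(x - inner ℝ x n • n) - (y - inner ℝ y n • n)‖ ≤ d) :
    |inner ℝ x n ^ 2 - inner ℝ y n ^ 2| ≤ 2 * d * c := by
  have h1 := norm_sub_inner_smul_sq hn x
  have h2 := norm_sub_inner_smul_sq hn y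
  have h3 := norm_sub_inner_smul_le hn x
  have h4 := norm_sub_inner_smul_le hn y
  have h5 := abs_norm_sub_norm_le (x - inner ℝ x n • n) (y - inner ℝ y n • n)
  rw [hx] at h1 h3
  rw [hy] at h2 h4
  have h6 : inner ℝ x n ^ 2 - inner ℝ y n ^ 2 =
      -((‖x - inner ℝ x n • n‖ - ‖y - inner ℝ y n • n‖) *
        (‖x - inner ℝ x n • n‖ + ‖y - inner ℝ y n • n‖)) := by linarith
  rw [h6, abs_neg, abs_mul, abs_of_nonneg (a := _ + _) (by positivity)]
  calc _ ≤ d * (c + c) := by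
        gcongr
        · exact (norm_nonneg _).trans h
        · exact h5.trans h
    _ = 2 * d * c := by ring

/-- A curve on a sphere whose projection to a plane is almost constant is almost constant. -/
theorem norm_sub_le_of_norm_proj_sub_le {g : ℝ → E3} {n : E3} {c k s t : ℝ} (hn : ‖n‖ = 1)
    (hst : s ≤ t) (hc : 0 < c) (hk : 0 ≤ k) (hk1 : k ≤ 1) (hg : ∀ x ∈ Icc s t, ‖g x‖ = c)
    (hgc : ContinuousOn g (Icc s t))
    (h : ∀ x ∈ Icc s t, ∀ y ∈ Icc s t, x ≤ y →
      ‖(g y - inner ℝ (g y) n • n) - (g x - inner ℝ (g x) n • n)‖ ≤ k ^ 2 * c) :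
    ‖g t - g s‖ ≤ 3 * k * c := by
  have hs := left_mem_Icc.2 hst
  have ht := right_mem_Icc.2 hst
  have hz : ∀ x ∈ Icc s t, ∀ y ∈ Icc s t, x ≤ y →
      |inner ℝ (g y) n ^ 2 - inner ℝ (g x) n ^ 2| ≤ 2 * (k * c) ^ 2 := fun x hx y hy hxy =>
    (abs_inner_sq_sub_le hn (hg y hy) (hg x hx) (h x hx y hy hxy)).trans_eq (by ring)
  have hcont : ContinuousOn (fun t => inner ℝ (g t) n) (Icc s t) := hgc.inner continuousOn_const
  -- The squares of the normal components differ by at most `2 (k c) ^ 2`. If the signs disagree,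
  -- the component vanishes in between, so both squares have this bound and the difference squared
  -- is at most `8 (k c) ^ 2`.
  have hd : (inner ℝ (g t) n - inner ℝ (g s) n) ^ 2 ≤ 8 * (k * c) ^ 2 := by
    have hst2 := hz s hs t ht hst
    rcases le_or_gt 0 (inner ℝ (g s) n * inner ℝ (g t) n) with h0 | h0
    · rw [mul_comm] at h0
      exact (sub_sq_le_abs_sq_sub_sq h0).trans (hst2.trans (by nlinarith [sq_nonneg (k * c)]))
    · have : ∃ r ∈ Icc s t, inner ℝ (g r) n = 0 := by
        rcases mul_neg_iff.1 h0 with ⟨h1, h2⟩ | ⟨h1, h2⟩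
        · exact isPreconnected_Icc.intermediate_value ht hs hcont ⟨h2.le, h1.le⟩
        · exact isPreconnected_Icc.intermediate_value hs ht hcont ⟨h1.le, h2.le⟩
      obtain ⟨r, hr, hr0⟩ := this
      have h1 := (abs_le.1 (hz s hs r hr hr.1)).1
      have h2 := (abs_le.1 (hz r hr t ht hr.2)).2
      rw [hr0] at h1 h2
      nlinarith [sq_nonneg (inner ℝ (g t) n + inner ℝ (g s) n)]
  have hF := pow_le_pow_left₀ (norm_nonneg _) (h s hs t ht hst) 2
  refine abs_le_of_sq_le_sq' ?_ (by positivity) |>.2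
  rw [norm_sub_sq_eq_add hn]
  have h1 : (k ^ 2 * c) ^ 2 ≤ (k * c) ^ 2 := by
    refine pow_le_pow_left₀ (by positivity) ?_ 2
    gcongr
    nlinarith
  linarith

/-- The `h`s are values at the vertices of a triangle of an affine function with planar gradient
`(x, y)`. Being nonnegative, they bound its differences along two edges, and these determine the
gradient when the triangle is fat. -/
theorem mul_abs_add_abs_le {x y h₀ h₁ h₂ ℓ β η κ R : ℝ} (hκ : 0 < κ) (hκ1 : κ ≤ 1) (hR : 0 < R)
    (h0 : 0 ≤ h₀) (h1 : 0 ≤ h₁) (h2 : 0 ≤ h₂) (e1 : ℓ * x = h₁ - h₀)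
    (e2 : β * x + η * y = h₂ - h₀) (hℓ : κ * R ≤ ℓ) (hη : κ * R ≤ η) (hβ : |β| ≤ R) :
    κ ^ 2 * R * (|x| + |y|) ≤ 3 * (h₀ + h₁ + h₂) := by
  have hκR : 0 < κ * R := by positivity
  have a1 : κ * R * |x| ≤ h₀ + h₁ + h₂ := by
    calc κ * R * |x| ≤ ℓ * |x| := by gcongr
      _ = |h₁ - h₀| := by rw [← e1, abs_mul, abs_of_pos (hκR.trans_le hℓ)]
      _ ≤ _ := abs_le.2 ⟨by linarith, by linarith⟩
  have a2 : κ * R * |y| ≤ (h₀ + h₁ + h₂) + R * |x| := by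
    calc κ * R * |y| ≤ η * |y| := by gcongr
      _ = |(h₂ - h₀) - β * x| := by
        rw [← e2, add_sub_cancel_left, abs_mul, abs_of_pos (hκR.trans_le hη)]
      _ ≤ |h₂ - h₀| + |β * x| := abs_sub _ _
      _ ≤ (h₀ + h₁ + h₂) + R * |x| := by
        rw [abs_mul]
        gcongr
        exact abs_le.2 ⟨by linarith, by linarith⟩
  have a3 := mul_le_mul_of_nonneg_left a1 hκ.le
  have a4 := mul_le_mul_of_nonneg_left a2 hκ.le
  have a5 := mul_le_mul_of_nonneg_right hκ1 (show 0 ≤ h₀ + h₁ + h₂ by positivity)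
  linarith

/-- A body which is not thin at `p` contains a fat triangle with vertex `p`. -/
theorem exists_triangle_of_not_isThinAt {K : Set E3} {p : E3} {κ R : ℝ} (hκ : 0 < κ) (hR : 0 < R)
    (h : ∀ u : E3, ‖u‖ = 1 → ¬IsThinAt K p u κ R) :
    ∃ (e₁ e₂ : E3) (ℓ β η : ℝ), ‖e₁‖ = 1 ∧ ‖e₂‖ = 1 ∧ inner ℝ e₁ e₂ = 0 ∧
      p + ℓ • e₁ ∈ K ∧ p + (β • e₁ + η • e₂) ∈ K ∧ κ * R ≤ ℓ ∧ κ * R ≤ η ∧ |β| ≤ R ∧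
      ‖ℓ • e₁‖ ≤ R ∧ ‖β • e₁ + η • e₂‖ ≤ R := by
  have hκR : 0 < κ * R := by positivity
  -- An arbitrary direction provides a point farther than `κ * R` from `p`; the direction towards
  -- this point provides the third vertex.
  obtain ⟨u, hu, -, -⟩ := exists_unit_orthogonal 0 0
  have h1 := h u hu
  simp only [IsThinAt] at h1
  push Not at h1
  obtain ⟨x, hx, hxR, hxκ⟩ := h1
  have hxκ' := hxκ.trans_le (norm_sub_inner_smul_le hu _)
  have hx0 : 0 < ‖x - p‖ := hκR.trans hxκ'
  have he₁ : ‖‖x - p‖⁻¹ • (x - p)‖ = 1 := by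
    rw [norm_smul, norm_inv, norm_norm, inv_mul_cancel₀ hx0.ne']
  have hxe : ‖x - p‖ • (‖x - p‖⁻¹ • (x - p)) = x - p := smul_inv_smul₀ hx0.ne' _
  generalize ‖x - p‖⁻¹ • (x - p) = e₁ at he₁ hxe
  have h2 := h e₁ he₁
  simp only [IsThinAt] at h2
  push Not at h2
  obtain ⟨y, hy, hyR, hyκ⟩ := h2
  have hy0 := hκR.trans hyκ
  have horth : inner ℝ e₁ ((y - p) - inner ℝ (y - p) e₁ • e₁) = 0 := by
    rw [inner_sub_right, inner_smul_right, real_inner_self_eq_norm_sq, he₁, real_inner_comm]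
    ring
  have hye : inner ℝ (y - p) e₁ • e₁ + ‖(y - p) - inner ℝ (y - p) e₁ • e₁‖ •
      (‖(y - p) - inner ℝ (y - p) e₁ • e₁‖⁻¹ • ((y - p) - inner ℝ (y - p) e₁ • e₁)) = y - p := by
    rw [smul_inv_smul₀ hy0.ne', add_sub_cancel]
  refine ⟨e₁, ‖(y - p) - inner ℝ (y - p) e₁ • e₁‖⁻¹ • ((y - p) - inner ℝ (y - p) e₁ • e₁), ‖x - p‖,
    inner ℝ (y - p) e₁, ‖(y - p) - inner ℝ (y - p) e₁ • e₁‖, he₁, ?_, ?_, ?_, ?_, hxκ'.le, hyκ.le,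
    ?_, ?_, ?_⟩
  · rw [norm_smul, norm_inv, norm_norm, inv_mul_cancel₀ hy0.ne']
  · rw [inner_smul_right, horth, mul_zero]
  · rw [hxe, add_sub_cancel]
    exact hx
  · rw [hye, add_sub_cancel]
    exact hy
  · refine (abs_real_inner_le_norm _ _).trans ?_
    rwa [he₁, mul_one]
  · rwa [hxe]
  · rwa [hye]

namespace IsShortArc

variable {K : Set E3} {γ g A : ℝ → E3} {a b c : ℝ}

/-- The turning of the velocity in the plane of a fat triangle is bounded. -/
theorem exists_monotoneOn_of_not_isThinAt (h : IsShortArc K γ g A a b c) {κ R T : ℝ} (hκ : 0 < κ)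
    (hκ1 : κ ≤ 1) (hR : 0 < R) (hfat : ∀ u : E3, ‖u‖ = 1 → ¬IsThinAt K (γ a) u κ R) (haT : a ≤ T)
    (hTb : T ≤ b) (hTR : c * (T - a) ≤ 2 * R) :
    ∃ (n : E3) (M : ℝ → ℝ), ‖n‖ = 1 ∧ ContinuousOn M (Icc a T) ∧ MonotoneOn M (Icc a T) ∧
      M T - M a ≤ 54 * c / κ ^ 2 ∧ ∀ x ∈ Icc a T, ∀ y ∈ Icc a T, x ≤ y →
        ‖(g y - inner ℝ (g y) n • n) - (g x - inner ℝ (g x) n • n)‖ ≤ M y - M x := by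
  have hc := h.speed_pos
  have hsub : Icc a T ⊆ Icc a b := Icc_subset_Icc_right hTb
  obtain ⟨e₁, e₂, ℓ, β, η, he₁, he₂, he₁₂, hx, hy, hℓ, hη, hβ, hxR, hyR⟩ :=
    exists_triangle_of_not_isThinAt hκ hR hfat
  obtain ⟨n, hn, hproj⟩ := exists_eq_sum_inner_smul he₁ he₂ he₁₂
  -- The centroid: the products of `A` with the vectors to the three vertices add up to `-3 * ⟪γ -
  -- o, A⟫`.
  obtain ⟨o, ho⟩ : ∃ o : E3, (3 : ℝ) • o = γ a + (γ a + ℓ • e₁) + (γ a + (β • e₁ + η • e₂)) :=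
    ⟨(3 : ℝ)⁻¹ • _, smul_inv_smul₀ (by norm_num) _⟩
  have hoR : 3 * ‖γ a - o‖ ≤ 2 * R := by
    rw [← Real.norm_of_nonneg (show (0 : ℝ) ≤ 3 by norm_num), ← norm_smul, smul_sub, ho,
      show (3 : ℝ) • γ a - (γ a + (γ a + ℓ • e₁) + (γ a + (β • e₁ + η • e₂))) =
        -(ℓ • e₁ + (β • e₁ + η • e₂)) by module, norm_neg]
    linarith [norm_add_le (ℓ • e₁) (β • e₁ + η • e₂)]
  have hbound : ∀ t ∈ Icc a T, |inner ℝ (A t) e₁| + |inner ℝ (A t) e₂| ≤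
      9 / (κ ^ 2 * R) * -inner ℝ (γ t - o) (A t) := by
    intro t ht
    have h0 := h.inner_nonneg t (hsub ht) _ (h.mem a (left_mem_Icc.2 h.lt.le))
    have h1 := h.inner_nonneg t (hsub ht) _ hx
    have h2 := h.inner_nonneg t (hsub ht) _ hy
    have h3 := mul_abs_add_abs_le (x := inner ℝ (A t) e₁) (y := inner ℝ (A t) e₂) hκ hκ1 hR h0 h1 h2
      (by rw [real_inner_comm, ← inner_sub_left, sub_sub_sub_cancel_right, add_sub_cancel_left,
        inner_smul_left]; simp)
      (by rw [real_inner_comm e₁, real_inner_comm e₂, ← inner_sub_left, sub_sub_sub_cancel_right,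
        add_sub_cancel_left, inner_add_left, inner_smul_left, inner_smul_left]; simp) hℓ hη hβ
    rw [← inner_add_left, ← inner_add_left, show γ a - γ t + (γ a + ℓ • e₁ - γ t) +
      (γ a + (β • e₁ + η • e₂) - γ t) = -((3 : ℝ) • (γ t - o)) by rw [smul_sub, ho]; module,
      inner_neg_left, inner_smul_left] at h3
    simp only [conj_trivial] at h3
    rw [div_mul_eq_mul_div, le_div_iff₀ (by positivity)]
    linarith
  -- The bound has an explicit primitive, because `c ^ 2 - ⟪γ - o, g⟫'` equals `-⟪γ - o, A⟫`.
  have hM : ∀ t ∈ Icc a T, HasDerivWithinAt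
      (fun t => 9 / (κ ^ 2 * R) * (c ^ 2 * t - inner ℝ (γ t - o) (g t)))
      (9 / (κ ^ 2 * R) * -inner ℝ (γ t - o) (A t)) (Icc a T) t := by
    intro t ht
    have h1 := ((((hasDerivAt_id t).const_mul (c ^ 2)).hasDerivWithinAt).sub
      ((((h.velocity t (hsub ht)).mono hsub).sub_const o).inner ℝ
        ((h.acceleration t (hsub ht)).mono hsub))).const_mul (9 / (κ ^ 2 * R))
    rw [real_inner_self_eq_norm_sq, h.norm_velocity t (hsub ht)] at h1
    exact h1.congr_deriv (by ring)
  have hF : ∀ t ∈ Icc a T, HasDerivWithinAt (fun t => g t - inner ℝ (g t) n • n)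
      (A t - inner ℝ (A t) n • n) (Icc a T) t := by
    intro t ht
    have h0 := (h.acceleration t (hsub ht)).mono hsub
    have h1 := h0.sub ((h0.inner ℝ (hasDerivWithinAt_const t _ n)).smul_const n)
    exact h1.congr_deriv (by rw [inner_zero_right, zero_add])
  refine ⟨n, _, hn, fun t ht => (hM t ht).continuousWithinAt,
    sub_le_of_hasDerivWithinAt_nonneg hM fun t ht => le_trans (by positivity) (hbound t ht), ?_,
    norm_image_sub_le_of_norm_deriv_le hF hM fun t ht => ?_⟩
  · have haI := left_mem_Icc.2 h.lt.le
    have h1 := abs_le.1 (abs_real_inner_le_norm (γ T - o) (g T))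
    have h2 := abs_le.1 (abs_real_inner_le_norm (γ a - o) (g a))
    have h3 := norm_sub_le_norm_sub_add_norm_sub (γ T) (γ a) o
    have h4 := h.norm_sub_le le_rfl haT hTb
    rw [h.norm_velocity T ⟨haT, hTb⟩] at h1
    rw [h.norm_velocity a haI] at h2
    -- The terms add up to `(2 + 8/3 + 2/3) * R * c ≤ 6 * R * c`, and `9 * 6 = 54`.
    have h5 : ‖γ T - o‖ * c ≤ (2 * R + 2 / 3 * R) * c := by gcongr; linarith
    have h6 : ‖γ a - o‖ * c ≤ (2 / 3 * R) * c := by gcongr; linarith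
    have h7 : c * (c * (T - a)) ≤ c * (2 * R) := by gcongr
    have h8 : 0 < R * c := by positivity
    rw [← mul_sub]
    calc _ ≤ 9 / (κ ^ 2 * R) * (6 * (R * c)) := by
          gcongr
          linarith
      _ = _ := by field_simp; ring
  · rw [hproj]
    refine ((norm_add_le _ _).trans_eq ?_).trans (hbound t ht)
    rw [norm_smul, norm_smul, he₁, he₂, mul_one, mul_one, Real.norm_eq_abs, Real.norm_eq_abs]

/-- The total rise of `M` is cut into at most `N + 1` pieces of size `(ε / 10) ^ 2 * c`; on each of
them the velocity moves by at most `3 * (ε / 10) * c`, and `3π / 10 < 1`. -/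
theorem exists_angle_lt_of_not_isThinAt (h : IsShortArc K γ g A a b c) {ε R T : ℝ} (hε : 0 < ε)
    (hε1 : ε ≤ 1) (hR : 0 < R) (hfat : ∀ u : E3, ‖u‖ = 1 → ¬IsThinAt K (γ a) u ((ε / 40) ^ 2) R)
    (haT : a ≤ T) (hTb : T ≤ b) (hTR : c * (T - a) ≤ 2 * R) (v : ℝ → ℝ) {N : ℕ}
    (hN : 54 ≤ (N + 1 : ℕ) * (((ε / 40) ^ 2) ^ 2 * (ε / 10) ^ 2)) :
    ∃ s t, a ≤ s ∧ s ≤ t ∧ t ≤ T ∧ v T - v a ≤ (N + 1 : ℕ) * (v t - v s) ∧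
      ∃ u : E3, ‖u‖ = 1 ∧ ∀ x ∈ Icc s t, InnerProductGeometry.angle (g x) u < ε := by
  have hc := h.speed_pos
  have hκ : 0 < (ε / 40) ^ 2 := by positivity
  obtain ⟨n, M, hn, hMc, hMm, hM, hF⟩ := h.exists_monotoneOn_of_not_isThinAt hκ (by nlinarith) hR
    hfat haT hTb hTR
  generalize (ε / 40) ^ 2 = κ at *
  obtain ⟨s, t, has, hst, htT, hη, hv⟩ := exists_subinterval_of_continuousOn (M := M) (v := v)
    (η := (ε / 10) ^ 2 * c) (by positivity) N a haT hMc (by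
      refine hM.trans ?_
      rw [div_le_iff₀ (by positivity)]
      have := mul_le_mul_of_nonneg_right hN hc.le
      linarith)
  have hsub : Icc s t ⊆ Icc a T := Icc_subset_Icc has htT
  have hsubb : Icc s t ⊆ Icc a b := hsub.trans (Icc_subset_Icc_right hTb)
  refine ⟨s, t, has, hst, htT, hv, c⁻¹ • g s, ?_, fun x hx => ?_⟩
  · rw [norm_smul, norm_inv, h.norm_velocity s (hsubb (left_mem_Icc.2 hst)),
      Real.norm_of_nonneg hc.le, inv_mul_cancel₀ hc.ne']
  rw [InnerProductGeometry.angle_smul_right_of_pos _ _ (inv_pos.2 hc)]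
  have hgs := h.norm_velocity s (hsubb (left_mem_Icc.2 hst))
  have hsx : Icc s x ⊆ Icc s t := Icc_subset_Icc_right hx.2
  have h1 := norm_sub_le_of_norm_proj_sub_le (k := ε / 10) hn hx.1 hc (by positivity) (by linarith)
    (fun y hy => h.norm_velocity y (hsubb (hsx hy)))
    (h.continuousOn_velocity.mono (hsx.trans hsubb)) fun y hy z hz hyz => by
      refine (hF y (hsub (hsx hy)) z (hsub (hsx hz)) hyz).trans ?_
      have h2 := hMm (hsub (left_mem_Icc.2 hst)) (hsub (hsx hy)) hy.1
      have h3 := hMm (hsub (hsx hz)) (hsub (right_mem_Icc.2 hst)) (hsx hz).2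
      linarith
  refine (angle_le_pi_mul_norm_sub_div _ (norm_pos_iff.1 (by rw [hgs]; exact hc))).trans_lt ?_
  rw [hgs, div_lt_iff₀ hc]
  have hπ := Real.pi_lt_d2
  calc Real.pi * ‖g x - g s‖ ≤ Real.pi * (3 * (ε / 10) * c) := by gcongr
    _ ≤ 3.15 * (3 * (ε / 10) * c) := by gcongr
    _ < ε * c := by nlinarith [mul_pos hε hc]

/-- In the first half of a short arc there is a subarc in almost constant direction that carries a
definite part of the variation of the velocity. -/
theorem exists_angle_lt_left (h : IsShortArc K γ g A a b c) {ε m D : ℝ} (hε : 0 < ε) (hε1 : ε ≤ 1)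
    (hm : 2 * (m - a) = b - a) {v : ℝ → ℝ} (hv : v a < v m)
    (hvD : ∀ t ∈ Icc a b, v t - v a ≤ D * (t - a)) {N : ℕ}
    (hN : 54 ≤ (N + 1 : ℕ) * (((ε / 40) ^ 2) ^ 2 * (ε / 10) ^ 2)) :
    ∃ s t, a ≤ s ∧ s ≤ t ∧ t ≤ b ∧ v m - v a ≤ 2 * (N + 1 : ℕ) * (v t - v s) ∧
      ∃ u : E3, ‖u‖ = 1 ∧ ∀ x ∈ Icc s t, InnerProductGeometry.angle (g x) u < ε := by
  have hc := h.speed_pos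
  have ham : a < m := by linarith [h.lt]
  have hmb : m < b := by linarith
  have hlam : 0 < c * (m - a) := mul_pos hc (sub_pos.2 ham)
  have hN1 : (1 : ℝ) ≤ (N + 1 : ℕ) := by exact_mod_cast Nat.le_add_left 1 N
  have hpow : ∀ j : ℕ, 0 < (m - a) / 2 ^ j := fun j => div_pos (sub_pos.2 ham) (by positivity)
  have hpow' : ∀ j : ℕ, (m - a) / 2 ^ j ≤ m - a := fun j =>
    div_le_self (sub_pos.2 ham).le (one_le_pow₀ one_le_two)
  have hthin : ∀ j : ℕ, (∃ u : E3, ‖u‖ = 1 ∧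
      IsThinAt K (γ a) u ((ε / 40) ^ 2) (c * ((m - a) / 2 ^ j))) →
      v m - v a ≤ 2 * (v m - v (a + (m - a) / 2 ^ j)) →
      ∃ s t, a ≤ s ∧ s ≤ t ∧ t ≤ b ∧ v m - v a ≤ 2 * (N + 1 : ℕ) * (v t - v s) ∧
      ∃ u : E3, ‖u‖ = 1 ∧ ∀ x ∈ Icc s t, InnerProductGeometry.angle (g x) u < ε := by
    rintro j ⟨u, hu, hj⟩ hvj
    refine ⟨a + (m - a) / 2 ^ j, m, by linarith [hpow j], by linarith [hpow' j], hmb.le, ?_,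
      h.exists_angle_lt_of_isThinAt hu hε hε1 (mul_pos hc (hpow j)) hj (by linarith [hpow j])
        (by linarith [hpow' j]) hm.le (by rw [add_sub_cancel_left])⟩
    refine hvj.trans ?_
    have h1 : 1 * (v m - v (a + (m - a) / 2 ^ j)) ≤
        (N + 1 : ℕ) * (v m - v (a + (m - a) / 2 ^ j)) := by
      gcongr
      linarith
    linarith
  -- If all scales are thin, the Lipschitz bound on `v` makes the initial arc that is left out carry
  -- at most half of the increment.
  by_cases hall : ∀ j : ℕ, ∃ u : E3, ‖u‖ = 1 ∧
      IsThinAt K (γ a) u ((ε / 40) ^ 2) (c * ((m - a) / 2 ^ j))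
  · have hlim : Filter.Tendsto (fun j : ℕ => 2 * D * ((m - a) / 2 ^ j)) Filter.atTop (nhds 0) := by
      have h1 := (tendsto_const_nhds (x := 2 * D * (m - a))).div_atTop
        (tendsto_pow_atTop_atTop_of_one_lt (one_lt_two (α := ℝ)))
      simpa only [mul_div_assoc] using h1
    obtain ⟨j, hj⟩ := (hlim.eventually_lt_const (sub_pos.2 hv)).exists
    have h1 := hvD (a + (m - a) / 2 ^ j)
      ⟨by linarith [hpow j], by linarith [hpow' j]⟩
    rw [add_sub_cancel_left] at h1
    exact hthin j (hall j) (by linarith)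
  · push Not at hall
    classical
    obtain ⟨j, hj, hmin⟩ : ∃ j : ℕ, (∀ u : E3, ‖u‖ = 1 →
        ¬IsThinAt K (γ a) u ((ε / 40) ^ 2) (c * ((m - a) / 2 ^ j))) ∧ ∀ i < j,
        ¬∀ u : E3, ‖u‖ = 1 → ¬IsThinAt K (γ a) u ((ε / 40) ^ 2) (c * ((m - a) / 2 ^ i)) :=
      ⟨Nat.find hall, Nat.find_spec hall, fun i hi => Nat.find_min hall hi⟩
    have hfat : ∀ T, a ≤ T → T ≤ m → c * (T - a) ≤ 2 * (c * ((m - a) / 2 ^ j)) →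
        v m - v a ≤ 2 * (v T - v a) →
        ∃ s t, a ≤ s ∧ s ≤ t ∧ t ≤ b ∧ v m - v a ≤ 2 * (N + 1 : ℕ) * (v t - v s) ∧
        ∃ u : E3, ‖u‖ = 1 ∧ ∀ x ∈ Icc s t, InnerProductGeometry.angle (g x) u < ε := by
      intro T haT hTm hTR hvT
      obtain ⟨s, t, has, hst, htT, hvst, hu⟩ := h.exists_angle_lt_of_not_isThinAt hε hε1
        (mul_pos hc (hpow j)) hj haT (hTm.trans hmb.le) hTR v hN
      exact ⟨s, t, has, hst, htT.trans (hTm.trans hmb.le), by linarith, hu⟩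
    -- At the coarsest scale the fat case covers all of `[a, m]`. Otherwise scale `i` is thin and
    -- twice scale `i + 1`, so `a + (m - a) / 2 ^ i` separates the fat range from the thin one, and
    -- one side carries half.
    rcases j with _ | i
    · refine hfat m ham.le le_rfl ?_ (by linarith)
      rw [pow_zero, div_one]
      linarith
    · have hi := hmin i (Nat.lt_succ_self i)
      push Not at hi
      rcases le_total (v m - v a) (2 * (v m - v (a + (m - a) / 2 ^ i))) with h1 | h1
      · exact hthin i hi h1
      · refine hfat (a + (m - a) / 2 ^ i) (by linarith [hpow i]) (by linarith [hpow' i]) ?_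
          (by linarith)
        rw [add_sub_cancel_left, pow_succ]
        exact le_of_eq (by field_simp)

/-- Reversing time changes the sign of the velocity but not of the acceleration, so the acceleration
still points into `K`. -/
theorem reverse (h : IsShortArc K γ g A a b c) :
    IsShortArc K (fun t => γ (a + b - t)) (fun t => -g (a + b - t)) (fun t => A (a + b - t))
      a b c := by
  have hmaps : MapsTo (fun t => a + b - t) (Icc a b) (Icc a b) := fun t ht =>
    ⟨by linarith [ht.2], by linarith [ht.1]⟩
  have hd : ∀ t, HasDerivWithinAt (fun t => a + b - t) (-1) (Icc a b) t := fun t =>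
    ((hasDerivAt_id t).const_sub (a + b)).hasDerivWithinAt
  refine ⟨h.convex, h.lt, h.speed_pos, fun t ht => h.mem _ (hmaps ht), fun t ht => ?_, fun t ht => ?_,
    fun t ht => ?_, fun t ht => h.inner_nonneg _ (hmaps ht), fun t ht => h.normal _ (hmaps ht), ?_⟩
  · have := (h.velocity _ (hmaps ht)).scomp t (hd t) hmaps
    simpa [Function.comp_def] using this
  · rw [norm_neg, h.norm_velocity _ (hmaps ht)]
  · have := ((h.acceleration _ (hmaps ht)).scomp t (hd t) hmaps).fun_neg
    simpa [Function.comp_def] using this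
  · intro s hs t ht hst z z' h1 h2 h3
    have h4 := h.short _ (hmaps ht) _ (hmaps hs) (by linarith) z' z
      (by rwa [segment_symm]) (by rwa [segment_symm]) (by rwa [segment_symm])
    simp only at h4
    rw [norm_sub_rev z' (γ _), norm_sub_rev z z', norm_sub_rev (γ _) z] at h4
    linarith

/-- A short arc has a subarc in almost constant direction that carries a definite part of the
variation of the velocity. -/
theorem exists_angle_lt (h : IsShortArc K γ g A a b c) {ε D : ℝ} (hε : 0 < ε) (hε1 : ε ≤ 1)
    {v : ℝ → ℝ} (hv : v a < v b)
    (hvD : ∀ s ∈ Icc a b, ∀ t ∈ Icc a b, s ≤ t → v t - v s ≤ D * (t - s)) {N : ℕ}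
    (hN : 54 ≤ (N + 1 : ℕ) * (((ε / 40) ^ 2) ^ 2 * (ε / 10) ^ 2)) :
    ∃ s t, a ≤ s ∧ s ≤ t ∧ t ≤ b ∧ v b - v a ≤ 4 * (N + 1 : ℕ) * (v t - v s) ∧
      ∃ u : E3, ‖u‖ = 1 ∧ ∀ x ∈ Icc s t, InnerProductGeometry.angle (g x) u < ε := by
  obtain ⟨m, hm⟩ : ∃ m, 2 * m = a + b := ⟨(a + b) / 2, by ring⟩
  have haI := left_mem_Icc.2 h.lt.le
  have hbI := right_mem_Icc.2 h.lt.le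
  rcases le_total (v b - v a) (2 * (v m - v a)) with h1 | h1
  · obtain ⟨s, t, has, hst, htb, hvst, hu⟩ := h.exists_angle_lt_left hε hε1 (m := m) (by linarith)
      (v := v) (by linarith) (fun t ht => hvD a haI t ht ht.1) hN
    exact ⟨s, t, has, hst, htb, by linarith, hu⟩
  · obtain ⟨s, t, has, hst, htb, hvst, u, hu, hsu⟩ := h.reverse.exists_angle_lt_left (D := D) hε hε1
      (m := m) (by linarith) (v := fun t => -v (a + b - t))
      (by rw [add_sub_cancel_left, show a + b - m = m by linarith]; linarith)
      (fun t ht => by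
        have := hvD (a + b - t) ⟨by linarith [ht.2], by linarith [ht.1]⟩ b hbI (by linarith [ht.1])
        rw [add_sub_cancel_left]
        linarith) hN
    rw [add_sub_cancel_left, show a + b - m = m by linarith] at hvst
    refine ⟨a + b - t, a + b - s, by linarith, by linarith, by linarith, by linarith, -u,
      by rw [norm_neg, hu], fun x hx => ?_⟩
    have := hsu (a + b - x) ⟨by linarith [hx.2], by linarith [hx.1]⟩
    rw [sub_sub_cancel] at this
    rwa [← InnerProductGeometry.angle_neg_neg, neg_neg]

end IsShortArc

/-! ### Arcs in almost constant direction -/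

/-- An additive real-valued function replaces the extended variation, so that increments can be
compared by linear arithmetic. -/
theorem exists_variation_function {g : ℝ → E3} {a b D : ℝ} (hab : a ≤ b)
    (hD : ∀ s ∈ Icc a b, ∀ t ∈ Icc a b, s ≤ t → ‖g t - g s‖ ≤ D * (t - s)) :
    ∃ v : ℝ → ℝ, ∀ s ∈ Icc a b, ∀ t ∈ Icc a b, s ≤ t →
      eVariationOn g (Icc s t) = ENNReal.ofReal (v t - v s) ∧ v t - v s ≤ D * (t - s) ∧
        ‖g t - g s‖ ≤ v t - v s := by
  have hle : ∀ s ∈ Icc a b, ∀ t ∈ Icc a b, s ≤ t →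
      eVariationOn g (Icc s t) ≤ ENNReal.ofReal (D * (t - s)) := fun s hs t ht hst => by
    have hsub : Icc s t ⊆ Icc a b := Icc_subset_Icc hs.1 ht.2
    rw [mul_sub]
    refine eVariationOn_le_ofReal_of_norm_sub_le (Ψ := fun x => D * x) hst fun x hx y hy hxy => ?_
    exact (hD x (hsub hx) y (hsub hy) hxy).trans_eq (mul_sub _ _ _)
  have haI := left_mem_Icc.2 hab
  have hbI := right_mem_Icc.2 hab
  have hbv : LocallyBoundedVariationOn g (Icc a b) := fun x y hx hy => by
    refine ne_top_of_le_ne_top ENNReal.ofReal_ne_top ((eVariationOn.mono g ?_).trans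
      (hle a haI b hbI hab))
    exact inter_subset_left
  refine ⟨variationOnFromTo g (Icc a b) a, fun s hs t ht hst => ?_⟩
  have h1 := variationOnFromTo.add hbv haI hs ht
  rw [variationOnFromTo.eq_of_le _ _ hst, inter_eq_right.2 (Icc_subset_Icc hs.1 ht.2)] at h1
  have hfin := ne_top_of_le_ne_top ENNReal.ofReal_ne_top (hle s hs t ht hst)
  rw [← h1, add_sub_cancel_left, ENNReal.ofReal_toReal hfin]
  have hD0 : 0 ≤ D * (t - s) := (norm_nonneg _).trans (hD s hs t ht hst)
  refine ⟨rfl, ENNReal.toReal_le_of_le_ofReal hD0 (hle s hs t ht hst), ?_⟩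
  have h2 := eVariationOn.edist_le g (right_mem_Icc.2 hst) (left_mem_Icc.2 hst)
  rw [edist_dist, dist_eq_norm] at h2
  exact (ENNReal.ofReal_le_iff_le_toReal hfin).1 h2

/-- The first condition reads `13824 * 10 ^ 6 ≤ (N + 1) * ε ^ 6`; rounding up costs at most `ε ^ 6 ≤
1`. -/
theorem exists_nat_le_mul {ε : ℝ} (hε : 0 < ε) (hε1 : ε ≤ 1) :
    ∃ N : ℕ, 54 ≤ (N + 1 : ℕ) * (((ε / 40) ^ 2) ^ 2 * (ε / 10) ^ 2) ∧
      (N + 1 : ℕ) * ε ^ 6 ≤ 14 * 10 ^ 9 := by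
  have h6 : 0 < ε ^ 6 := by positivity
  have h61 : ε ^ 6 ≤ 1 := pow_le_one₀ hε.le hε1
  have h1 := (Nat.lt_floor_add_one (13824 * 10 ^ 6 / ε ^ 6)).le
  have h2 := Nat.floor_le (show 0 ≤ 13824 * 10 ^ 6 / ε ^ 6 by positivity)
  rw [div_le_iff₀ h6] at h1
  rw [le_div_iff₀ h6] at h2
  refine ⟨⌊13824 * 10 ^ 6 / ε ^ 6⌋₊, ?_, ?_⟩ <;> push_cast
  · calc (54 : ℝ) = 13824 * 10 ^ 6 / 256000000 := by norm_num
      _ ≤ ((⌊13824 * 10 ^ 6 / ε ^ 6⌋₊ : ℝ) + 1) * ε ^ 6 / 256000000 := by gcongr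
      _ = _ := by ring
  · linarith

/-! ### From short arcs back to minimizing geodesics -/

namespace IsGeodesicOnBody

variable {K : Set E3} {γ : ℝ → E3} {a b : ℝ} {c : ℝ≥0}

theorem notMem_interior (h : IsGeodesicOnBody K γ a b c) {t : ℝ} (ht : t ∈ Icc a b) :
    γ t ∉ interior K := (h.geodesic.mapsTo ht).2

theorem injOn (h : IsGeodesicOnBody K γ a b c) : InjOn γ (Icc a b) := by
  have hne : ∀ s ∈ Icc a b, ∀ t ∈ Icc a b, s < t → γ s ≠ γ t := fun s hs t ht hst heq => by
    have h1 : IsJoinedBy (interior K)ᶜ s t (γ s) (γ t) (ENNReal.ofReal ‖γ t - γ s‖) := by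
      refine isJoinedBy_of_segment_subset hst ?_
      rw [heq, segment_same, singleton_subset_iff]
      exact h.notMem_interior ht
    have h2 := h.geodesic.le_of_isJoinedBy h.isClosed h.convex h.speed hs.1 hst.le ht.2 h1
    rw [heq, sub_self, norm_zero, ENNReal.ofReal_zero, nonpos_iff_eq_zero,
      ENNReal.ofReal_eq_zero] at h2
    exact h2.not_gt (mul_pos h.speed_pos (sub_pos.2 hst))
  intro s hs t ht heq
  rcases lt_trichotomy s t with hst | hst | hst
  · exact absurd heq (hne s hs t ht hst)
  · exact hst
  · exact absurd heq.symm (hne t ht s hs hst)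

theorem isShortArc (h : IsGeodesicOnBody K γ a b c) {g A : ℝ → E3}
    (hγ : ∀ t ∈ Icc a b, HasDerivWithinAt γ (g t) (Icc a b) t) (hgc : ∀ t ∈ Icc a b, ‖g t‖ = c)
    (hg : ∀ t ∈ Icc a b, HasDerivWithinAt g (A t) (Icc a b) t)
    (hA : ∀ t ∈ Icc a b, ∀ x ∈ K, 0 ≤ inner ℝ (x - γ t) (A t)) : IsShortArc K γ g A a b c where
  convex := h.convex
  lt := h.geodesic.lt
  speed_pos := h.speed_pos
  mem := fun _ ht => h.isClosed.frontier_subset (h.geodesic.mapsTo ht)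
  velocity := hγ
  norm_velocity := hgc
  acceleration := hg
  inner_nonneg := hA
  normal := fun t ht => by
    obtain ⟨ν, hν, hK⟩ := h.exists_supporting_normal ht
    exact ⟨ν, norm_ne_zero_iff.1 (by rw [hν]; exact one_ne_zero), hK⟩
  short := fun s hs t ht hst z z' h1 h2 h3 => by
    obtain ⟨m, hsm, hmt⟩ := exists_between hst
    obtain ⟨n, hmn, hnt⟩ := exists_between hmt
    have h4 := ((isJoinedBy_of_segment_subset hsm h1).trans hsm.le hmn.le
      (isJoinedBy_of_segment_subset hmn h2)).trans (hsm.le.trans hmn.le) hnt.le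
      (isJoinedBy_of_segment_subset hnt h3)
    have h5 := h.geodesic.le_of_isJoinedBy h.isClosed h.convex h.speed hs.1 hst.le ht.2 h4
    rw [← ENNReal.ofReal_add (norm_nonneg _) (norm_nonneg _),
      ← ENNReal.ofReal_add (by positivity) (norm_nonneg _)] at h5
    exact (ENNReal.ofReal_le_ofReal_iff (by positivity)).1 h5

theorem exists_arc (h : IsGeodesicOnBody K γ a b c) {ε : ℝ} (hε : 0 < ε) (hε1 : ε ≤ 1) :
    ∃ a' b' : ℝ, a ≤ a' ∧ a' < b' ∧ b' ≤ b ∧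
      ENNReal.ofReal (ε ^ 6 / 10 ^ 12) * totalCurvature γ a b < totalCurvature γ a' b' ∧
      ∃ u : E3, ‖u‖ = 1 ∧ ∀ t ∈ Icc a' b', ∃ v : E3,
        HasDerivWithinAt γ v (Icc a b) t ∧ v ≠ 0 ∧ InnerProductGeometry.angle v u < ε := by
  obtain ⟨g, A, hγ, hgc, hg, hAc, hAK, hA0⟩ := h.exists_acceleration
  have hab := h.geodesic.lt
  have hc : (0 : ℝ) < c := h.speed_pos
  have haI := left_mem_Icc.2 hab.le
  have hbI := right_mem_Icc.2 hab.le
  obtain ⟨D, hD⟩ := isCompact_Icc.exists_bound_of_continuousOn hAc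
  obtain ⟨v, hv⟩ := exists_variation_function hab.le (D := D) fun s hs t ht hst =>
    (norm_image_sub_le_of_norm_deriv_le hg (B := fun t => D * t) (B' := fun _ => D)
      (fun t _ => by simpa using ((hasDerivAt_id t).const_mul D).hasDerivWithinAt) hD
      s hs t ht hst).trans_eq (mul_sub _ _ _).symm
  -- Without variation `g` would be constant and `A a = 0`. This positivity makes the final
  -- inequality strict.
  have hvab : v a < v b := by
    by_contra! hle
    have hconst : ∀ t ∈ Icc a b, g t = g a := fun t ht => by
      have h1 := (hv a haI t ht ht.1).2.2
      have h2 := (norm_nonneg _).trans (hv t ht b hbI ht.2).2.2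
      exact sub_eq_zero.1 (norm_le_zero_iff.1 (by linarith))
    exact hA0 a haI ((uniqueDiffOn_Icc hab a haI).eq_deriv _ (hg a haI)
      ((hasDerivWithinAt_const a (Icc a b) (g a)).congr hconst rfl))
  obtain ⟨N, hN, hN'⟩ := exists_nat_le_mul hε hε1
  obtain ⟨s, t, has, hst, htb, hvst, u, hu, hsu⟩ := (h.isShortArc hγ hgc hg hAK).exists_angle_lt
    hε hε1 hvab (fun s hs t ht hst => (hv s hs t ht hst).2.1) hN
  have hsub : Icc s t ⊆ Icc a b := Icc_subset_Icc has htb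
  have hw : 0 < v t - v s := by
    by_contra! hle
    have h1 : 4 * ((N + 1 : ℕ) : ℝ) * (v t - v s) ≤ 0 :=
      mul_nonpos_of_nonneg_of_nonpos (by positivity) hle
    linarith
  have hlt : s < t := hst.lt_of_ne fun heq => by simp [heq] at hw
  refine ⟨s, t, has, hlt, htb, ?_, u, hu, fun x hx => ⟨g x, hγ x (hsub hx),
    norm_pos_iff.1 (by rw [hgc x (hsub hx)]; exact hc), hsu x hx⟩⟩
  have hup := totalCurvature_le hc hγ hgc fun s hs t ht hst => (hv s hs t ht hst).2.2
  have hlow : ENNReal.ofReal ((v t - v s) / c) ≤ totalCurvature γ s t := by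
    rw [ENNReal.ofReal_div_of_pos hc]
    refine ENNReal.div_le_of_le_mul' ?_
    rw [← (hv s (hsub (left_mem_Icc.2 hst)) t (hsub (right_mem_Icc.2 hst)) hst).1]
    exact eVariationOn_velocity_le hc hlt (h.injOn.mono hsub)
      (fun x hx => (hγ x (hsub hx)).mono hsub) (fun x hx => hgc x (hsub hx))
      fun x hx => ((hg x (hsub hx)).mono hsub).continuousWithinAt
  refine lt_of_lt_of_le ?_ hlow
  refine (mul_le_mul_right hup _).trans_lt ?_
  rw [← ENNReal.ofReal_mul (by positivity), ENNReal.ofReal_lt_ofReal_iff (by positivity),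
    mul_div_assoc', div_lt_div_iff_of_pos_right hc]
  have hπ := Real.pi_lt_d2
  have hπ0 := Real.pi_pos
  -- The loss is `4π` from total curvature and `4 * (N + 1)` from the choice of the arc; with `(N +
  -- 1) * ε ^ 6 ≤ 14 * 10 ^ 9` the product stays below `1`.
  calc ε ^ 6 / 10 ^ 12 * (4 * Real.pi * (v b - v a))
      ≤ ε ^ 6 / 10 ^ 12 * (4 * 3.15 * (4 * (N + 1 : ℕ) * (v t - v s))) := by gcongr
    _ = ((N + 1 : ℕ) * ε ^ 6) * (4 * 3.15 * 4 / 10 ^ 12) * (v t - v s) := by ring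
    _ ≤ (14 * 10 ^ 9) * (4 * 3.15 * 4 / 10 ^ 12) * (v t - v s) := by gcongr
    _ < v t - v s := by linarith

end IsGeodesicOnBody

theorem hasAlmostConstantArcs {ε : ℝ} (hε : 0 < ε) (hε1 : ε ≤ 1) :
    HasAlmostConstantArcs ε (ε ^ 6 / 10 ^ 12) := by
  rintro S ⟨K, hK, hconv, -, rfl, hsmooth, hcurv⟩ γ a b hγ
  obtain ⟨c, hc, hspeed⟩ := hγ.constantSpeed
  exact IsGeodesicOnBody.exists_arc ⟨hK, hconv, hsmooth, hcurv, hγ, hc, hspeed⟩ hε hε1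

theorem HasAlmostConstantArcs.mono {ε ε' δ δ' : ℝ} (h : HasAlmostConstantArcs ε δ) (hε : ε ≤ ε')
    (hδ : δ' ≤ δ) : HasAlmostConstantArcs ε' δ' := by
  intro S hS γ a b hγ
  obtain ⟨a', b', ha, hab, hb, hΦ, u, hu, hv⟩ := h S hS γ a b hγ
  refine ⟨a', b', ha, hab, hb, lt_of_le_of_lt (by gcongr) hΦ, u, hu, fun t ht => ?_⟩
  obtain ⟨v, h1, h2, h3⟩ := hv t ht
  exact ⟨v, h1, h2, h3.trans_le hε⟩

theorem mainTheorem5 :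
    (∀ ε : ℝ, 0 < ε → ∃ δ : ℝ, 0 < δ ∧ HasAlmostConstantArcs ε δ) ∧
      HasAlmostConstantArcs (1 / 10) (1 / 100 ^ 100) := by
  refine ⟨fun ε hε => ?_, ?_⟩
  · have h0 : 0 < min ε 1 := lt_min hε one_pos
    exact ⟨min ε 1 ^ 6 / 10 ^ 12, by positivity,
      (hasAlmostConstantArcs h0 (min_le_right _ _)).mono (min_le_left _ _) le_rfl⟩
  · exact (hasAlmostConstantArcs (by norm_num) (by norm_num)).mono le_rfl (by norm_num)
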